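/- Let $\mu,\nu$ be finite positive Borel measures on $\mathbb R$ with $\mu(\mathbb R)=\nu(\mathbb R)>0$. *Notation.* Let $\mathrm{Marg}(\gamma_1,\gamma_2)$ be the set of finite positive Borel measures on $\mathbb R^2$ with marginals $\gamma_1,\gamma_2$, and let $\mathfrak C(\mu,\nu)$ be the set of those $\pi\in\mathrm{Marg}(\mu,\nu)$ that are concentrated on a Borel set $\Gamma\subset\mathbb R^2$ which is cyclically monotone, i.e. $\sum_{i=1}^n|y_i-x_i|\le\sum_{i=1}^n|y_{i+1}-x_i|$ for all $n\ge1$ and $(x_1,y_1),\dots,(x_n,y_n)\in\Gamma$ (with $y_{n+1}=y_1$). For finite measures $\gamma_1,\gamma_2$ on the same space, let $\mathrm{Ent}(\gamma_1|\gamma_2)=\int \frac{d\gamma_1}{d\gamma_2}\log\frac{d\gamma_1}{d\gamma_2}\,d\gamma_2\in\,]-\infty,+\infty]$ if $\gamma_1\ll\gamma_2$, and $+\infty$ otherwise. A finite measure on $\mathbb R^2$ is strongly multiplicative if it is the restriction of a product $\eta_1\otimes\eta_2$ of $\sigma$-finite measures on $\mathbb R$ to $\mathrm F=\{(x,y): x\le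 y\}$. *Decomposition.* Put $F_\gamma^+(t)=\gamma(]-\infty,t])$, $F_\gamma^-(t)=\gamma(]-\infty,t[)$, $$E^+=\{F_\mu^+>F_\nu^+\}\cap\{F_\mu^->F_\nu^-\},\quad E^-=\{F_\mu^+<F_\nu^+\}\cap\{F_\mu^-<F_\nu^-\},\quad E^= =\mathbb R\setminus(E^+\cup E^-).$$ The sets $E^\pm$ are open; let $(]a_k^\pm,b_k^\pm[)_{k\in\mathcal K^\pm}$ be the connected components of $E^\pm$, and $B\subset\mathbb R$ the set of all their finite endpoints. Define $$\mu_k^+=(F_\mu^+(a_k^+)-F_\nu^+(a_k^+))\delta_{a_k^+}+\mu|_{]a_k^+,b_k^+[},\qquad \nu_k^+=\nu|_{]a_k^+,b_k^+[}+(F_\mu^-(b_k^+)-F_\nu^-(b_k^+))\delta_{b_k^+},$$ $$\mu_k^-=\mu|_{]a_k^-,b_k^-[}+(F_\nu^-(b_k^-)-F_\mu^-(b_k^-))\delta_{b_k^-},\qquad \nu_k^-=(F_\nu^+(a_k^-)-F_\mu^+(a_k^-))\delta_{a_k^-}+\nu|_{]a_k^-,b_k^-[},$$ where point masses at infinite endpoints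 are omitted, and, with $\mu^\pm=\sum_{k\in\mathcal K^\pm}\mu_k^\pm$, $$\mu^= =\mu|_{E^=\setminus B}+\sum_{x\in B}\big(\mu(\{x\})-\mu^+(\{x\})-\mu^-(\{x\})\big)\delta_x .$$ *Theorem.* For every $k\in\mathcal K^+$ the set $\mathrm{Marg}(\mu_k^+,\nu_k^+)$ contains exactly one strongly multiplicative measure, denoted $\mathcal K_{\mathrm F}(\mu_k^+,\nu_k^+)$; for every $k\in\mathcal K^-$ the set $\mathrm{Marg}(\nu_k^-,\mu_k^-)$ contains exactly one strongly multiplicative measure, denoted $\mathcal K_{\mathrm F}(\nu_k^-,\mu_k^-)$. Let $i(x,y)=(y,x)$. The generalized Kellerer transport plan $$\mathcal K(\mu,\nu)=\sum_{k\in\mathcal K^+}\mathcal K_{\mathrm F}(\mu_k^+,\nu_k^+)+\sum_{k\in\mathcal K^-}i_\#\mathcal K_{\mathrm F}(\nu_k^-,\mu_k^-)+(\mathrm{id},\mathrm{id})_\#\mu^=$$ belongs to $\mathfrak C(\mu,\nu)$, and $$\mathrm{Ent}(\mathcal K(\mu,\nu)\,|\,\mu\otimes\nu)=\min_{\pi\in\mathfrak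 C(\mu,\nu)}\mathrm{Ent}(\pi\,|\,\mu\otimes\nu).$$ -/

import Mathlib

open MeasureTheory Set

noncomputable section

namespace Kellerer

/-- Transport plans from `γ₁` to `γ₂`: finite measures on the plane with marginals `γ₁`, `γ₂`. -/
def Marg (γ₁ γ₂ : Measure ℝ) : Set (Measure (ℝ × ℝ)) :=
  {π | IsFiniteMeasure π ∧ π.map Prod.fst = γ₁ ∧ π.map Prod.snd = γ₂}

/-- Cyclical monotonicity for the cost `|y - x|`. The indices are taken in `Fin (n + 1)`, where
`i + 1` is the cyclic successor, so families of every length at least one are covered. -/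
def IsCyclicallyMonotone (Γ : Set (ℝ × ℝ)) : Prop :=
  ∀ (n : ℕ) (p : Fin (n + 1) → ℝ × ℝ), (∀ i, p i ∈ Γ) →
    ∑ i, |(p i).2 - (p i).1| ≤ ∑ i, |(p (i + 1)).2 - (p i).1|

/-- Cyclically monotone transport plans: those concentrated on a Borel cyclically monotone set. -/
def cyclMonPlans (γ₁ γ₂ : Measure ℝ) : Set (Measure (ℝ × ℝ)) :=
  {π | π ∈ Marg γ₁ γ₂ ∧ ∃ Γ : Set (ℝ × ℝ), MeasurableSet Γ ∧ IsCyclicallyMonotone Γ ∧ π Γᶜ = 0}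

/-- The integrand `t log t` of the entropy, where `t` is the density of `γ₁` with respect
to `γ₂`. -/
def entIntegrand {S : Type*} [MeasurableSpace S] (γ₁ γ₂ : Measure S) (z : S) : ℝ :=
  (γ₁.rnDeriv γ₂ z).toReal * Real.log (γ₁.rnDeriv γ₂ z).toReal

open Classical in
/-- Relative entropy `Ent(γ₁ | γ₂)` of finite measures, with values in `]-∞, +∞]`. The integral is
written as the integral of the positive part, which may be infinite, minus that of the negative
part, which is at most `γ₂(S) / e`. -/
def Ent {S : Type*} [MeasurableSpace S] (γ₁ γ₂ : Measure S) : EReal :=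
  if γ₁ ≪ γ₂ then
    ((∫⁻ z, ENNReal.ofReal (entIntegrand γ₁ γ₂ z) ∂γ₂ : ENNReal) : EReal)
      - ((∫⁻ z, ENNReal.ofReal (-entIntegrand γ₁ γ₂ z) ∂γ₂ : ENNReal) : EReal)
  else ⊤

/-- Right-continuous cumulative distribution function, `t ↦ γ(]-∞, t])`. -/
def cdfR (γ : Measure ℝ) (t : ℝ) : ℝ := γ.real (Iic t)

/-- Left-continuous cumulative distribution function, `t ↦ γ(]-∞, t[)`. -/
def cdfL (γ : Measure ℝ) (t : ℝ) : ℝ := γ.real (Iio t)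

/-- `E⁺`. -/
def Epos (μ ν : Measure ℝ) : Set ℝ := {t | cdfR ν t < cdfR μ t ∧ cdfL ν t < cdfL μ t}

/-- `E⁻`. -/
def Eneg (μ ν : Measure ℝ) : Set ℝ := {t | cdfR μ t < cdfR ν t ∧ cdfL μ t < cdfL ν t}

/-- `E⁼`, the complement of the union of `E⁺` and `E⁻`. -/
def Eeq (μ ν : Measure ℝ) : Set ℝ := (Epos μ ν ∪ Eneg μ ν)ᶜ

/-- The set of connected components of a subset of the line. -/
def comps (E : Set ℝ) : Set (Set ℝ) := connectedComponentIn E '' E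

/-- The finite endpoints of the connected components of `E⁺` and `E⁻`. -/
def bdryPts (μ ν : Measure ℝ) : Set ℝ :=
  {x | ∃ I ∈ comps (Epos μ ν) ∪ comps (Eneg μ ν),
    (BddBelow I ∧ x = sInf I) ∨ (BddAbove I ∧ x = sSup I)}

open Classical in
/-- The point mass `w(a) δ_a` at the left endpoint `a` of the interval `I`; zero if `a = -∞`. -/
def leftAtom (I : Set ℝ) (w : ℝ → ℝ) : Measure ℝ :=
  if BddBelow I then ENNReal.ofReal (w (sInf I)) • Measure.dirac (sInf I) else 0

open Classical in
/-- The point mass `w(b) δ_b` at the right endpoint `b` of the interval `I`; zero if `b = +∞`. -/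
def rightAtom (I : Set ℝ) (w : ℝ → ℝ) : Measure ℝ :=
  if BddAbove I then ENNReal.ofReal (w (sSup I)) • Measure.dirac (sSup I) else 0

/-- `μ_k⁺`, for the connected component `I = ]a_k, b_k[` of `E⁺`. -/
def muPos (μ ν : Measure ℝ) (I : Set ℝ) : Measure ℝ :=
  leftAtom I (fun a => cdfR μ a - cdfR ν a) + μ.restrict I

/-- `ν_k⁺`, for the connected component `I = ]a_k, b_k[` of `E⁺`. -/
def nuPos (μ ν : Measure ℝ) (I : Set ℝ) : Measure ℝ :=
  ν.restrict I + rightAtom I (fun b => cdfL μ b - cdfL ν b)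

/-- `μ_k⁻`, for the connected component `I = ]a_k, b_k[` of `E⁻`. -/
def muNeg (μ ν : Measure ℝ) (I : Set ℝ) : Measure ℝ :=
  μ.restrict I + rightAtom I (fun b => cdfL ν b - cdfL μ b)

/-- `ν_k⁻`, for the connected component `I = ]a_k, b_k[` of `E⁻`. -/
def nuNeg (μ ν : Measure ℝ) (I : Set ℝ) : Measure ℝ :=
  leftAtom I (fun a => cdfR ν a - cdfR μ a) + ν.restrict I

/-- `μ⁺`, the sum of the `μ_k⁺`. -/
def muPosSum (μ ν : Measure ℝ) : Measure ℝ :=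
  Measure.sum fun I : comps (Epos μ ν) => muPos μ ν (I : Set ℝ)

/-- `μ⁻`, the sum of the `μ_k⁻`. -/
def muNegSum (μ ν : Measure ℝ) : Measure ℝ :=
  Measure.sum fun I : comps (Eneg μ ν) => muNeg μ ν (I : Set ℝ)

/-- `μ⁼`, the fixed part: the restriction of `μ` to the points of `E⁼` that are not endpoints,
plus the mass that remains at the endpoints. -/
def muEq (μ ν : Measure ℝ) : Measure ℝ :=
  μ.restrict ((bdryPts μ ν)ᶜ ∩ Eeq μ ν) +
    Measure.sum fun x : bdryPts μ ν =>
      (μ {(x : ℝ)} - muPosSum μ ν {(x : ℝ)} - muNegSum μ ν {(x : ℝ)}) • Measure.dirac (x : ℝ)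

/-- The half-plane `F`. -/
def halfPlane : Set (ℝ × ℝ) := {p | p.1 ≤ p.2}

/-- Strong multiplicativity: `π` is the restriction to `F` of a product of σ-finite measures. -/
def IsStronglyMult (π : Measure (ℝ × ℝ)) : Prop :=
  ∃ η₁ η₂ : Measure ℝ, SigmaFinite η₁ ∧ SigmaFinite η₂ ∧ π = (η₁.prod η₂).restrict halfPlane

open Classical in
/-- The Kellerer plan `K_F(γ₁, γ₂)`: the strongly multiplicative transport plan from `γ₁` to `γ₂`
(zero if there is none). -/
def planF (γ₁ γ₂ : Measure ℝ) : Measure (ℝ × ℝ) :=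
  if h : ∃ π, π ∈ Marg γ₁ γ₂ ∧ IsStronglyMult π then h.choose else 0

/-- The Kellerer plan for the opposite half-plane, obtained by exchanging the coordinates. -/
def planFswap (γ₁ γ₂ : Measure ℝ) : Measure (ℝ × ℝ) := (planF γ₂ γ₁).map Prod.swap

/-- The generalized Kellerer transport plan `K(μ, ν)`. -/
def plan (μ ν : Measure ℝ) : Measure (ℝ × ℝ) :=
  (Measure.sum fun I : comps (Epos μ ν) => planF (muPos μ ν (I : Set ℝ)) (nuPos μ ν (I : Set ℝ)))
    + (Measure.sum fun I : comps (Eneg μ ν) =>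
        planFswap (muNeg μ ν (I : Set ℝ)) (nuNeg μ ν (I : Set ℝ)))
    + (muEq μ ν).map (fun x => (x, x))

end Kellerer

end

open MeasureTheory Set

set_option linter.unusedSectionVars false

noncomputable section

namespace Kellerer

/-! The problem splits into independent problems on the components of E⁺ and E⁻. A cyclically
monotone plan never moves mass across a point in both directions (`noCross_of_mem_cyclMonPlans`), so
the mass it moves to the right across t is the positive part of F_μ(t) − F_ν(t)
(`Marg.measure_right`, `Marg.measure_left`). Hence mass moves to the right only within a component
of E⁺, to the left only within one of E⁻, and otherwise stays put. The plan is therefore a sum over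
disjoint cells of the plane; its part in a cell has the marginals μ_k, ν_k whatever the plan was
(`Marg.restrict_cell`), and the remainder is the diagonal image of μ⁼ (`Marg.restrict_restPart`).
Divergences relative to μ ⊗ ν are compared cell by cell (`klDiv_le_of_partition`). The quantile
coupling provides one plan without crossings, and the needed facts about μ_k and ν_k are read off
from it. Conversely, the Kellerer plan is concentrated on pairs along which a 1-Lipschitz function,
of slope 1 on E⁺ and −1 on E⁻, attains the distance, hence on a cyclically monotone set.

In a cell the marginals γ₁, γ₂ form an `Irreducible` pair, and the multiplicative plan is explicit.
With F₁, F₂ the distribution functions, let lag(v) = v − γ₂{F₁ < v} for a level v, and let L be a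
primitive of 1/lag. The first factor has distribution function exp(L ∘ F₁), the second has density
exp(−L ∘ F₁) with respect to γ₂. The two cancel, so the second marginal is γ₂. By Tonelli the second
factor gives ]t, ∞[ the mass exp(−L(F₁(t)))(F₁(t) − F₂(t))
(`Irreducible.lintegral_exp_neg_logFactor`); thus the mass crossing t is F₁(t) − F₂(t), which yields
the first marginal. Working with levels instead of points treats atoms uniformly. Uniqueness is a
monotonicity argument (`restrict_prod_unique`).

For minimality, the logarithm of the density of K relative to γ₁ ⊗ γ₂ is −b(x) − l(y) on F. Gibbs'
inequality would conclude at once if b and l were integrable. Instead, write −b(x) − l(y) = −(b +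
l)(x) − (l(y) − l(x)). The first term depends on x only and is bounded below. The second bracket is
non-negative along plans to the right, and its integral is finite and determined by the marginals,
because it integrates 1/lag over the levels that are passed (`Irreducible.lintegral_logFactor_sub`).
This is what `klDiv_le_of_density` requires. -/

/-! ### Uniqueness of strongly multiplicative plans -/

/-- Two σ-finite measures have densities adding up to one with respect to their sum. -/
lemma exists_density_add {S : Type*} [MeasurableSpace S] (η η' : Measure S) [SigmaFinite η]
    [SigmaFinite η'] :
    ∃ p : S → ℝ, Measurable p ∧ (∀ x, 0 ≤ p x) ∧ (∀ x, p x ≤ 1) ∧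
      η = (η + η').withDensity (fun x => ENNReal.ofReal (p x)) ∧
      η' = (η + η').withDensity (fun x => ENNReal.ofReal (1 - p x)) := by
  set ρ := η + η' with hρ
  have h1 : η ≪ ρ := Measure.absolutelyContinuous_of_le (Measure.le_add_right le_rfl)
  have h2 : η' ≪ ρ := Measure.absolutelyContinuous_of_le (Measure.le_add_left le_rfl)
  have hsum : η.rnDeriv ρ + η'.rnDeriv ρ =ᵐ[ρ] fun _ => 1 :=
    (Measure.rnDeriv_add' η η' ρ).symm.trans (Measure.rnDeriv_self ρ)
  -- Truncation at 1 changes the density on a null set only, and gives bounds valid at every point.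
  refine ⟨fun x => min 1 (η.rnDeriv ρ x).toReal,
    measurable_const.min (Measure.measurable_rnDeriv _ _).ennreal_toReal,
    fun x => le_min zero_le_one ENNReal.toReal_nonneg, fun x => min_le_left _ _, ?_, ?_⟩
  · conv_lhs => rw [← Measure.withDensity_rnDeriv_eq η ρ h1]
    refine withDensity_congr_ae ?_
    filter_upwards [hsum] with x hx
    have hle : η.rnDeriv ρ x ≤ 1 := by
      rw [← hx]; exact le_self_add
    have hne : η.rnDeriv ρ x ≠ ⊤ := ne_top_of_le_ne_top ENNReal.one_ne_top hle
    rw [min_eq_right, ENNReal.ofReal_toReal hne]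
    simpa using ENNReal.toReal_mono ENNReal.one_ne_top hle
  · conv_lhs => rw [← Measure.withDensity_rnDeriv_eq η' ρ h2]
    refine withDensity_congr_ae ?_
    filter_upwards [hsum] with x hx
    have hle : η.rnDeriv ρ x ≤ 1 := by
      rw [← hx]; exact le_self_add
    have hne : η.rnDeriv ρ x ≠ ⊤ := ne_top_of_le_ne_top ENNReal.one_ne_top hle
    rw [min_eq_right (by simpa using ENNReal.toReal_mono ENNReal.one_ne_top hle),
      ENNReal.ofReal_sub _ ENNReal.toReal_nonneg, ENNReal.ofReal_toReal hne, ENNReal.ofReal_one]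
    rw [← hx, Pi.add_apply, ENNReal.add_sub_cancel_left hne]

/-- The restriction of a product of σ-finite measures to a fixed measurable set is determined by
its marginals, as long as it is finite. -/
theorem restrict_prod_unique {S T : Type*} [MeasurableSpace S] [MeasurableSpace T]
    {η₁ η₁' : Measure S} {η₂ η₂' : Measure T} [SigmaFinite η₁] [SigmaFinite η₁']
    [SigmaFinite η₂] [SigmaFinite η₂'] {F : Set (S × T)} (hF : MeasurableSet F)
    [IsFiniteMeasure ((η₁.prod η₂).restrict F)] [IsFiniteMeasure ((η₁'.prod η₂').restrict F)]
    (h₁ : ((η₁.prod η₂).restrict F).map Prod.fst = ((η₁'.prod η₂').restrict F).map Prod.fst)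
    (h₂ : ((η₁.prod η₂).restrict F).map Prod.snd = ((η₁'.prod η₂').restrict F).map Prod.snd) :
    (η₁.prod η₂).restrict F = (η₁'.prod η₂').restrict F := by
  obtain ⟨p, hp, hp0, hp1, e₁, e₁'⟩ := exists_density_add η₁ η₁'
  obtain ⟨q, hq, hq0, hq1, e₂, e₂'⟩ := exists_density_add η₂ η₂'
  set ρ := ((η₁ + η₁').prod (η₂ + η₂')).restrict F with hρ
  have eK : (η₁.prod η₂).restrict F =
      ρ.withDensity (fun z => ENNReal.ofReal (p z.1 * q z.2)) := by
    conv_lhs => rw [e₁, e₂]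
    rw [prod_withDensity (by fun_prop) (by fun_prop), restrict_withDensity hF]
    congr 1
    ext z
    rw [ENNReal.ofReal_mul (hp0 _)]
  have eK' : (η₁'.prod η₂').restrict F =
      ρ.withDensity (fun z => ENNReal.ofReal ((1 - p z.1) * (1 - q z.2))) := by
    conv_lhs => rw [e₁', e₂']
    rw [prod_withDensity (by fun_prop) (by fun_prop), restrict_withDensity hF]
    congr 1
    ext z
    rw [ENNReal.ofReal_mul (sub_nonneg.2 (hp1 _))]
  -- The test function p(x) + q(y) − 1 is a sum of functions of one variable, so its integral sees
  -- only the marginals and the mass of K.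
  have key : ∀ (K : Measure (S × T)) [IsFiniteMeasure K] (k : S × T → ℝ), Measurable k →
      (∀ z, 0 ≤ k z) → K = ρ.withDensity (fun z => ENNReal.ofReal (k z)) →
      Integrable (fun z => (p z.1 + q z.2 - 1) * k z) ρ ∧
      (∫ z, (p z.1 + q z.2 - 1) * k z ∂ρ) =
        (∫ x, p x ∂(K.map Prod.fst)) + (∫ y, q y ∂(K.map Prod.snd)) - K.real univ := by
    intro K _ k hk hk0 hK
    have i1 : Integrable (fun z : S × T => p z.1) K :=
      Integrable.of_bound (hp.comp measurable_fst).aestronglyMeasurable 1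
        (ae_of_all _ fun z => by rw [Real.norm_eq_abs, abs_of_nonneg (hp0 _)]; exact hp1 _)
    have i2 : Integrable (fun z : S × T => q z.2) K :=
      Integrable.of_bound (hq.comp measurable_snd).aestronglyMeasurable 1
        (ae_of_all _ fun z => by rw [Real.norm_eq_abs, abs_of_nonneg (hq0 _)]; exact hq1 _)
    have i3 : Integrable (fun z : S × T => p z.1 + q z.2 - 1) K :=
      (i1.add i2).sub (integrable_const 1)
    have hm : Measurable fun z => ENNReal.ofReal (k z) := hk.ennreal_ofReal
    constructor
    · have := i3
      rw [hK, integrable_withDensity_iff hm (ae_of_all _ fun z => ENNReal.ofReal_lt_top)] at this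
      simpa [ENNReal.toReal_ofReal (hk0 _)] using this
    · rw [integral_map measurable_fst.aemeasurable hp.aestronglyMeasurable,
        integral_map measurable_snd.aemeasurable hq.aestronglyMeasurable]
      have : (∫ z, (p z.1 + q z.2 - 1) ∂K)
          = (∫ z, p z.1 ∂K) + (∫ z, q z.2 ∂K) - K.real univ := by
        rw [← integral_add i1 i2, integral_sub (by exact i1.add i2) (integrable_const 1)]
        simp
      rw [← this, hK, integral_withDensity_eq_integral_toReal_smul hm
        (ae_of_all _ fun z => ENNReal.ofReal_lt_top)]
      refine integral_congr_ae (ae_of_all _ fun z => ?_)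
      simp only [ENNReal.toReal_ofReal (hk0 _), smul_eq_mul]
      ring
  have hmp : Measurable fun z : S × T => p z.1 * q z.2 := by fun_prop
  have hmp' : Measurable fun z : S × T => (1 - p z.1) * (1 - q z.2) := by fun_prop
  obtain ⟨i, I⟩ := key _ _ hmp (fun z => mul_nonneg (hp0 _) (hq0 _)) eK
  obtain ⟨i', I'⟩ := key _ _ hmp' (fun z => mul_nonneg (sub_nonneg.2 (hp1 _))
    (sub_nonneg.2 (hq1 _))) eK'
  have hu : ((η₁.prod η₂).restrict F).real univ = ((η₁'.prod η₂').restrict F).real univ := by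
    have := congrArg (fun m : Measure S => m.real univ) h₁
    simpa [map_measureReal_apply measurable_fst MeasurableSet.univ] using this
  have hII : ∫ z, (p z.1 + q z.2 - 1) * (p z.1 * q z.2) ∂ρ
      = ∫ z, (p z.1 + q z.2 - 1) * ((1 - p z.1) * (1 - q z.2)) ∂ρ := by
    rw [I, I', h₁, h₂, hu]
  -- The test function is also the difference of the two densities, pq − (1 − p)(1 − q) = p + q − 1.
  -- Subtracting the two integrals leaves a square.
  have hz : ∫ z, (p z.1 + q z.2 - 1) ^ 2 ∂ρ = 0 := by
    rw [← sub_eq_zero, ← integral_sub i i'] at hII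
    rw [← hII]
    refine integral_congr_ae (ae_of_all _ fun z => ?_)
    ring
  have hi : Integrable (fun z => (p z.1 + q z.2 - 1) ^ 2) ρ := by
    refine (i.sub i').congr (ae_of_all _ fun z => ?_)
    simp only [Pi.sub_apply]
    ring
  rw [integral_eq_zero_iff_of_nonneg (fun z => sq_nonneg _) hi] at hz
  rw [eK, eK']
  refine withDensity_congr_ae ?_
  filter_upwards [hz] with z hz
  have h0 : p z.1 + q z.2 - 1 = 0 := by simpa using hz
  congr 1
  linear_combination h0

lemma measurableSet_halfPlane : MeasurableSet halfPlane :=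
  measurableSet_le measurable_fst measurable_snd

lemma IsStronglyMult.unique {γ₁ γ₂ : Measure ℝ} {π π' : Measure (ℝ × ℝ)}
    (hπ : π ∈ Marg γ₁ γ₂) (hπ' : π' ∈ Marg γ₁ γ₂) (h : IsStronglyMult π)
    (h' : IsStronglyMult π') : π = π' := by
  obtain ⟨η₁, η₂, _, _, rfl⟩ := h
  obtain ⟨η₁', η₂', _, _, rfl⟩ := h'
  have := hπ.1
  have := hπ'.1
  exact restrict_prod_unique measurableSet_halfPlane (hπ.2.1.trans hπ'.2.1.symm)
    (hπ.2.2.trans hπ'.2.2.symm)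

/-! ### Distribution functions on the line -/

open Filter Topology

lemma cdfR_mono (γ : Measure ℝ) [IsFiniteMeasure γ] : Monotone (cdfR γ) :=
  fun _ _ h => measureReal_mono (Iic_subset_Iic.2 h)

lemma cdfL_le_cdfR (γ : Measure ℝ) [IsFiniteMeasure γ] (t : ℝ) : cdfL γ t ≤ cdfR γ t :=
  measureReal_mono Iio_subset_Iic_self

lemma cdfR_nonneg (γ : Measure ℝ) (t : ℝ) : 0 ≤ cdfR γ t := measureReal_nonneg

lemma cdfR_le (γ : Measure ℝ) [IsFiniteMeasure γ] (t : ℝ) : cdfR γ t ≤ γ.real univ :=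
  measureReal_mono (subset_univ _)

lemma cdfL_le (γ : Measure ℝ) [IsFiniteMeasure γ] (t : ℝ) : cdfL γ t ≤ γ.real univ :=
  measureReal_mono (subset_univ _)

lemma measurable_cdfR (γ : Measure ℝ) [IsFiniteMeasure γ] : Measurable (cdfR γ) :=
  (cdfR_mono γ).measurable

lemma tendsto_cdfR_atTop (γ : Measure ℝ) [IsFiniteMeasure γ] :
    Tendsto (cdfR γ) atTop (𝓝 (γ.real univ)) :=
  (ENNReal.tendsto_toReal (measure_ne_top γ _)).comp (tendsto_measure_Iic_atTop γ)

lemma tendsto_cdfR_atBot (γ : Measure ℝ) [IsFiniteMeasure γ] :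
    Tendsto (cdfR γ) atBot (𝓝 0) := by
  have h := tendsto_measure_iInter_atBot (μ := γ) (s := fun t : ℝ => Iic t)
    (fun _ => measurableSet_Iic.nullMeasurableSet) (fun _ _ hab => Iic_subset_Iic.2 hab)
    ⟨0, measure_ne_top _ _⟩
  rw [iInter_Iic_eq_empty_iff.2 (by simp [not_bddBelow_univ]), measure_empty] at h
  exact (ENNReal.tendsto_toReal ENNReal.zero_ne_top).comp h

lemma tendsto_cdfR_nhdsGT (γ : Measure ℝ) [IsFiniteMeasure γ] (t : ℝ) :
    Tendsto (cdfR γ) (𝓝[>] t) (𝓝 (cdfR γ t)) := by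
  have h := tendsto_measure_biInter_gt (μ := γ) (s := fun r : ℝ => Iic r) (a := t)
    (fun r _ => measurableSet_Iic.nullMeasurableSet) (fun i j _ hij => Iic_subset_Iic.2 hij)
    ⟨t + 1, by simp, measure_ne_top _ _⟩
  have e : ⋂ r > t, Iic r = Iic t := by
    ext x
    simp only [mem_iInter, mem_Iic]
    exact ⟨fun H => le_of_forall_gt_imp_ge_of_dense H, fun H r hr => H.trans hr.le⟩
  rw [e] at h
  exact (ENNReal.tendsto_toReal (measure_ne_top γ _)).comp h

lemma tendsto_cdfR_nhdsLT (γ : Measure ℝ) [IsFiniteMeasure γ] (t : ℝ) :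
    Tendsto (cdfR γ) (𝓝[<] t) (𝓝 (cdfL γ t)) := by
  have hmono : Monotone fun n : ℕ => Iic (t - 1 / (n + 1 : ℝ)) := by
    intro m n h
    refine Iic_subset_Iic.2 (sub_le_sub_left ?_ _)
    gcongr
  have hU : ⋃ n : ℕ, Iic (t - 1 / (n + 1 : ℝ)) = Iio t := by
    ext x
    simp only [mem_iUnion, mem_Iic, mem_Iio]
    constructor
    · rintro ⟨n, hn⟩
      have : (0:ℝ) < 1 / (n + 1 : ℝ) := by positivity
      linarith
    · intro hx
      obtain ⟨n, hn⟩ := exists_nat_one_div_lt (sub_pos.2 hx)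
      exact ⟨n, by linarith⟩
  have h := tendsto_measure_iUnion_atTop (μ := γ) hmono
  rw [hU] at h
  have h' : Tendsto (fun n : ℕ => cdfR γ (t - 1 / (n + 1 : ℝ))) atTop (𝓝 (cdfL γ t)) :=
    (ENNReal.tendsto_toReal (measure_ne_top γ _)).comp h
  rw [tendsto_order]
  refine ⟨fun a ha => ?_, fun a ha => ?_⟩
  · obtain ⟨n, hn⟩ := (h'.eventually_const_lt ha).exists
    have : t - 1 / (n + 1 : ℝ) < t := by
      have : (0:ℝ) < 1 / (n + 1 : ℝ) := by positivity
      linarith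
    filter_upwards [Ioo_mem_nhdsLT this] with x hx
    exact hn.trans_le (cdfR_mono γ hx.1.le)
  · filter_upwards [self_mem_nhdsWithin] with x hx
    exact lt_of_le_of_lt (measureReal_mono (Iic_subset_Iio.2 hx)) ha

/-- Classification of the lower sets of the line. -/
lemma isLowerSet_real_cases {Z : Set ℝ} (hZ : IsLowerSet Z) :
    Z = ∅ ∨ Z = univ ∨ ∃ c, Z = Iic c ∨ Z = Iio c := by
  rcases Z.eq_empty_or_nonempty with h | hne
  · exact Or.inl h
  by_cases hb : BddAbove Z
  · refine Or.inr (Or.inr ⟨sSup Z, ?_⟩)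
    have hlt : ∀ x < sSup Z, x ∈ Z := fun x hx => by
      obtain ⟨y, hy, hxy⟩ := exists_lt_of_lt_csSup hne hx
      exact hZ hxy.le hy
    by_cases hc : sSup Z ∈ Z
    · exact Or.inl (Subset.antisymm (fun x hx => le_csSup hb hx) fun x hx => hZ hx hc)
    · exact Or.inr (Subset.antisymm
        (fun x hx => lt_of_le_of_ne (le_csSup hb hx) fun h => hc (h ▸ hx)) hlt)
  · refine Or.inr (Or.inl (eq_univ_of_forall fun x => ?_))
    obtain ⟨y, hy, hxy⟩ := not_bddAbove_iff.1 hb x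
    exact hZ hxy.le hy

/-- Open half-lines and the whole line are limits of closed half-lines, so a bound on the latter
suffices. -/
lemma measureReal_lowerSet_le {γ : Measure ℝ} [IsFiniteMeasure γ] {Z : Set ℝ}
    (hZ : IsLowerSet Z) {v : ℝ} (hv : 0 ≤ v) (h : ∀ x ∈ Z, cdfR γ x ≤ v) : γ.real Z ≤ v := by
  rcases isLowerSet_real_cases hZ with rfl | rfl | ⟨c, rfl | rfl⟩
  · simpa using hv
  · exact le_of_tendsto (tendsto_cdfR_atTop γ) (Eventually.of_forall fun x => h x (mem_univ x))
  · exact h c (mem_Iic.2 le_rfl)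
  · exact le_of_tendsto (tendsto_cdfR_nhdsLT γ c)
      (by filter_upwards [self_mem_nhdsWithin] with x hx using h x hx)

/-! ### Irreducible pairs, the lag and its primitive -/

/-- The pair `(γ₁, γ₂)` is irreducible: the measures have the same mass, and the distribution
function of `γ₁` exceeds that of `γ₂` strictly, except where both are trivial. -/
structure Irreducible (γ₁ γ₂ : Measure ℝ) : Prop where
  mass : γ₁ univ = γ₂ univ
  right : ∀ t, cdfR γ₂ t < cdfR γ₁ t ∨ (cdfR γ₁ t = 0 ∧ cdfR γ₂ t = 0) ∨
    (cdfR γ₁ t = γ₁.real univ ∧ cdfR γ₂ t = γ₁.real univ)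
  left : ∀ t, cdfL γ₂ t < cdfL γ₁ t ∨ (cdfL γ₁ t = 0 ∧ cdfL γ₂ t = 0) ∨
    (cdfL γ₁ t = γ₁.real univ ∧ cdfL γ₂ t = γ₁.real univ)

/-- A proper lower set is a closed or an open half-line, which is why `Irreducible` constrains both
versions of the distribution functions. Its degenerate alternatives do no harm since 0 < v < γ₁(ℝ).
-/
lemma Irreducible.measureReal_lowerSet_lt {γ₁ γ₂ : Measure ℝ} [IsFiniteMeasure γ₁]
    (H : Irreducible γ₁ γ₂) {Z : Set ℝ}
    (hZ : IsLowerSet Z) {v : ℝ} (hv : 0 < v) (hv' : v < γ₁.real univ)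
    (h : ∀ x ∈ Z, cdfR γ₁ x ≤ v) : γ₂.real Z < v := by
  have h1 : γ₁.real Z ≤ v := measureReal_lowerSet_le hZ hv.le h
  rcases isLowerSet_real_cases hZ with rfl | rfl | ⟨c, rfl | rfl⟩
  · simpa using hv
  · exact absurd h1 (not_le.2 hv')
  · change cdfR γ₁ c ≤ v at h1
    change cdfR γ₂ c < v
    rcases H.right c with h | ⟨_, h⟩ | ⟨h, _⟩ <;> linarith
  · change cdfL γ₁ c ≤ v at h1
    change cdfL γ₂ c < v
    rcases H.left c with h | ⟨_, h⟩ | ⟨h, _⟩ <;> linarith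

section lag

variable (γ₁ γ₂ : Measure ℝ)

/-- The amount by which `γ₂` lags behind `γ₁` at the `v`-quantile of `γ₁`. -/
def lag (v : ℝ) : ℝ := v - γ₂.real {y | cdfR γ₁ y < v}

/-- The levels at which the lag is positive: all levels except possibly the last. -/
def lagDom : Set ℝ := {v | 0 < v ∧ v ≤ γ₁.real univ ∧ 0 < lag γ₁ γ₂ v}

/-- The primitive of the inverse lag. -/
def lagPrim (u : ℝ) : ℝ := ∫ v in (γ₁.real univ / 2)..u, (lag γ₁ γ₂ v)⁻¹

variable {γ₁ γ₂} [IsFiniteMeasure γ₁] [IsFiniteMeasure γ₂]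

lemma isLowerSet_cdfR_lt (v : ℝ) : IsLowerSet {y | cdfR γ₁ y < v} :=
  fun _ _ hab ha => (cdfR_mono γ₁ hab).trans_lt ha

lemma isLowerSet_cdfR_le (v : ℝ) : IsLowerSet {y | cdfR γ₁ y ≤ v} :=
  fun _ _ hab ha => (cdfR_mono γ₁ hab).trans ha

lemma monotone_measureReal_cdfR_lt : Monotone fun v => γ₂.real {y | cdfR γ₁ y < v} :=
  fun _ _ h => measureReal_mono fun _ hy => lt_of_lt_of_le hy h

lemma measurable_lag : Measurable (lag γ₁ γ₂) :=
  measurable_id.sub (monotone_measureReal_cdfR_lt).measurable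

lemma lag_le (v : ℝ) : lag γ₁ γ₂ v ≤ v := sub_le_self _ measureReal_nonneg

lemma Irreducible.lag_pos (H : Irreducible γ₁ γ₂) {v : ℝ} (hv : 0 < v)
    (hv' : v < γ₁.real univ) : 0 < lag γ₁ γ₂ v :=
  sub_pos.2 (H.measureReal_lowerSet_lt (isLowerSet_cdfR_lt v) hv hv' fun _ hx => le_of_lt hx)

lemma Irreducible.Ioo_subset_lagDom (H : Irreducible γ₁ γ₂) :
    Ioo 0 (γ₁.real univ) ⊆ lagDom γ₁ γ₂ :=
  fun _ hv => ⟨hv.1, hv.2.le, H.lag_pos hv.1 hv.2⟩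

lemma Irreducible.ordConnected_lagDom (H : Irreducible γ₁ γ₂) : OrdConnected (lagDom γ₁ γ₂) := by
  refine ⟨fun x hx z hz y hy => ?_⟩
  rcases (hy.2.trans hz.2.1).lt_or_eq with h | h
  · exact H.Ioo_subset_lagDom ⟨hx.1.trans_le hy.1, h⟩
  · have : y = z := le_antisymm hy.2 (h ▸ hz.2.1)
    exact this ▸ hz

lemma Irreducible.measurableSet_lagDom (H : Irreducible γ₁ γ₂) :
    MeasurableSet (lagDom γ₁ γ₂) := H.ordConnected_lagDom.measurableSet

lemma tendsto_measure_cdfR_lt_nhdsGT (v : ℝ) :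
    Tendsto (fun w => γ₂.real {y | cdfR γ₁ y < w}) (𝓝[>] v)
      (𝓝 (γ₂.real {y | cdfR γ₁ y ≤ v})) := by
  have h := tendsto_measure_biInter_gt (μ := γ₂) (s := fun r : ℝ => {y | cdfR γ₁ y < r}) (a := v)
    (fun r _ => (isLowerSet_cdfR_lt r).ordConnected.measurableSet.nullMeasurableSet)
    (fun i j _ hij y hy => lt_of_lt_of_le hy hij) ⟨v + 1, by simp, measure_ne_top _ _⟩
  have e : ⋂ r > v, {y | cdfR γ₁ y < r} = {y | cdfR γ₁ y ≤ v} := by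
    ext x
    simp only [mem_iInter, mem_ofPred_eq]
    exact ⟨fun H => le_of_forall_gt_imp_ge_of_dense fun r hr => (H r hr).le,
      fun H r hr => H.trans_lt hr⟩
  rw [e] at h
  exact (ENNReal.tendsto_toReal (measure_ne_top γ₂ _)).comp h

/-- The lag may jump, but it stays locally away from zero. To the left of v it loses at most v − w
by monotonicity; to the right its limit is v − γ₂{F₁ ≤ v}, positive by irreducibility. At the top
level nothing of the domain lies to the right. -/
lemma Irreducible.exists_lag_ge (H : Irreducible γ₁ γ₂) {v : ℝ} (hv : v ∈ lagDom γ₁ γ₂) :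
    ∃ ε > 0, ∀ᶠ w in 𝓝[lagDom γ₁ γ₂] v, ε ≤ lag γ₁ γ₂ w := by
  have hleft : ∀ᶠ w in 𝓝 v, w ≤ v → lag γ₁ γ₂ v / 2 ≤ lag γ₁ γ₂ w := by
    have : v - lag γ₁ γ₂ v / 2 < v := by linarith [hv.2.2]
    filter_upwards [Ioi_mem_nhds this] with w hw hwv
    have h1 : γ₂.real {y | cdfR γ₁ y < w} ≤ γ₂.real {y | cdfR γ₁ y < v} :=
      monotone_measureReal_cdfR_lt hwv
    have h2 : v - lag γ₁ γ₂ v / 2 < w := hw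
    unfold lag at *
    linarith
  rcases hv.2.1.lt_or_eq with hlt | heq
  · have hz : γ₂.real {y | cdfR γ₁ y ≤ v} < v :=
      H.measureReal_lowerSet_lt (isLowerSet_cdfR_le v) hv.1 hlt fun _ hx => hx
    have h1 := (tendsto_measure_cdfR_lt_nhdsGT (γ₁ := γ₁) (γ₂ := γ₂) v).eventually_le_const
      (show γ₂.real {y | cdfR γ₁ y ≤ v} < (γ₂.real {y | cdfR γ₁ y ≤ v} + v) / 2 by linarith)
    rw [eventually_nhdsWithin_iff] at h1
    refine ⟨min (lag γ₁ γ₂ v / 2) ((v - γ₂.real {y | cdfR γ₁ y ≤ v}) / 2),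
      lt_min (half_pos hv.2.2) (by linarith), ?_⟩
    refine Filter.Eventually.filter_mono nhdsWithin_le_nhds ?_
    filter_upwards [hleft, h1] with w hw hw'
    rcases le_or_gt w v with h | h
    · exact (min_le_left _ _).trans (hw h)
    · refine (min_le_right _ _).trans ?_
      have := hw' h
      unfold lag
      have h3 : v < w := h
      linarith
  · refine ⟨lag γ₁ γ₂ v / 2, half_pos hv.2.2, ?_⟩
    filter_upwards [nhdsWithin_le_nhds hleft, self_mem_nhdsWithin] with w hw hwW
    exact hw (heq ▸ hwW.2.1)

lemma Irreducible.locallyIntegrableOn_inv_lag (H : Irreducible γ₁ γ₂) :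
    LocallyIntegrableOn (fun v => (lag γ₁ γ₂ v)⁻¹) (lagDom γ₁ γ₂) := by
  intro v hv
  obtain ⟨ε, hε, h⟩ := H.exists_lag_ge hv
  have := H.measurableSet_lagDom.nhdsWithin_isMeasurablyGenerated v
  refine Measure.FiniteAtFilter.integrableAtFilter
    ⟨univ, univ_mem, measurable_lag.inv.aestronglyMeasurable⟩
    ((volume.finiteAt_nhds v).filter_mono nhdsWithin_le_nhds) ⟨ε⁻¹, ?_⟩
  rw [eventually_map]
  filter_upwards [h] with w hw
  rw [Function.comp_apply, Real.norm_eq_abs, abs_of_nonneg (inv_nonneg.2 (hε.le.trans hw))]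
  exact inv_anti₀ hε hw

lemma Irreducible.intervalIntegrable_inv_lag (H : Irreducible γ₁ γ₂) {u w : ℝ}
    (hu : u ∈ lagDom γ₁ γ₂) (hw : w ∈ lagDom γ₁ γ₂) :
    IntervalIntegrable (fun v => (lag γ₁ γ₂ v)⁻¹) volume u w :=
  (intervalIntegrable_iff' (by finiteness)).2
    (H.locallyIntegrableOn_inv_lag.integrableOn_compact_subset
      (H.ordConnected_lagDom.uIcc_subset hu hw) isCompact_uIcc)

lemma Irreducible.half_mem_lagDom (H : Irreducible γ₁ γ₂) (hM : 0 < γ₁.real univ) :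
    γ₁.real univ / 2 ∈ lagDom γ₁ γ₂ := H.Ioo_subset_lagDom ⟨by linarith, by linarith⟩

lemma mass_pos_of_mem_lagDom {v : ℝ} (hv : v ∈ lagDom γ₁ γ₂) : 0 < γ₁.real univ :=
  hv.1.trans_le hv.2.1

lemma Irreducible.lagPrim_sub (H : Irreducible γ₁ γ₂) {u w : ℝ}
    (hu : u ∈ lagDom γ₁ γ₂) (hw : w ∈ lagDom γ₁ γ₂) :
    lagPrim γ₁ γ₂ w - lagPrim γ₁ γ₂ u = ∫ v in u..w, (lag γ₁ γ₂ v)⁻¹ := by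
  have h0 := H.half_mem_lagDom (mass_pos_of_mem_lagDom hu)
  exact intervalIntegral.integral_interval_sub_left (H.intervalIntegrable_inv_lag h0 hw)
    (H.intervalIntegrable_inv_lag h0 hu)

lemma Irreducible.continuousOn_lagPrim (H : Irreducible γ₁ γ₂) :
    ContinuousOn (lagPrim γ₁ γ₂) (lagDom γ₁ γ₂) := by
  intro v hv
  have h0 := H.half_mem_lagDom (mass_pos_of_mem_lagDom hv)
  -- a compact interval of levels that is a neighbourhood of `v` within the domain
  obtain ⟨r, s, hr, hs, hrs⟩ : ∃ r s, r ∈ lagDom γ₁ γ₂ ∧ s ∈ lagDom γ₁ γ₂ ∧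
      Icc r s ∈ 𝓝[lagDom γ₁ γ₂] v := by
    have hr : v / 2 ∈ lagDom γ₁ γ₂ :=
      H.Ioo_subset_lagDom ⟨by linarith [hv.1], by linarith [hv.1, hv.2.1]⟩
    rcases hv.2.1.lt_or_eq with hlt | heq
    · refine ⟨v / 2, (v + γ₁.real univ) / 2, hr,
        H.Ioo_subset_lagDom ⟨by linarith [hv.1], by linarith⟩, ?_⟩
      exact nhdsWithin_le_nhds (Icc_mem_nhds (by linarith [hv.1]) (by linarith))
    · refine ⟨v / 2, v, hr, hv, ?_⟩
      filter_upwards [nhdsWithin_le_nhds (Ici_mem_nhds (show v / 2 < v by linarith [hv.1])),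
        self_mem_nhdsWithin] with w hw hwW
      exact ⟨hw, heq ▸ hwW.2.1⟩
  have hrs' : r ≤ s := (mem_of_mem_nhdsWithin hv hrs).1.trans (mem_of_mem_nhdsWithin hv hrs).2
  have hcont : ContinuousOn (fun u => ∫ t in r..u, (lag γ₁ γ₂ t)⁻¹) (uIcc r s) :=
    intervalIntegral.continuousOn_primitive_interval' (H.intervalIntegrable_inv_lag hr hs)
      left_mem_uIcc
  rw [uIcc_of_le hrs'] at hcont
  have := (hcont v (mem_of_mem_nhdsWithin hv hrs)).mono_of_mem_nhdsWithin hrs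
  refine (this.const_add (lagPrim γ₁ γ₂ r)).congr (fun w hw => ?_) ?_
  · rw [← H.lagPrim_sub hr hw]; ring
  · rw [← H.lagPrim_sub hr hv]; ring

lemma Irreducible.lagPrim_mono (H : Irreducible γ₁ γ₂) :
    MonotoneOn (lagPrim γ₁ γ₂) (lagDom γ₁ γ₂) := by
  intro u hu w hw huw
  rw [← sub_nonneg, H.lagPrim_sub hu hw]
  exact intervalIntegral.integral_nonneg huw fun v hv =>
    inv_nonneg.2 (H.ordConnected_lagDom.out hu hw hv).2.2.le

/-- The lag is the identity minus a monotone function. The fundamental theorem of calculus tolerates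
the countably many jumps. -/
lemma countable_not_continuousAt_lag : {v | ¬ ContinuousAt (lag γ₁ γ₂) v}.Countable := by
  refine Set.Countable.mono ?_
    (monotone_measureReal_cdfR_lt (γ₁ := γ₁) (γ₂ := γ₂)).countable_not_continuousAt
  intro v hv h
  exact hv (continuousAt_id.sub h)

lemma Irreducible.hasDerivAt_lagPrim (H : Irreducible γ₁ γ₂) {v : ℝ} (hv : v ∈ lagDom γ₁ γ₂)
    (hc : ContinuousAt (lag γ₁ γ₂) v) : HasDerivAt (lagPrim γ₁ γ₂) (lag γ₁ γ₂ v)⁻¹ v := by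
  have h0 := H.half_mem_lagDom (mass_pos_of_mem_lagDom hv)
  exact intervalIntegral.integral_hasDerivAt_right (H.intervalIntegrable_inv_lag h0 hv)
    ⟨univ, univ_mem, measurable_lag.inv.aestronglyMeasurable⟩ (hc.inv₀ hv.2.2.ne')

/-- Fundamental theorem of calculus for functions of a level and of `lagPrim`. -/
lemma Irreducible.lintegral_deriv (H : Irreducible γ₁ γ₂) {f c₁ c₂ : ℝ → ℝ}
    (hf : ContinuousOn f (lagDom γ₁ γ₂)) (h₁ : ContinuousOn c₁ (lagDom γ₁ γ₂))
    (h₂ : ContinuousOn c₂ (lagDom γ₁ γ₂))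
    (hd : ∀ v ∈ lagDom γ₁ γ₂, HasDerivAt (lagPrim γ₁ γ₂) (lag γ₁ γ₂ v)⁻¹ v →
      HasDerivAt f (c₁ v + c₂ v * (lag γ₁ γ₂ v)⁻¹) v)
    (hnn : ∀ v ∈ lagDom γ₁ γ₂, 0 ≤ c₁ v + c₂ v * (lag γ₁ γ₂ v)⁻¹)
    {u w : ℝ} (hu : u ∈ lagDom γ₁ γ₂) (hw : w ∈ lagDom γ₁ γ₂) (huw : u ≤ w) :
    ∫⁻ v in Ioc u w, ENNReal.ofReal (c₁ v + c₂ v * (lag γ₁ γ₂ v)⁻¹) =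
      ENNReal.ofReal (f w - f u) := by
  have hsub : Icc u w ⊆ lagDom γ₁ γ₂ := H.ordConnected_lagDom.out hu hw
  have hsub' : uIcc u w ⊆ lagDom γ₁ γ₂ := by rwa [uIcc_of_le huw]
  have hint : IntervalIntegrable (fun v => c₁ v + c₂ v * (lag γ₁ γ₂ v)⁻¹) volume u w :=
    (h₁.mono hsub').intervalIntegrable.add
      ((H.intervalIntegrable_inv_lag hu hw).continuousOn_mul (h₂.mono hsub'))
  have := integral_eq_of_hasDerivAt_off_countable_of_le f
    (fun v => c₁ v + c₂ v * (lag γ₁ γ₂ v)⁻¹) huw countable_not_continuousAt_lag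
    (hf.mono hsub) (fun v hv => hd v (hsub (Ioo_subset_Icc_self hv.1))
      (H.hasDerivAt_lagPrim (hsub (Ioo_subset_Icc_self hv.1)) (not_not.1 hv.2))) hint
  rw [← this, intervalIntegral.integral_of_le huw, ofReal_integral_eq_lintegral_ofReal hint.1]
  exact (ae_restrict_iff' measurableSet_Ioc).2
    (ae_of_all _ fun v hv => hnn v (hsub (Ioc_subset_Icc_self hv)))

end lag

section lag

variable {γ₁ γ₂ : Measure ℝ} [IsFiniteMeasure γ₁] [IsFiniteMeasure γ₂]

lemma Irreducible.lintegral_inv_lag (H : Irreducible γ₁ γ₂) {u w : ℝ}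
    (hu : u ∈ lagDom γ₁ γ₂) (hw : w ∈ lagDom γ₁ γ₂) (huw : u ≤ w) :
    ∫⁻ v in Ioc u w, ENNReal.ofReal (lag γ₁ γ₂ v)⁻¹ =
      ENNReal.ofReal (lagPrim γ₁ γ₂ w - lagPrim γ₁ γ₂ u) := by
  have := H.lintegral_deriv (f := lagPrim γ₁ γ₂) (c₁ := fun _ => 0) (c₂ := fun _ => 1)
    H.continuousOn_lagPrim continuousOn_const continuousOn_const (fun v _ h => by simpa using h)
    (fun v hv => by simpa using hv.2.2.le) hu hw huw
  simpa using this

lemma Irreducible.lintegral_exp_neg_lagPrim (H : Irreducible γ₁ γ₂) {u w : ℝ}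
    (hu : u ∈ lagDom γ₁ γ₂) (hw : w ∈ lagDom γ₁ γ₂) (huw : u ≤ w) :
    ∫⁻ v in Ioc u w, ENNReal.ofReal (Real.exp (-lagPrim γ₁ γ₂ v) * (lag γ₁ γ₂ v)⁻¹) =
      ENNReal.ofReal (Real.exp (-lagPrim γ₁ γ₂ u) - Real.exp (-lagPrim γ₁ γ₂ w)) := by
  have hc : ContinuousOn (fun v => Real.exp (-lagPrim γ₁ γ₂ v)) (lagDom γ₁ γ₂) :=
    H.continuousOn_lagPrim.neg.rexp
  have := H.lintegral_deriv (f := fun v => -Real.exp (-lagPrim γ₁ γ₂ v)) (c₁ := fun _ => 0)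
    (c₂ := fun v => Real.exp (-lagPrim γ₁ γ₂ v)) hc.neg continuousOn_const hc
    (fun v _ h => by
      have := h.neg.exp.neg
      refine this.congr_deriv ?_
      simp only [Pi.neg_apply]
      ring)
    (fun v hv => by
      have := inv_pos.2 hv.2.2
      positivity) hu hw huw
  simpa [sub_eq_add_neg, add_comm] using this

lemma Irreducible.lintegral_exp_lagPrim (H : Irreducible γ₁ γ₂) {u w : ℝ}
    (hu : u ∈ lagDom γ₁ γ₂) (hw : w ∈ lagDom γ₁ γ₂) (huw : u ≤ w) :
    ∫⁻ v in Ioc u w, ENNReal.ofReal (Real.exp (lagPrim γ₁ γ₂ v) * (lag γ₁ γ₂ v)⁻¹) =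
      ENNReal.ofReal (Real.exp (lagPrim γ₁ γ₂ w) - Real.exp (lagPrim γ₁ γ₂ u)) := by
  have hc : ContinuousOn (fun v => Real.exp (lagPrim γ₁ γ₂ v)) (lagDom γ₁ γ₂) :=
    H.continuousOn_lagPrim.rexp
  have := H.lintegral_deriv (f := fun v => Real.exp (lagPrim γ₁ γ₂ v)) (c₁ := fun _ => 0)
    (c₂ := fun v => Real.exp (lagPrim γ₁ γ₂ v)) hc continuousOn_const hc
    (fun v _ h => by
      refine h.exp.congr_deriv ?_
      ring)
    (fun v hv => by
      have := inv_pos.2 hv.2.2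
      positivity) hu hw huw
  simpa using this

/-- Since lag(v) ≤ v, the primitive grows at least like the logarithm. Hence exp(L) vanishes at
level 0. -/
lemma Irreducible.exp_lagPrim_le (H : Irreducible γ₁ γ₂) {u w : ℝ}
    (hu : u ∈ lagDom γ₁ γ₂) (hw : w ∈ lagDom γ₁ γ₂) (huw : u ≤ w) :
    Real.exp (lagPrim γ₁ γ₂ u) ≤ Real.exp (lagPrim γ₁ γ₂ w) * (u / w) := by
  have h1 : Real.log (w / u) ≤ lagPrim γ₁ γ₂ w - lagPrim γ₁ γ₂ u := by
    rw [H.lagPrim_sub hu hw, ← integral_inv_of_pos hu.1 hw.1]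
    refine intervalIntegral.integral_mono_on huw ?_ (H.intervalIntegrable_inv_lag hu hw) ?_
    · exact intervalIntegral.intervalIntegrable_inv (fun x hx => by
        rw [uIcc_of_le huw] at hx
        exact (hu.1.trans_le hx.1).ne') continuousOn_id
    · intro v hv
      exact inv_anti₀ (H.ordConnected_lagDom.out hu hw hv).2.2 (lag_le v)
  have h2 : u / w = Real.exp (-Real.log (w / u)) := by
    rw [Real.exp_neg, Real.exp_log (div_pos hw.1 hu.1), inv_div]
  rw [h2, ← Real.exp_add]
  exact Real.exp_le_exp.2 (by linarith)

/-- There is no boundary term at level 0, so exp(L) is itself a distribution function in the level.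
-/
lemma Irreducible.lintegral_exp_lagPrim_zero (H : Irreducible γ₁ γ₂) {u : ℝ}
    (hu : u ∈ lagDom γ₁ γ₂) :
    ∫⁻ v in Ioc 0 u, ENNReal.ofReal (Real.exp (lagPrim γ₁ γ₂ v) * (lag γ₁ γ₂ v)⁻¹) =
      ENNReal.ofReal (Real.exp (lagPrim γ₁ γ₂ u)) := by
  set a : ℕ → ℝ := fun n => u * (1 / ((n : ℝ) + 1)) with ha
  have hinv (n : ℕ) : 1 / ((n : ℝ) + 1) ≤ 1 := by
    rw [div_le_one (by positivity)]; linarith [(Nat.cast_nonneg n : (0 : ℝ) ≤ n)]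
  have hale (n : ℕ) : a n ≤ u := mul_le_of_le_one_right hu.1.le (hinv n)
  have hapos (n : ℕ) : 0 < a n := mul_pos hu.1 (by positivity)
  have haW (n : ℕ) : a n ∈ lagDom γ₁ γ₂ := by
    rcases (hale n).lt_or_eq with h | h
    · exact H.Ioo_subset_lagDom ⟨hapos n, h.trans_le hu.2.1⟩
    · rwa [h]
  have hlim : Tendsto a atTop (𝓝 0) := by
    simpa [a] using (tendsto_one_div_add_atTop_nhds_zero_nat (𝕜 := ℝ)).const_mul u
  have hexp : Tendsto (fun n => Real.exp (lagPrim γ₁ γ₂ (a n))) atTop (𝓝 0) := by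
    refine squeeze_zero (fun n => (Real.exp_pos _).le)
      (fun n => H.exp_lagPrim_le (haW n) hu (hale n)) ?_
    simpa using (hlim.div_const u).const_mul (Real.exp (lagPrim γ₁ γ₂ u))
  have hm : AEMeasurable (fun v => ENNReal.ofReal
      (Real.exp (lagPrim γ₁ γ₂ v) * (lag γ₁ γ₂ v)⁻¹)) (volume.restrict (Ioo 0 u)) := by
    have : Ioo 0 u ⊆ lagDom γ₁ γ₂ := (Ioo_subset_Ioo_right hu.2.1).trans H.Ioo_subset_lagDom
    exact (((H.continuousOn_lagPrim.mono this).rexp.aemeasurable measurableSet_Ioo).mul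
      measurable_lag.inv.aemeasurable).ennreal_ofReal
  rw [Measure.restrict_congr_set Ioo_ae_eq_Ioc.symm]
  refine (aecover_Ioo_of_Ioo hlim tendsto_const_nhds).lintegral_eq_of_tendsto _ hm ?_
  have hE (n : ℕ) : ∫⁻ v in Ioo (a n) u, ENNReal.ofReal
      (Real.exp (lagPrim γ₁ γ₂ v) * (lag γ₁ γ₂ v)⁻¹) ∂(volume.restrict (Ioo 0 u)) =
      ENNReal.ofReal (Real.exp (lagPrim γ₁ γ₂ u) - Real.exp (lagPrim γ₁ γ₂ (a n))) := by
    rw [Measure.restrict_restrict measurableSet_Ioo,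
      inter_eq_left.2 (Ioo_subset_Ioo_left (hapos n).le), Measure.restrict_congr_set Ioo_ae_eq_Ioc,
      H.lintegral_exp_lagPrim (haW n) hu (hale n)]
  simp_rw [hE]
  refine ENNReal.tendsto_ofReal ?_
  simpa using hexp.const_sub (Real.exp (lagPrim γ₁ γ₂ u))

/-- The integrand is the derivative of −(M − v) exp(−L(v)), where M is the total mass. The boundary
term at M vanishes because exp(−L) is decreasing, even if L is unbounded there. -/
lemma Irreducible.lintegral_exp_neg_lagPrim_last (H : Irreducible γ₁ γ₂) {u : ℝ}
    (hu : u ∈ lagDom γ₁ γ₂) :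
    ∫⁻ v in Ioc u (γ₁.real univ), ENNReal.ofReal (Real.exp (-lagPrim γ₁ γ₂ v) +
        (γ₁.real univ - v) * Real.exp (-lagPrim γ₁ γ₂ v) * (lag γ₁ γ₂ v)⁻¹) =
      ENNReal.ofReal ((γ₁.real univ - u) * Real.exp (-lagPrim γ₁ γ₂ u)) := by
  set M := γ₁.real univ with hM
  have hc : ContinuousOn (fun v => Real.exp (-lagPrim γ₁ γ₂ v)) (lagDom γ₁ γ₂) :=
    H.continuousOn_lagPrim.neg.rexp
  have hc' : ContinuousOn (fun v => (M - v) * Real.exp (-lagPrim γ₁ γ₂ v)) (lagDom γ₁ γ₂) :=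
    (continuous_const.sub continuous_id).continuousOn.mul hc
  have fin {w : ℝ} (hw : w ∈ lagDom γ₁ γ₂) (huw : u ≤ w) :
      ∫⁻ v in Ioc u w, ENNReal.ofReal (Real.exp (-lagPrim γ₁ γ₂ v) +
        (M - v) * Real.exp (-lagPrim γ₁ γ₂ v) * (lag γ₁ γ₂ v)⁻¹) =
      ENNReal.ofReal ((M - u) * Real.exp (-lagPrim γ₁ γ₂ u) -
        (M - w) * Real.exp (-lagPrim γ₁ γ₂ w)) := by
    have := H.lintegral_deriv (f := fun v => -((M - v) * Real.exp (-lagPrim γ₁ γ₂ v)))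
      hc'.neg hc hc'
      (fun v _ h => by
        refine (((hasDerivAt_id v).const_sub M).mul h.neg.exp).neg.congr_deriv ?_
        simp only [id, Pi.neg_apply]
        ring)
      (fun v hv => by
        have h1 := inv_pos.2 hv.2.2
        have h2 : 0 ≤ M - v := sub_nonneg.2 hv.2.1
        positivity) hu hw huw
    rw [this]
    congr 1
    ring
  rcases hu.2.1.lt_or_eq with hlt | heq
  swap
  · simp [← heq, hM]
  set a : ℕ → ℝ := fun n => M - (M - u) * (1 / ((n : ℝ) + 1)) with ha
  have hinv (n : ℕ) : 1 / ((n : ℝ) + 1) ≤ 1 := by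
    rw [div_le_one (by positivity)]; linarith [(Nat.cast_nonneg n : (0 : ℝ) ≤ n)]
  have hMu : 0 < M - u := sub_pos.2 hlt
  have hale (n : ℕ) : u ≤ a n := by
    have := mul_le_of_le_one_right hMu.le (hinv n)
    simp only [ha]
    linarith
  have halt (n : ℕ) : a n < M := by
    have : 0 < (M - u) * (1 / ((n : ℝ) + 1)) := mul_pos hMu (by positivity)
    simp only [ha]
    linarith
  have haW (n : ℕ) : a n ∈ lagDom γ₁ γ₂ := H.Ioo_subset_lagDom ⟨hu.1.trans_le (hale n), halt n⟩
  have hlim : Tendsto a atTop (𝓝 M) := by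
    simpa [a] using ((tendsto_one_div_add_atTop_nhds_zero_nat (𝕜 := ℝ)).const_mul (M - u)).const_sub M
  have hexp : Tendsto (fun n => (M - a n) * Real.exp (-lagPrim γ₁ γ₂ (a n))) atTop (𝓝 0) := by
    refine squeeze_zero (g := fun n => (M - a n) * Real.exp (-lagPrim γ₁ γ₂ u))
      (fun n => mul_nonneg (sub_nonneg.2 (halt n).le) (Real.exp_pos _).le)
      (fun n => mul_le_mul_of_nonneg_left (Real.exp_le_exp.2 (neg_le_neg
        (H.lagPrim_mono hu (haW n) (hale n)))) (sub_nonneg.2 (halt n).le)) ?_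
    simpa using (hlim.const_sub M).mul_const (Real.exp (-lagPrim γ₁ γ₂ u))
  have hm : AEMeasurable (fun v => ENNReal.ofReal (Real.exp (-lagPrim γ₁ γ₂ v) +
        (M - v) * Real.exp (-lagPrim γ₁ γ₂ v) * (lag γ₁ γ₂ v)⁻¹))
        (volume.restrict (Ioo u M)) := by
    have : Ioo u M ⊆ lagDom γ₁ γ₂ := (Ioo_subset_Ioo_left hu.1.le).trans H.Ioo_subset_lagDom
    exact (((hc.mono this).aemeasurable measurableSet_Ioo).add
      (((hc'.mono this).aemeasurable measurableSet_Ioo).mul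
      measurable_lag.inv.aemeasurable)).ennreal_ofReal
  rw [Measure.restrict_congr_set Ioo_ae_eq_Ioc.symm]
  refine (aecover_Ioo_of_Ioo tendsto_const_nhds hlim).lintegral_eq_of_tendsto _ hm ?_
  have hE (n : ℕ) : ∫⁻ v in Ioo u (a n), ENNReal.ofReal (Real.exp (-lagPrim γ₁ γ₂ v) +
        (M - v) * Real.exp (-lagPrim γ₁ γ₂ v) * (lag γ₁ γ₂ v)⁻¹) ∂(volume.restrict (Ioo u M)) =
      ENNReal.ofReal ((M - u) * Real.exp (-lagPrim γ₁ γ₂ u) -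
        (M - a n) * Real.exp (-lagPrim γ₁ γ₂ (a n))) := by
    rw [Measure.restrict_restrict measurableSet_Ioo,
      inter_eq_left.2 (Ioo_subset_Ioo_right (halt n).le), Measure.restrict_congr_set Ioo_ae_eq_Ioc,
      fin (haW n) (hale n)]
  simp_rw [hE]
  refine ENNReal.tendsto_ofReal ?_
  simpa using hexp.const_sub ((M - u) * Real.exp (-lagPrim γ₁ γ₂ u))

end lag

/-! ### The tail of the second factor -/

/-- Tonelli's theorem for integrals over intervals with variable endpoints. -/
lemma lintegral_lintegral_Ioc {S : Type*} [MeasurableSpace S] (σ : Measure S) [SFinite σ]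
    {a b : S → ℝ} (ha : Measurable a) (hb : Measurable b) {k : ℝ → ENNReal} (hk : Measurable k) :
    ∫⁻ y, (∫⁻ v in Ioc (a y) (b y), k v) ∂σ = ∫⁻ v, k v * σ {y | a y < v ∧ v ≤ b y} := by
  have hs : MeasurableSet {p : S × ℝ | a p.1 < p.2 ∧ p.2 ≤ b p.1} :=
    (measurableSet_lt (ha.comp measurable_fst) measurable_snd).inter
      (measurableSet_le measurable_snd (hb.comp measurable_fst))
  have h1 (y : S) : ∫⁻ v in Ioc (a y) (b y), k v =
      ∫⁻ v, {p : S × ℝ | a p.1 < p.2 ∧ p.2 ≤ b p.1}.indicator (fun p => k p.2) (y, v) := by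
    rw [← lintegral_indicator measurableSet_Ioc]
    rfl
  simp_rw [h1]
  rw [lintegral_lintegral_swap (f := fun y v =>
    {p : S × ℝ | a p.1 < p.2 ∧ p.2 ≤ b p.1}.indicator (fun p => k p.2) (y, v))
    (by exact ((hk.comp measurable_snd).indicator hs).aemeasurable)]
  refine lintegral_congr fun v => ?_
  have hs' : MeasurableSet {y | a y < v ∧ v ≤ b y} :=
    (measurableSet_lt ha measurable_const).inter (measurableSet_le measurable_const hb)
  rw [← lintegral_indicator_const hs']
  rfl

section lag

variable {γ₁ γ₂ : Measure ℝ} [IsFiniteMeasure γ₁] [IsFiniteMeasure γ₂]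

variable (γ₁ γ₂) in
/-- `lagPrim`, cut off outside of its domain. -/
def levelLog (v : ℝ) : ℝ := (lagDom γ₁ γ₂).indicator (lagPrim γ₁ γ₂) v

lemma levelLog_eq {v : ℝ} (hv : v ∈ lagDom γ₁ γ₂) : levelLog γ₁ γ₂ v = lagPrim γ₁ γ₂ v :=
  indicator_of_mem hv _

lemma Irreducible.measurable_levelLog (H : Irreducible γ₁ γ₂) : Measurable (levelLog γ₁ γ₂) := by
  classical
  unfold levelLog
  have := H.continuousOn_lagPrim.measurable_piecewise
    (continuousOn_const (c := (0 : ℝ)) (s := (lagDom γ₁ γ₂)ᶜ)) H.measurableSet_lagDom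
  exact (piecewise_eq_indicator (s := lagDom γ₁ γ₂) (f := lagPrim γ₁ γ₂)) ▸ this

variable (γ₁ γ₂) in
/-- The logarithm of the distribution function of the first factor of the Kellerer plan. -/
def logFactor (y : ℝ) : ℝ := levelLog γ₁ γ₂ (cdfR γ₁ y)

lemma Irreducible.measurable_logFactor (H : Irreducible γ₁ γ₂) : Measurable (logFactor γ₁ γ₂) :=
  H.measurable_levelLog.comp (measurable_cdfR γ₁)

lemma Irreducible.mass_real (H : Irreducible γ₁ γ₂) : γ₂.real univ = γ₁.real univ := by
  simp [measureReal_def, H.mass]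

lemma Irreducible.notMem_lagDom (H : Irreducible γ₁ γ₂) {t : ℝ}
    (ht : cdfR γ₁ t ∉ lagDom γ₁ γ₂) :
    cdfR γ₁ t = 0 ∨ (cdfR γ₁ t = γ₁.real univ ∧ lag γ₁ γ₂ (γ₁.real univ) ≤ 0) := by
  by_contra! h
  have h0 : 0 < cdfR γ₁ t := (cdfR_nonneg γ₁ t).lt_of_ne' h.1
  rcases (cdfR_le γ₁ t).lt_or_eq with h1 | h1
  · exact ht (H.Ioo_subset_lagDom ⟨h0, h1⟩)
  · exact ht ⟨h0, h1.le, by rw [h1]; exact h.2 h1⟩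

lemma Irreducible.measureReal_compl_cdfR_lt (H : Irreducible γ₁ γ₂) (v : ℝ) :
    γ₂.real {y | v ≤ cdfR γ₁ y} = γ₁.real univ - v + lag γ₁ γ₂ v := by
  have : {y | v ≤ cdfR γ₁ y} = {y | cdfR γ₁ y < v}ᶜ := by ext; simp
  rw [this, measureReal_compl (isLowerSet_cdfR_lt v).ordConnected.measurableSet, H.mass_real]
  unfold lag
  ring

/-- Irreducibility makes γ₂{F₁ ≤ 0} smaller than every positive number. The mass γ₂{F₁ ≥ M} equals
lag(M), so the top level is γ₂-null exactly when it is missing from the domain. -/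
lemma Irreducible.ae_mem_lagDom (H : Irreducible γ₁ γ₂) :
    ∀ᵐ y ∂γ₂, cdfR γ₁ y ∈ lagDom γ₁ γ₂ := by
  rcases (measureReal_nonneg (μ := γ₁) (s := univ)).eq_or_lt with hM | hM
  · have : γ₂ = 0 := by
      rw [← Measure.measure_univ_eq_zero, ← H.mass, ← measureReal_eq_zero_iff]
      exact hM.symm
    simp [this]
  have h0 : γ₂ {y | cdfR γ₁ y ≤ 0} = 0 := by
    rw [← measureReal_eq_zero_iff]
    refine le_antisymm (le_of_forall_gt_imp_ge_of_dense fun v hv => ?_) measureReal_nonneg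
    have hv' : 0 < min v (γ₁.real univ / 2) := lt_min hv (half_pos hM)
    exact ((H.measureReal_lowerSet_lt (isLowerSet_cdfR_le 0) hv'
      ((min_le_right _ _).trans_lt (half_lt_self hM)) fun x hx => le_trans hx hv'.le).le).trans
      (min_le_left _ _)
  have h1 : lag γ₁ γ₂ (γ₁.real univ) ≤ 0 → γ₂ {y | γ₁.real univ ≤ cdfR γ₁ y} = 0 := by
    intro h
    rw [← measureReal_eq_zero_iff]
    refine le_antisymm ?_ measureReal_nonneg
    rw [H.measureReal_compl_cdfR_lt]
    linarith
  have h0' : ∀ᵐ y ∂γ₂, ¬ cdfR γ₁ y ≤ 0 := measure_eq_zero_iff_ae_notMem.1 h0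
  by_cases hl : lag γ₁ γ₂ (γ₁.real univ) ≤ 0
  · filter_upwards [h0', measure_eq_zero_iff_ae_notMem.1 (h1 hl)] with y hy hy'
    by_contra hn
    rcases H.notMem_lagDom hn with h | h
    · exact hy h.le
    · exact hy' h.1.ge
  · filter_upwards [h0'] with y hy
    by_contra hn
    rcases H.notMem_lagDom hn with h | h
    · exact hy h.le
    · exact hl h.2

lemma Irreducible.logFactor_mono (H : Irreducible γ₁ γ₂) {x y : ℝ}
    (hx : cdfR γ₁ x ∈ lagDom γ₁ γ₂) (hy : cdfR γ₁ y ∈ lagDom γ₁ γ₂) (hxy : x ≤ y) :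
    logFactor γ₁ γ₂ x ≤ logFactor γ₁ γ₂ y := by
  unfold logFactor
  rw [levelLog_eq hx, levelLog_eq hy]
  exact H.lagPrim_mono hx hy (cdfR_mono γ₁ hxy)

/-- The tail integral of the second factor of the Kellerer plan. -/
lemma Irreducible.lintegral_exp_neg_logFactor (H : Irreducible γ₁ γ₂) {t : ℝ}
    (ht : cdfR γ₁ t ∈ lagDom γ₁ γ₂) :
    ∫⁻ y in Ioi t, ENNReal.ofReal (Real.exp (-logFactor γ₁ γ₂ y)) ∂γ₂ =
      ENNReal.ofReal (Real.exp (-logFactor γ₁ γ₂ t) * (cdfR γ₁ t - cdfR γ₂ t)) := by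
  set s := cdfR γ₁ t with hs
  set M := γ₁.real univ with hM
  set E := Real.exp (-lagPrim γ₁ γ₂ s) with hE
  have ht' : Real.exp (-logFactor γ₁ γ₂ t) = E := by
    rw [hE, logFactor, ← hs, levelLog_eq ht]
  -- The difference E − exp(−L(F₁(y))) is the integral of k over the levels between s and F₁(y).
  -- Integrating over y > t and exchanging the integrals brings in γ₂{F₁ ≥ v} = M − v + lag(v), and
  -- the result is (M − s)E.
  set k : ℝ → ENNReal := (lagDom γ₁ γ₂).indicator fun v =>
    ENNReal.ofReal (Real.exp (-levelLog γ₁ γ₂ v) * (lag γ₁ γ₂ v)⁻¹) with hk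
  have hkm : Measurable k :=
    ((H.measurable_levelLog.neg.exp.mul measurable_lag.inv).ennreal_ofReal).indicator
      H.measurableSet_lagDom
  have hF := lintegral_lintegral_Ioc (γ₂.restrict (Ioi t)) (measurable_const (a := s))
    (measurable_cdfR γ₁) hkm
  have hinner : ∫⁻ y in Ioi t, (∫⁻ v in Ioc s (cdfR γ₁ y), k v) ∂γ₂ =
      ∫⁻ y in Ioi t, ENNReal.ofReal (E - Real.exp (-logFactor γ₁ γ₂ y)) ∂γ₂ := by
    refine lintegral_congr_ae ?_
    filter_upwards [ae_restrict_of_ae H.ae_mem_lagDom, ae_restrict_mem measurableSet_Ioi]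
      with y hy hyt
    have hle : s ≤ cdfR γ₁ y := cdfR_mono γ₁ (le_of_lt hyt)
    rw [logFactor, levelLog_eq hy, hE, ← H.lintegral_exp_neg_lagPrim ht hy hle]
    refine setLIntegral_congr_fun measurableSet_Ioc fun v hv => ?_
    have hv' : v ∈ lagDom γ₁ γ₂ := H.ordConnected_lagDom.out ht hy (Ioc_subset_Icc_self hv)
    simp only [hk, indicator_of_mem hv', levelLog_eq hv']
  have houter : ∫⁻ v, k v * (γ₂.restrict (Ioi t)) {y | s < v ∧ v ≤ cdfR γ₁ y} =
      ENNReal.ofReal ((M - s) * E) := by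
    rw [hE, ← H.lintegral_exp_neg_lagPrim_last ht, ← lintegral_indicator measurableSet_Ioc]
    -- The top level need not belong to `lagDom`, but a single level is negligible.
    have hIoo : ∀ᵐ v : ℝ, v ≠ M := by simp [ae_iff]
    refine lintegral_congr_ae ?_
    filter_upwards [hIoo] with v hvM
    by_cases hv : v ∈ Ioc s M
    · have hv' : v ∈ lagDom γ₁ γ₂ :=
        H.Ioo_subset_lagDom ⟨ht.1.trans hv.1, hv.2.lt_of_ne hvM⟩
      have hset : {y | s < v ∧ v ≤ cdfR γ₁ y} = {y | v ≤ cdfR γ₁ y} := by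
        ext y; simp [hv.1]
      have hsub : {y | v ≤ cdfR γ₁ y} ⊆ Ioi t := by
        intro y hy
        by_contra hyt
        exact absurd (hv.1.trans_le hy) (not_lt.2 (cdfR_mono γ₁ (not_lt.1 hyt)))
      have hmeas : MeasurableSet {y | v ≤ cdfR γ₁ y} :=
        measurableSet_le measurable_const (measurable_cdfR γ₁)
      rw [indicator_of_mem hv, hset, Measure.restrict_apply hmeas, inter_eq_left.2 hsub]
      have h1 : γ₂ {y | v ≤ cdfR γ₁ y} = ENNReal.ofReal (M - v + lag γ₁ γ₂ v) := by
        rw [← H.measureReal_compl_cdfR_lt, ofReal_measureReal]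
      have hpos := hv'.2.2
      simp only [hk, indicator_of_mem hv', levelLog_eq hv']
      rw [h1, ← ENNReal.ofReal_mul (by positivity)]
      congr 1
      field_simp
      ring
    · rw [indicator_of_notMem hv]
      by_cases hvs : s < v
      · have : v ∉ lagDom γ₁ γ₂ := fun h => hv ⟨hvs, h.2.1⟩
        simp [hk, indicator_of_notMem this]
      · simp [hvs]
  have hEexp : ∀ᵐ y ∂(γ₂.restrict (Ioi t)), Real.exp (-logFactor γ₁ γ₂ y) ≤ E := by
    filter_upwards [ae_restrict_of_ae H.ae_mem_lagDom, ae_restrict_mem measurableSet_Ioi]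
      with y hy hyt
    rw [← ht']
    exact Real.exp_le_exp.2 (neg_le_neg (H.logFactor_mono ht hy (le_of_lt hyt)))
  have hml : Measurable fun y => ENNReal.ofReal (Real.exp (-logFactor γ₁ γ₂ y)) :=
    H.measurable_logFactor.neg.exp.ennreal_ofReal
  have hsum : ∫⁻ y in Ioi t, ENNReal.ofReal (Real.exp (-logFactor γ₁ γ₂ y)) ∂γ₂ +
      ENNReal.ofReal ((M - s) * E) = ENNReal.ofReal (E * (M - cdfR γ₂ t)) := by
    rw [← houter, ← hF, hinner, ← lintegral_add_left hml]
    have : ∫⁻ y in Ioi t, (ENNReal.ofReal (Real.exp (-logFactor γ₁ γ₂ y)) +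
        ENNReal.ofReal (E - Real.exp (-logFactor γ₁ γ₂ y))) ∂γ₂ =
        ∫⁻ y in Ioi t, ENNReal.ofReal E ∂γ₂ := by
      refine lintegral_congr_ae ?_
      filter_upwards [hEexp] with y hy
      rw [← ENNReal.ofReal_add (Real.exp_pos _).le (sub_nonneg.2 hy)]
      congr 1
      ring
    rw [this, setLIntegral_const, ENNReal.ofReal_mul (Real.exp_pos _).le]
    congr 1
    have : Ioi t = (Iic t)ᶜ := by simp
    rw [← ofReal_measureReal, this, measureReal_compl measurableSet_Iic, H.mass_real]
    rfl
  have hE0 : 0 < E := Real.exp_pos _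
  have h1 : 0 ≤ M - s := sub_nonneg.2 ht.2.1
  rw [ht']
  have h2 : ENNReal.ofReal (E * (M - cdfR γ₂ t)) =
      ENNReal.ofReal (E * (s - cdfR γ₂ t)) + ENNReal.ofReal ((M - s) * E) := by
    rw [← ENNReal.ofReal_add _ (by positivity)]
    · congr 1; ring
    · refine mul_nonneg hE0.le (sub_nonneg.2 ?_)
      rcases H.right t with h | h | h
      · exact h.le
      · rw [h.2]; exact ht.1.le
      · rw [h.2, hs, h.1]
  rw [h2] at hsum
  exact (ENNReal.add_left_inj ENNReal.ofReal_ne_top).1 hsum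

end lag

/-! ### Quantiles and the explicit Kellerer plan -/

/-- The quantile function of a measure on the line. -/
def quant (γ : Measure ℝ) (u : ℝ) : ℝ := sInf {t | u ≤ cdfR γ t}

lemma le_cdfR_quant {γ : Measure ℝ} [IsFiniteMeasure γ] {u : ℝ} (hne : ∃ t, u ≤ cdfR γ t) :
    u ≤ cdfR γ (quant γ u) := by
  refine ge_of_tendsto (tendsto_cdfR_nhdsGT γ (quant γ u)) ?_
  filter_upwards [self_mem_nhdsWithin] with t ht
  obtain ⟨r, hr, hrt⟩ := exists_lt_of_csInf_lt hne ht
  exact le_trans hr (cdfR_mono γ hrt.le)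

lemma quant_le_iff {γ : Measure ℝ} [IsFiniteMeasure γ] {u t : ℝ} (hu : 0 < u)
    (hne : ∃ t, u ≤ cdfR γ t) : quant γ u ≤ t ↔ u ≤ cdfR γ t := by
  refine ⟨fun h => (le_cdfR_quant hne).trans (cdfR_mono γ h), fun h => csInf_le ?_ h⟩
  obtain ⟨r, hr⟩ := ((tendsto_cdfR_atBot γ).eventually_lt_const hu).exists
  refine ⟨r, fun s hs => ?_⟩
  by_contra hsr
  exact absurd (le_trans hs (cdfR_mono γ (not_le.1 hsr).le)) (not_le.2 hr)

lemma quant_mono {γ : Measure ℝ} [IsFiniteMeasure γ] {u w : ℝ} (hu : 0 < u) (huw : u ≤ w)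
    (hw : ∃ t, w ≤ cdfR γ t) : quant γ u ≤ quant γ w :=
  (quant_le_iff hu (hw.imp fun _ h => huw.trans h)).2 (huw.trans (le_cdfR_quant hw))

section lag

variable {γ₁ γ₂ : Measure ℝ} [IsFiniteMeasure γ₁] [IsFiniteMeasure γ₂]

lemma Irreducible.exists_le_cdfR (H : Irreducible γ₁ γ₂) {u : ℝ} (hu : u ∈ lagDom γ₁ γ₂) :
    ∃ t, u ≤ cdfR γ₁ t := by
  have h : 0 < γ₂.real {y | u ≤ cdfR γ₁ y} := by
    rw [H.measureReal_compl_cdfR_lt]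
    linarith [hu.2.1, hu.2.2]
  by_contra! hn
  have : {y | u ≤ cdfR γ₁ y} = ∅ := by
    ext y; simp [hn y]
  simp [this] at h

lemma Irreducible.setOf_le_cdfR (H : Irreducible γ₁ γ₂) {u : ℝ} (hu : u ∈ lagDom γ₁ γ₂) :
    {y | u ≤ cdfR γ₁ y} = Ici (quant γ₁ u) := by
  ext y
  exact (quant_le_iff hu.1 (H.exists_le_cdfR hu)).symm

lemma Irreducible.Ici_quant_pos (H : Irreducible γ₁ γ₂) {u : ℝ} (hu : u ∈ lagDom γ₁ γ₂) :
    0 < γ₂ (Ici (quant γ₁ u)) := by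
  have h : 0 < γ₂.real {y | u ≤ cdfR γ₁ y} := by
    rw [H.measureReal_compl_cdfR_lt]
    linarith [hu.2.1, hu.2.2]
  rw [H.setOf_le_cdfR hu] at h
  exact (ENNReal.toReal_pos_iff.1 h).1

/-- At an atom F₁ overshoots u and might reach an excluded top level M. Then γ₂{F₁ ≥ u} would be at
most lag(M) ≤ 0, whereas it equals M − u + lag(u) > 0. -/
lemma Irreducible.cdfR_quant_mem (H : Irreducible γ₁ γ₂) {u : ℝ} (hu : u ∈ lagDom γ₁ γ₂) :
    cdfR γ₁ (quant γ₁ u) ∈ lagDom γ₁ γ₂ := by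
  by_contra hn
  have h1 := le_cdfR_quant (H.exists_le_cdfR hu)
  rcases H.notMem_lagDom hn with h | ⟨h, h'⟩
  · exact absurd h (hu.1.trans_le h1).ne'
  · have h2 : γ₂.real {y | u ≤ cdfR γ₁ y} ≤ γ₂.real {y | γ₁.real univ ≤ cdfR γ₁ y} := by
      refine measureReal_mono ?_
      rw [H.setOf_le_cdfR hu]
      intro y hy
      have := cdfR_mono γ₁ (show quant γ₁ u ≤ y from hy)
      rwa [h] at this
    rw [H.measureReal_compl_cdfR_lt, H.measureReal_compl_cdfR_lt] at h2
    linarith [hu.2.1, hu.2.2]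

variable (γ₁ γ₂) in
/-- The image under the quantile function of `γ₁` is the first factor of the Kellerer plan. -/
def levelMeasure : Measure ℝ :=
  (volume.restrict (lagDom γ₁ γ₂)).withDensity fun v =>
    ENNReal.ofReal (Real.exp (levelLog γ₁ γ₂ v) * (lag γ₁ γ₂ v)⁻¹)

variable (γ₁ γ₂) in
/-- The first factor of the Kellerer plan. -/
def firstFactor : Measure ℝ := (levelMeasure γ₁ γ₂).map (quant γ₁)

variable (γ₁ γ₂) in
/-- The second factor of the Kellerer plan. -/
def secondFactor : Measure ℝ :=
  γ₂.withDensity fun y => ENNReal.ofReal (Real.exp (-logFactor γ₁ γ₂ y))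

instance : SFinite (levelMeasure γ₁ γ₂) := by unfold levelMeasure; infer_instance
instance : SFinite (firstFactor γ₁ γ₂) := by unfold firstFactor; infer_instance
instance : SigmaFinite (secondFactor γ₁ γ₂) :=
  SigmaFinite.withDensity_ofReal _

lemma Irreducible.ae_levelMeasure (H : Irreducible γ₁ γ₂) :
    ∀ᵐ u ∂(levelMeasure γ₁ γ₂), u ∈ lagDom γ₁ γ₂ :=
  (withDensity_absolutelyContinuous _ _).ae_le (ae_restrict_mem H.measurableSet_lagDom)

lemma Irreducible.aemeasurable_quant (H : Irreducible γ₁ γ₂) :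
    AEMeasurable (quant γ₁) (levelMeasure γ₁ γ₂) :=
  (aemeasurable_restrict_of_monotoneOn H.measurableSet_lagDom fun _ hu _ hw huw =>
    quant_mono hu.1 huw (H.exists_le_cdfR hw)).mono_ac (withDensity_absolutelyContinuous _ _)

lemma Irreducible.firstFactor_Iic' (H : Irreducible γ₁ γ₂) (y : ℝ) :
    firstFactor γ₁ γ₂ (Iic y) = levelMeasure γ₁ γ₂ (Iic (cdfR γ₁ y)) := by
  rw [firstFactor, Measure.map_apply_of_aemeasurable H.aemeasurable_quant measurableSet_Iic]
  refine measure_congr ?_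
  filter_upwards [H.ae_levelMeasure] with u hu
  exact propext (quant_le_iff hu.1 (H.exists_le_cdfR hu))

lemma Irreducible.firstFactor_Iic (H : Irreducible γ₁ γ₂) {y : ℝ}
    (hy : cdfR γ₁ y ∈ lagDom γ₁ γ₂) :
    firstFactor γ₁ γ₂ (Iic y) = ENNReal.ofReal (Real.exp (logFactor γ₁ γ₂ y)) := by
  have hset : Iic (cdfR γ₁ y) ∩ lagDom γ₁ γ₂ = Ioc 0 (cdfR γ₁ y) := by
    ext u
    refine ⟨fun h => ⟨h.2.1, h.1⟩, fun h => ⟨h.2, ?_⟩⟩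
    rcases h.2.lt_or_eq with h' | h'
    · exact H.Ioo_subset_lagDom ⟨h.1, h'.trans_le hy.2.1⟩
    · rwa [h']
  rw [H.firstFactor_Iic', levelMeasure, withDensity_apply _ measurableSet_Iic,
    Measure.restrict_restrict measurableSet_Iic, hset, logFactor, levelLog_eq hy,
    ← H.lintegral_exp_lagPrim_zero hy]
  refine setLIntegral_congr_fun measurableSet_Ioc fun v hv => ?_
  have hv' : v ∈ lagDom γ₁ γ₂ := (hset.ge hv).2
  simp only [levelLog_eq hv']

lemma Irreducible.firstFactor_Iic_zero (H : Irreducible γ₁ γ₂) {y : ℝ}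
    (hy : cdfR γ₁ y = 0) : firstFactor γ₁ γ₂ (Iic y) = 0 := by
  rw [H.firstFactor_Iic', hy]
  refine measure_eq_zero_iff_ae_notMem.2 ?_
  filter_upwards [H.ae_levelMeasure] with u hu h
  exact absurd hu.1 (not_lt.2 h)

lemma Irreducible.ae_firstFactor (H : Irreducible γ₁ γ₂) :
    ∀ᵐ x ∂(firstFactor γ₁ γ₂), cdfR γ₁ x ∈ lagDom γ₁ γ₂ ∧ 0 < γ₂ (Ici x) := by
  have hm : MeasurableSet {x : ℝ | cdfR γ₁ x ∈ lagDom γ₁ γ₂ ∧ 0 < γ₂ (Ici x)} := by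
    refine (measurable_cdfR γ₁ H.measurableSet_lagDom).inter ?_
    have : Antitone fun x : ℝ => γ₂ (Ici x) := fun _ _ h => measure_mono (Ici_subset_Ici.2 h)
    exact measurableSet_lt measurable_const this.measurable
  rw [firstFactor, ae_map_iff H.aemeasurable_quant hm]
  filter_upwards [H.ae_levelMeasure] with u hu
  exact ⟨H.cdfR_quant_mem hu, H.Ici_quant_pos hu⟩

variable (γ₁ γ₂) in
/-- The Kellerer plan, constructed from its factors. -/
def factorPlan : Measure (ℝ × ℝ) :=
  ((firstFactor γ₁ γ₂).prod (secondFactor γ₁ γ₂)).restrict halfPlane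

/-- The section of F at height y has first-factor mass exp(L(F₁(y))), which cancels the density of
the second factor. -/
lemma Irreducible.factorPlan_snd (H : Irreducible γ₁ γ₂) :
    (factorPlan γ₁ γ₂).map Prod.snd = γ₂ := by
  ext A hA
  have hm : MeasurableSet (Prod.snd ⁻¹' A ∩ halfPlane) :=
    (measurable_snd hA).inter measurableSet_halfPlane
  have hmeas : Measurable fun y => firstFactor γ₁ γ₂ (Iic y) :=
    Monotone.measurable fun _ _ h => measure_mono (Iic_subset_Iic.2 h)
  rw [Measure.map_apply measurable_snd hA, factorPlan,
    Measure.restrict_apply (measurable_snd hA), Measure.prod_apply_symm hm]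
  have h1 (y : ℝ) : firstFactor γ₁ γ₂ ((fun x => (x, y)) ⁻¹' (Prod.snd ⁻¹' A ∩ halfPlane)) =
      A.indicator (fun y => firstFactor γ₁ γ₂ (Iic y)) y := by
    by_cases hy : y ∈ A
    · rw [indicator_of_mem hy]
      congr 1
      ext x
      simp [hy, halfPlane]
    · rw [indicator_of_notMem hy]
      have : (fun x => (x, y)) ⁻¹' (Prod.snd ⁻¹' A ∩ halfPlane) = ∅ := by
        ext x
        simp [hy]
      rw [this, measure_empty]
  simp_rw [h1]
  rw [lintegral_indicator hA, secondFactor, restrict_withDensity hA,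
    lintegral_withDensity_eq_lintegral_mul _
      (by exact H.measurable_logFactor.neg.exp.ennreal_ofReal) hmeas]
  conv_rhs => rw [← setLIntegral_one]
  refine lintegral_congr_ae ?_
  filter_upwards [ae_restrict_of_ae H.ae_mem_lagDom] with y hy
  rw [Pi.mul_apply, H.firstFactor_Iic hy, ← ENNReal.ofReal_mul (Real.exp_pos _).le,
    ← Real.exp_add]
  simp

lemma Irreducible.factorPlan_univ (H : Irreducible γ₁ γ₂) :
    factorPlan γ₁ γ₂ univ = γ₂ univ := by
  conv_rhs => rw [← H.factorPlan_snd]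
  rw [Measure.map_apply measurable_snd MeasurableSet.univ, preimage_univ]

lemma Irreducible.isFiniteMeasure_factorPlan (H : Irreducible γ₁ γ₂) :
    IsFiniteMeasure (factorPlan γ₁ γ₂) := ⟨by rw [H.factorPlan_univ]; exact measure_lt_top _ _⟩

lemma Irreducible.secondFactor_Ioi (H : Irreducible γ₁ γ₂) {t : ℝ}
    (ht : cdfR γ₁ t ∈ lagDom γ₁ γ₂) :
    secondFactor γ₁ γ₂ (Ioi t) =
      ENNReal.ofReal (Real.exp (-logFactor γ₁ γ₂ t) * (cdfR γ₁ t - cdfR γ₂ t)) := by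
  rw [secondFactor, withDensity_apply _ measurableSet_Ioi, H.lintegral_exp_neg_logFactor ht]

lemma ae_factorPlan_le : ∀ᵐ p ∂(factorPlan γ₁ γ₂), p.1 ≤ p.2 :=
  ae_restrict_mem measurableSet_halfPlane

/-- For a plan carried by F, the first distribution function at t exceeds the second by the mass of
the rectangle ]−∞, t] × ]t, ∞[. The rectangle lies in F, so its mass is the product exp(L) ·
exp(−L)(F₁ − F₂). -/
lemma Irreducible.factorPlan_fst (H : Irreducible γ₁ γ₂) :
    (factorPlan γ₁ γ₂).map Prod.fst = γ₁ := by
  have := H.isFiniteMeasure_factorPlan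
  have hsnd (t : ℝ) : factorPlan γ₁ γ₂ {p | p.2 ≤ t} = γ₂ (Iic t) := by
    conv_rhs => rw [← H.factorPlan_snd]
    rw [Measure.map_apply measurable_snd measurableSet_Iic]
    rfl
  have hle (t : ℝ) : γ₂ (Iic t) ≤ factorPlan γ₁ γ₂ {p | p.1 ≤ t} := by
    rw [← hsnd]
    refine measure_mono_ae ?_
    filter_upwards [ae_factorPlan_le] with p hp h
    exact hp.trans h
  refine (Measure.ext_of_Iic _ _ fun t => ?_).symm
  rw [Measure.map_apply measurable_fst measurableSet_Iic]
  change _ = factorPlan γ₁ γ₂ {p | p.1 ≤ t}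
  by_cases ht : cdfR γ₁ t ∈ lagDom γ₁ γ₂
  · have hsplit : factorPlan γ₁ γ₂ {p | p.1 ≤ t} =
        factorPlan γ₁ γ₂ {p | p.2 ≤ t} + factorPlan γ₁ γ₂ (Iic t ×ˢ Ioi t) := by
      rw [← measure_union]
      · refine measure_congr ?_
        filter_upwards [ae_factorPlan_le] with p hp
        refine propext ⟨fun h => ?_, fun h => ?_⟩
        · rcases le_or_gt p.2 t with h' | h'
          · exact Or.inl h'
          · exact Or.inr ⟨h, h'⟩
        · rcases h with h | h
          · exact hp.trans h
          · exact h.1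
      · rw [Set.disjoint_left]
        rintro p hp ⟨_, hp'⟩
        exact absurd (show p.2 ≤ t from hp) (not_le.2 hp')
      · exact measurableSet_Iic.prod measurableSet_Ioi
    have hrect : factorPlan γ₁ γ₂ (Iic t ×ˢ Ioi t) =
        ENNReal.ofReal (cdfR γ₁ t - cdfR γ₂ t) := by
      have hsub : Iic t ×ˢ Ioi t ⊆ halfPlane := fun p hp =>
        show p.1 ≤ p.2 from le_trans (mem_Iic.1 hp.1) (le_of_lt (mem_Ioi.1 hp.2))
      rw [factorPlan, Measure.restrict_apply (measurableSet_Iic.prod measurableSet_Ioi),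
        inter_eq_left.2 hsub, Measure.prod_prod, H.firstFactor_Iic ht, H.secondFactor_Ioi ht,
        ← ENNReal.ofReal_mul (Real.exp_pos _).le, ← mul_assoc, ← Real.exp_add]
      simp
    have hFle : cdfR γ₂ t ≤ cdfR γ₁ t := by
      rcases H.right t with h | h | h
      · exact h.le
      · rw [h.1, h.2]
      · rw [h.1, h.2]
    rw [hsplit, hsnd, hrect, ← ofReal_measureReal (μ := γ₂), ← ENNReal.ofReal_add
      measureReal_nonneg (sub_nonneg.2 hFle), ← ofReal_measureReal (μ := γ₁)]
    congr 1
    change cdfR γ₁ t = cdfR γ₂ t + (cdfR γ₁ t - cdfR γ₂ t)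
    ring
  -- Two degenerate levels remain. At level 0 the first factor has no mass up to t; at an excluded
  -- top level, a non-positive lag forces all of γ₂ into ]−∞, t].
  rcases H.notMem_lagDom ht with h | ⟨h, h'⟩
  · have h0 : γ₁ (Iic t) = 0 := (measureReal_eq_zero_iff).1 h
    rw [h0, eq_comm, factorPlan]
    refine measure_mono_null (t := Iic t ×ˢ univ) (fun p hp => ⟨hp, mem_univ _⟩) ?_
    refine Measure.absolutelyContinuous_of_le Measure.restrict_le_self ?_
    rw [Measure.prod_prod, H.firstFactor_Iic_zero h, zero_mul]
  · have h1 : γ₁ (Iic t) = γ₁ univ := by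
      rw [← ofReal_measureReal (μ := γ₁) (s := Iic t), ← ofReal_measureReal (μ := γ₁) (s := univ)]
      exact congrArg _ h
    refine le_antisymm ?_ ?_
    · refine le_trans ?_ (hle t)
      rw [h1, ← ofReal_measureReal, ← ofReal_measureReal (μ := γ₂)]
      refine ENNReal.ofReal_le_ofReal ?_
      have h2 : γ₁.real univ ≤ γ₂.real {y | cdfR γ₁ y < γ₁.real univ} := by
        unfold lag at h'
        linarith
      refine h2.trans (measureReal_mono fun y hy => ?_)
      by_contra hyt
      have := cdfR_mono γ₁ (not_le.1 hyt).le
      rw [h] at this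
      exact absurd hy (not_lt.2 this)
    · rw [h1, H.mass, ← H.factorPlan_univ]
      exact measure_mono (subset_univ _)

end lag

/-! ### Logarithms of the factors -/

section lag

variable {γ₁ γ₂ : Measure ℝ} [IsFiniteMeasure γ₁] [IsFiniteMeasure γ₂]

/-- This is the first marginal computed by vertical sections of F. Inverting the density expresses
the first factor through γ₁, as the entropy comparison needs. -/
lemma Irreducible.withDensity_firstFactor (H : Irreducible γ₁ γ₂) :
    (firstFactor γ₁ γ₂).withDensity (fun x => secondFactor γ₁ γ₂ (Ici x)) = γ₁ := by
  ext A hA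
  have hm : MeasurableSet (Prod.fst ⁻¹' A ∩ halfPlane) :=
    (measurable_fst hA).inter measurableSet_halfPlane
  conv_rhs => rw [← H.factorPlan_fst]
  rw [Measure.map_apply measurable_fst hA, factorPlan,
    Measure.restrict_apply (measurable_fst hA), Measure.prod_apply hm, withDensity_apply _ hA,
    ← lintegral_indicator hA]
  refine lintegral_congr fun x => ?_
  by_cases hx : x ∈ A
  · rw [indicator_of_mem hx]
    congr 1
    ext y
    simp [hx, halfPlane]
  · rw [indicator_of_notMem hx]
    have : Prod.mk x ⁻¹' (Prod.fst ⁻¹' A ∩ halfPlane) = ∅ := by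
      ext y
      simp [hx]
    rw [this, measure_empty]

lemma measurable_secondFactor_Ici : Measurable fun x => secondFactor γ₁ γ₂ (Ici x) :=
  Antitone.measurable fun _ _ h => measure_mono (Ici_subset_Ici.2 h)

lemma Irreducible.secondFactor_Ici_le (H : Irreducible γ₁ γ₂) {x : ℝ}
    (hx : cdfR γ₁ x ∈ lagDom γ₁ γ₂) :
    secondFactor γ₁ γ₂ (Ici x) ≤
      ENNReal.ofReal (Real.exp (-logFactor γ₁ γ₂ x) * γ₁.real univ) := by
  rw [secondFactor, withDensity_apply _ measurableSet_Ici]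
  have : ∫⁻ y in Ici x, ENNReal.ofReal (Real.exp (-logFactor γ₁ γ₂ y)) ∂γ₂ ≤
      ∫⁻ y in Ici x, ENNReal.ofReal (Real.exp (-logFactor γ₁ γ₂ x)) ∂γ₂ := by
    refine lintegral_mono_ae ?_
    filter_upwards [ae_restrict_of_ae H.ae_mem_lagDom, ae_restrict_mem measurableSet_Ici]
      with y hy hyx
    exact ENNReal.ofReal_le_ofReal
      (Real.exp_le_exp.2 (neg_le_neg (H.logFactor_mono hx hy hyx)))
  refine this.trans ?_
  rw [setLIntegral_const, ENNReal.ofReal_mul (Real.exp_pos _).le, ofReal_measureReal, H.mass]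
  gcongr
  exact subset_univ _

lemma Irreducible.secondFactor_Ici_pos {x : ℝ} (H : Irreducible γ₁ γ₂)
    (hx : 0 < γ₂ (Ici x)) : 0 < secondFactor γ₁ γ₂ (Ici x) := by
  have hm : Measurable fun y => ENNReal.ofReal (Real.exp (-logFactor γ₁ γ₂ y)) :=
    H.measurable_logFactor.neg.exp.ennreal_ofReal
  have h : γ₂ ≪ secondFactor γ₁ γ₂ := withDensity_absolutelyContinuous' hm.aemeasurable
    (ae_of_all _ fun y => by simp [Real.exp_pos])
  exact pos_iff_ne_zero.2 fun h0 => hx.ne' (h h0)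

lemma Irreducible.ae_fst (H : Irreducible γ₁ γ₂) :
    ∀ᵐ x ∂γ₁, cdfR γ₁ x ∈ lagDom γ₁ γ₂ ∧ 0 < secondFactor γ₁ γ₂ (Ici x) := by
  have : γ₁ ≪ firstFactor γ₁ γ₂ := by
    conv_lhs => rw [← H.withDensity_firstFactor]
    exact withDensity_absolutelyContinuous _ _
  filter_upwards [this.ae_le H.ae_firstFactor] with x hx
  exact ⟨hx.1, H.secondFactor_Ici_pos hx.2⟩

variable (γ₁ γ₂) in
/-- The logarithm of the tail function of the second factor of the Kellerer plan. -/
def logTail (x : ℝ) : ℝ := Real.log (secondFactor γ₁ γ₂ (Ici x)).toReal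

lemma measurable_logTail : Measurable (logTail γ₁ γ₂) :=
  measurable_secondFactor_Ici.ennreal_toReal.log

lemma Irreducible.firstFactor_eq (H : Irreducible γ₁ γ₂) :
    firstFactor γ₁ γ₂ = γ₁.withDensity fun x => ENNReal.ofReal (Real.exp (-logTail γ₁ γ₂ x)) := by
  have h := withDensity_inv_same (μ := firstFactor γ₁ γ₂)
    (measurable_secondFactor_Ici (γ₁ := γ₁) (γ₂ := γ₂))
    (by
      filter_upwards [H.ae_firstFactor] with x hx using (H.secondFactor_Ici_pos hx.2).ne')
    (by
      filter_upwards [H.ae_firstFactor] with x hx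
      exact ne_top_of_le_ne_top ENNReal.ofReal_ne_top (H.secondFactor_Ici_le hx.1))
  rw [H.withDensity_firstFactor] at h
  rw [← h]
  refine withDensity_congr_ae ?_
  filter_upwards [H.ae_fst] with x hx
  have hfin := ne_top_of_le_ne_top ENNReal.ofReal_ne_top (H.secondFactor_Ici_le hx.1)
  have hpos := ENNReal.toReal_pos hx.2.ne' hfin
  rw [logTail, Real.exp_neg, Real.exp_log hpos, ENNReal.ofReal_inv_of_pos hpos,
    ENNReal.ofReal_toReal hfin]

/-- The tail integral from x is at most the total mass times exp(−l(x)), because l is monotone. This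
one-sided bound replaces integrability of b and l. -/
lemma Irreducible.logTail_add_le (H : Irreducible γ₁ γ₂) :
    ∀ᵐ x ∂γ₁, logTail γ₁ γ₂ x + logFactor γ₁ γ₂ x ≤ Real.log (γ₁.real univ) := by
  filter_upwards [H.ae_fst] with x hx
  have hle := H.secondFactor_Ici_le hx.1
  have hfin := ne_top_of_le_ne_top ENNReal.ofReal_ne_top hle
  have hpos := ENNReal.toReal_pos hx.2.ne' hfin
  have hM := mass_pos_of_mem_lagDom hx.1
  have h1 : (secondFactor γ₁ γ₂ (Ici x)).toReal ≤
      Real.exp (-logFactor γ₁ γ₂ x) * γ₁.real univ :=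
    ENNReal.toReal_le_of_le_ofReal (by positivity) hle
  have h2 := Real.log_le_log hpos h1
  rw [Real.log_mul (Real.exp_pos _).ne' hM.ne', Real.log_exp] at h2
  unfold logTail
  linarith

/-- The logarithm of the second factor is displaced by an amount that depends on the marginals
only, for transport plans to the right. -/
lemma Irreducible.lintegral_logFactor_sub (H : Irreducible γ₁ γ₂) :
    ∃ c : ENNReal, c ≠ ⊤ ∧ ∀ π ∈ Marg γ₁ γ₂, (∀ᵐ p ∂π, p.1 ≤ p.2) →
      (∀ᵐ p ∂π, logFactor γ₁ γ₂ p.1 ≤ logFactor γ₁ γ₂ p.2) ∧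
      ∫⁻ p, ENNReal.ofReal (logFactor γ₁ γ₂ p.2 - logFactor γ₁ γ₂ p.1) ∂π = c := by
  set k : ℝ → ENNReal := (lagDom γ₁ γ₂).indicator fun v =>
    ENNReal.ofReal (lag γ₁ γ₂ v)⁻¹ with hk
  have hkm : Measurable k := measurable_lag.inv.ennreal_ofReal.indicator H.measurableSet_lagDom
  -- Write l(y) − l(x) as the integral of 1/lag over the levels passed. Every plan to the right
  -- carries the same mass past level v, namely the difference of the marginal masses of {F₁ < v}.
  refine ⟨∫⁻ v, k v * (γ₁ {x | cdfR γ₁ x < v} - γ₂ {x | cdfR γ₁ x < v}), ?_, ?_⟩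
  · have hle : ∫⁻ v, k v * (γ₁ {x | cdfR γ₁ x < v} - γ₂ {x | cdfR γ₁ x < v}) ≤
        ∫⁻ v, (Ioc 0 (γ₁.real univ)).indicator 1 v := by
      refine lintegral_mono fun v => ?_
      by_cases hv : v ∈ lagDom γ₁ γ₂
      · rw [indicator_of_mem (show v ∈ Ioc 0 (γ₁.real univ) from ⟨hv.1, hv.2.1⟩), hk,
          indicator_of_mem hv, ← ofReal_measureReal, ← ofReal_measureReal (μ := γ₂),
          ← ENNReal.ofReal_sub _ measureReal_nonneg,
          ← ENNReal.ofReal_mul (inv_nonneg.2 hv.2.2.le), Pi.one_apply, ← ENNReal.ofReal_one]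
        refine ENNReal.ofReal_le_ofReal ?_
        rw [inv_mul_le_iff₀ hv.2.2, mul_one, lag]
        exact sub_le_sub_right (measureReal_lowerSet_le (isLowerSet_cdfR_lt v) hv.1.le
          fun x hx => le_of_lt hx) _
      · simp [hk, indicator_of_notMem hv]
    refine ne_top_of_le_ne_top ?_ hle
    rw [lintegral_indicator_one measurableSet_Ioc]
    simp
  intro π hπ hF
  have := hπ.1
  have h1 : ∀ᵐ p ∂π, cdfR γ₁ p.1 ∈ lagDom γ₁ γ₂ := by
    have h := H.ae_fst
    rw [← hπ.2.1] at h
    filter_upwards [ae_of_ae_map measurable_fst.aemeasurable h] with p hp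
    exact hπ.2.1 ▸ hp.1
  have h2 : ∀ᵐ p ∂π, cdfR γ₁ p.2 ∈ lagDom γ₁ γ₂ := by
    have h := H.ae_mem_lagDom
    rw [← hπ.2.2] at h
    filter_upwards [ae_of_ae_map measurable_snd.aemeasurable h] with p hp
    exact hπ.2.2 ▸ hp
  refine ⟨?_, ?_⟩
  · filter_upwards [hF, h1, h2] with p hp hp1 hp2 using H.logFactor_mono hp1 hp2 hp
  have hm1 : Measurable fun p : ℝ × ℝ => cdfR γ₁ p.1 := (measurable_cdfR γ₁).comp measurable_fst
  have hm2 : Measurable fun p : ℝ × ℝ => cdfR γ₁ p.2 := (measurable_cdfR γ₁).comp measurable_snd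
  have hT := lintegral_lintegral_Ioc π hm1 hm2 hkm
  have hL : ∫⁻ p, ENNReal.ofReal (logFactor γ₁ γ₂ p.2 - logFactor γ₁ γ₂ p.1) ∂π =
      ∫⁻ p, (∫⁻ v in Ioc (cdfR γ₁ p.1) (cdfR γ₁ p.2), k v) ∂π := by
    refine lintegral_congr_ae ?_
    filter_upwards [hF, h1, h2] with p hp hp1 hp2
    rw [logFactor, logFactor, levelLog_eq hp1, levelLog_eq hp2,
      ← H.lintegral_inv_lag hp1 hp2 (cdfR_mono γ₁ hp)]
    refine setLIntegral_congr_fun measurableSet_Ioc fun v hv => ?_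
    have hv' := H.ordConnected_lagDom.out hp1 hp2 (Ioc_subset_Icc_self hv)
    simp only [hk, indicator_of_mem hv']
  rw [hL, hT]
  refine lintegral_congr fun v => ?_
  congr 1
  have hms : MeasurableSet {x | cdfR γ₁ x < v} :=
    measurableSet_lt (measurable_cdfR γ₁) measurable_const
  have e1 : γ₁ {x | cdfR γ₁ x < v} = π {p | cdfR γ₁ p.1 < v} := by
    conv_lhs => rw [← hπ.2.1, Measure.map_apply measurable_fst (hπ.2.1.symm ▸ hms)]
    rw [hπ.2.1]
    rfl
  have e2 : γ₂ {x | cdfR γ₁ x < v} = π {p | cdfR γ₁ p.2 < v} := by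
    conv_lhs => rw [← hπ.2.2, Measure.map_apply measurable_snd hms]
    rfl
  have hmp : MeasurableSet {p : ℝ × ℝ | cdfR γ₁ p.2 < v} := measurableSet_lt hm2 measurable_const
  have e3 : π {p | cdfR γ₁ p.1 < v} =
      π {p | cdfR γ₁ p.2 < v} + π {p | cdfR γ₁ p.1 < v ∧ v ≤ cdfR γ₁ p.2} := by
    rw [← measure_union₀']
    · refine measure_congr ?_
      filter_upwards [hF] with p hp
      refine propext ⟨fun h => ?_, fun h => ?_⟩
      · rcases lt_or_ge (cdfR γ₁ p.2) v with h' | h'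
        · exact Or.inl h'
        · exact Or.inr ⟨h, h'⟩
      · rcases h with h | h
        · exact (cdfR_mono γ₁ hp).trans_lt h
        · exact h.1
    · exact hmp.nullMeasurableSet
    · refine Disjoint.aedisjoint (Set.disjoint_left.2 fun p hp hp' => ?_)
      exact absurd (show cdfR γ₁ p.2 < v from hp) (not_lt.2 hp'.2)
  rw [e1, e2, e3, ENNReal.add_sub_cancel_left (measure_ne_top _ _)]

/-- Kellerer's theorem, together with the properties of the logarithm of the density that make the
plan a minimizer of the entropy. -/
theorem Irreducible.exists_factorization (H : Irreducible γ₁ γ₂) :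
    ∃ b l : ℝ → ℝ, Measurable b ∧ Measurable l ∧
      ((γ₁.withDensity fun x => ENNReal.ofReal (Real.exp (-b x))).prod
        (γ₂.withDensity fun y => ENNReal.ofReal (Real.exp (-l y)))).restrict halfPlane ∈
          Marg γ₁ γ₂ ∧
      (∀ᵐ x ∂γ₁, b x + l x ≤ Real.log (γ₁.real univ)) ∧
      ∃ c : ENNReal, c ≠ ⊤ ∧ ∀ π ∈ Marg γ₁ γ₂, (∀ᵐ p ∂π, p.1 ≤ p.2) →
        (∀ᵐ p ∂π, l p.1 ≤ l p.2) ∧ ∫⁻ p, ENNReal.ofReal (l p.2 - l p.1) ∂π = c := by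
  refine ⟨logTail γ₁ γ₂, logFactor γ₁ γ₂, measurable_logTail, H.measurable_logFactor, ?_,
    H.logTail_add_le, H.lintegral_logFactor_sub⟩
  rw [← H.firstFactor_eq]
  exact ⟨H.isFiniteMeasure_factorPlan, H.factorPlan_fst, H.factorPlan_snd⟩

theorem Irreducible.existsUnique_isStronglyMult (H : Irreducible γ₁ γ₂) :
    ∃! π, π ∈ Marg γ₁ γ₂ ∧ IsStronglyMult π := by
  obtain ⟨b, l, -, -, h, -⟩ := H.exists_factorization
  exact ⟨_, ⟨h, _, _, SigmaFinite.withDensity_ofReal _, SigmaFinite.withDensity_ofReal _, rfl⟩,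
    fun π' h' => h'.2.unique h'.1 h ⟨_, _, SigmaFinite.withDensity_ofReal _,
      SigmaFinite.withDensity_ofReal _, rfl⟩⟩

end lag

/-! ### Divergence and relative entropy -/

open InformationTheory

section entropy

variable {S : Type*} [MeasurableSpace S] {ρ K π : Measure S} [IsFiniteMeasure ρ]
  [IsFiniteMeasure K] [IsFiniteMeasure π]

lemma klDiv_eq_lintegral (h : π ≪ ρ) :
    klDiv π ρ = ∫⁻ z, ENNReal.ofReal (klFun (π.rnDeriv ρ z).toReal) ∂ρ := by
  rw [klDiv_eq_lintegral_klFun, if_pos h]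

/-- A measure with density `exp (U - V)`, where `U` and `V` have the same integrals for another
measure, has the smaller divergence of the two. -/
lemma klDiv_le_of_density {k U V : S → ℝ} (hk : Measurable k) (hk0 : ∀ z, 0 ≤ k z)
    (hU : Measurable U) (hV : Measurable V)
    (hK : K = ρ.withDensity fun z => ENNReal.ofReal (k z))
    (hKk : ∀ᵐ z ∂K, 0 ≤ U z ∧ 0 ≤ V z ∧ k z = Real.exp (U z - V z))
    (hπk : ∀ᵐ z ∂π, 0 ≤ U z ∧ 0 ≤ V z ∧ k z = Real.exp (U z - V z))
    (hUint : ∫⁻ z, ENNReal.ofReal (U z) ∂K = ∫⁻ z, ENNReal.ofReal (U z) ∂π)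
    (hVint : ∫⁻ z, ENNReal.ofReal (V z) ∂K = ∫⁻ z, ENNReal.ofReal (V z) ∂π)
    (hVfin : ∫⁻ z, ENNReal.ofReal (V z) ∂K ≠ ⊤) : klDiv K ρ ≤ klDiv π ρ := by
  by_cases hac : π ≪ ρ
  swap
  · rw [klDiv_of_not_ac hac]; exact le_top
  have hKac : K ≪ ρ := hK ▸ withDensity_absolutelyContinuous _ _
  have hkm : Measurable fun z => ENNReal.ofReal (k z) := hk.ennreal_ofReal
  have hUm : Measurable fun z => ENNReal.ofReal (U z) := hU.ennreal_ofReal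
  have hVm : Measurable fun z => ENNReal.ofReal (V z) := hV.ennreal_ofReal
  set P := π.rnDeriv ρ with hP
  have hPm : Measurable P := Measure.measurable_rnDeriv _ _
  have hπ : π = ρ.withDensity P := (Measure.withDensity_rnDeriv_eq π ρ hac).symm
  have hkl (p : S → ENNReal) (hp : Measurable p) :
      Measurable fun z => ENNReal.ofReal (klFun (p z).toReal) :=
    (measurable_klFun.comp hp.ennreal_toReal).ennreal_ofReal
  -- the inequality for `π`
  have ineq : (∫⁻ z, ENNReal.ofReal (U z) ∂π) + ρ univ ≤
      klDiv π ρ + (∫⁻ z, ENNReal.ofReal (V z) ∂π) + K univ := by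
    have e1 : K univ = ∫⁻ z, ENNReal.ofReal (k z) ∂ρ := by
      rw [hK, withDensity_apply _ MeasurableSet.univ, Measure.restrict_univ]
    have e2 {W : S → ENNReal} (hW : Measurable W) : ∫⁻ z, W z ∂π = ∫⁻ z, P z * W z ∂ρ := by
      conv_lhs => rw [hπ]
      rw [lintegral_withDensity_eq_lintegral_mul _ hPm hW]
      rfl
    rw [klDiv_eq_lintegral hac, e1, e2 hUm, e2 hVm, ← lintegral_add_left (hkl P hPm),
      ← lintegral_add_right _ hkm, ← lintegral_one, ← lintegral_add_right _ measurable_const]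
    refine lintegral_mono_ae ?_
    have hπk' := hπk
    rw [hπ, ae_withDensity_iff hPm] at hπk'
    filter_upwards [hπk', Measure.rnDeriv_lt_top π ρ] with z hz hfin
    by_cases h0 : P z = 0
    · rw [h0]
      simp [klFun_zero]
    obtain ⟨hU0, hV0, hkz⟩ := hz h0
    have hp : 0 < (P z).toReal := ENNReal.toReal_pos h0 hfin.ne
    have hPz : P z = ENNReal.ofReal (P z).toReal := (ENNReal.ofReal_toReal hfin.ne).symm
    change P z * _ + 1 ≤ ENNReal.ofReal (klFun (P z).toReal) + P z * _ + _
    set p := (P z).toReal with hpdef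
    rw [hPz, ← ENNReal.ofReal_mul hp.le, ← ENNReal.ofReal_mul hp.le, ← ENNReal.ofReal_one,
      ← ENNReal.ofReal_add (by positivity) zero_le_one,
      ← ENNReal.ofReal_add (klFun_nonneg hp.le) (by positivity),
      ← ENNReal.ofReal_add (add_nonneg (klFun_nonneg hp.le) (by positivity)) (hk0 z)]
    refine ENNReal.ofReal_le_ofReal ?_
    have hkpos : 0 < k z := hkz ▸ Real.exp_pos _
    have h1 : Real.log (k z) = U z - V z := by rw [hkz, Real.log_exp]
    -- Gibbs' inequality in pointwise form, p(log k − log p) ≤ k − p.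
    have h2 := Real.log_le_sub_one_of_pos (div_pos hkpos hp)
    rw [Real.log_div hkpos.ne' hp.ne', h1] at h2
    have h3 := mul_le_mul_of_nonneg_left h2 hp.le
    have h4 : p * (k z / p - 1) = k z - p := by field_simp
    rw [h4] at h3
    unfold klFun
    linarith
  -- For K itself p = k, and the pointwise inequality is an equality.
  have eqn : (∫⁻ z, ENNReal.ofReal (U z) ∂K) + ρ univ =
      klDiv K ρ + (∫⁻ z, ENNReal.ofReal (V z) ∂K) + K univ := by
    have e1 : K univ = ∫⁻ z, ENNReal.ofReal (k z) ∂ρ := by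
      rw [hK, withDensity_apply _ MeasurableSet.univ, Measure.restrict_univ]
    have e2 {W : S → ENNReal} (hW : Measurable W) :
        ∫⁻ z, W z ∂K = ∫⁻ z, ENNReal.ofReal (k z) * W z ∂ρ := by
      conv_lhs => rw [hK]
      rw [lintegral_withDensity_eq_lintegral_mul _ hkm hW]
      rfl
    have hrn : K.rnDeriv ρ =ᵐ[ρ] fun z => ENNReal.ofReal (k z) := by
      conv_lhs => rw [hK]
      exact Measure.rnDeriv_withDensity ρ hkm
    rw [klDiv_eq_lintegral hKac, e1, e2 hUm, e2 hVm,
      ← lintegral_add_left (hkl _ (Measure.measurable_rnDeriv _ _)),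
      ← lintegral_add_right _ hkm, ← lintegral_one, ← lintegral_add_right _ measurable_const]
    refine lintegral_congr_ae ?_
    have hKk' := hKk
    rw [hK, ae_withDensity_iff hkm] at hKk'
    filter_upwards [hKk', hrn] with z hz hr
    rw [hr]
    by_cases h0 : ENNReal.ofReal (k z) = 0
    · rw [h0]
      simp [klFun_zero]
    obtain ⟨hU0, hV0, hkz⟩ := hz h0
    have hkpos : 0 < k z := hkz ▸ Real.exp_pos _
    rw [ENNReal.toReal_ofReal hkpos.le, ← ENNReal.ofReal_mul hkpos.le,
      ← ENNReal.ofReal_mul hkpos.le, ← ENNReal.ofReal_one,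
      ← ENNReal.ofReal_add (by positivity) zero_le_one,
      ← ENNReal.ofReal_add (klFun_nonneg hkpos.le) (by positivity),
      ← ENNReal.ofReal_add (add_nonneg (klFun_nonneg hkpos.le) (by positivity)) hkpos.le]
    congr 1
    have h1 : Real.log (k z) = U z - V z := by rw [hkz, Real.log_exp]
    unfold klFun
    rw [h1]
    ring
  -- The integral of U is substituted and never cancelled, so it may be infinite. Only that of V has
  -- to be finite.
  rw [hUint, hVint] at eqn
  rw [eqn] at ineq
  rw [hVint] at hVfin
  exact (ENNReal.add_le_add_iff_right hVfin).1
    ((ENNReal.add_le_add_iff_right (measure_ne_top K univ)).1 ineq)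

/-- Non-negativity of `klFun` reads t log t ≥ t − 1 ≥ −1. Thus the subtraction in `Ent` never meets
∞ − ∞. -/
lemma lintegral_entIntegrand_neg_le :
    ∫⁻ z, ENNReal.ofReal (-entIntegrand π ρ z) ∂ρ ≤ ρ univ := by
  rw [← lintegral_one]
  refine lintegral_mono fun z => ?_
  rw [← ENNReal.ofReal_one]
  refine ENNReal.ofReal_le_ofReal ?_
  have h := klFun_nonneg (ENNReal.toReal_nonneg (a := π.rnDeriv ρ z))
  have h0 := ENNReal.toReal_nonneg (a := π.rnDeriv ρ z)
  unfold klFun at h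
  unfold entIntegrand
  linarith

/-- Integrate klFun(t) = t log t + 1 − t, with the negative terms moved across so that only sums of
extended non-negative numbers occur. -/
lemma klDiv_add_eq (hac : π ≪ ρ) :
    klDiv π ρ + (∫⁻ z, ENNReal.ofReal (-entIntegrand π ρ z) ∂ρ) + π univ =
      (∫⁻ z, ENNReal.ofReal (entIntegrand π ρ z) ∂ρ) + ρ univ := by
  have hm : Measurable fun z => ENNReal.ofReal (klFun (π.rnDeriv ρ z).toReal) :=
    (measurable_klFun.comp (Measure.measurable_rnDeriv _ _).ennreal_toReal).ennreal_ofReal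
  have e1 : π univ = ∫⁻ z, π.rnDeriv ρ z ∂ρ := by
    conv_lhs => rw [← Measure.withDensity_rnDeriv_eq π ρ hac]
    rw [withDensity_apply _ MeasurableSet.univ, Measure.restrict_univ]
  rw [klDiv_eq_lintegral hac, e1, ← lintegral_add_left hm,
    ← lintegral_add_right _ (Measure.measurable_rnDeriv _ _), ← lintegral_one,
    ← lintegral_add_right _ measurable_const]
  refine lintegral_congr_ae ?_
  filter_upwards [Measure.rnDeriv_lt_top π ρ] with z hz
  rw [← ENNReal.ofReal_toReal hz.ne]
  set p := (π.rnDeriv ρ z).toReal with hp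
  have hp0 : 0 ≤ p := ENNReal.toReal_nonneg
  have he : entIntegrand π ρ z = p * Real.log p := rfl
  rw [ENNReal.toReal_ofReal hp0, he, ← ENNReal.ofReal_one]
  rcases le_total 0 (p * Real.log p) with h | h
  · rw [ENNReal.ofReal_of_nonpos (neg_nonpos.2 h), add_zero,
      ← ENNReal.ofReal_add (klFun_nonneg hp0) hp0, ← ENNReal.ofReal_add h zero_le_one]
    congr 1
    unfold klFun
    ring
  · rw [ENNReal.ofReal_of_nonpos h, zero_add,
      ← ENNReal.ofReal_add (klFun_nonneg hp0) (neg_nonneg.2 h),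
      ← ENNReal.ofReal_add (add_nonneg (klFun_nonneg hp0) (neg_nonneg.2 h)) hp0]
    congr 1
    unfold klFun
    ring

/-- For measures of the same mass, comparing entropies is comparing divergences. -/
lemma Ent_le_of_klDiv_le (hm : K univ = π univ) (h : klDiv K ρ ≤ klDiv π ρ) :
    Ent K ρ ≤ Ent π ρ := by
  by_cases hπ : π ≪ ρ
  swap
  · rw [Ent, Ent, if_neg hπ]; exact le_top
  have eπ := klDiv_add_eq hπ
  have nπ : ∫⁻ z, ENNReal.ofReal (-entIntegrand π ρ z) ∂ρ ≠ ⊤ :=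
    ne_top_of_le_ne_top (measure_ne_top ρ univ) lintegral_entIntegrand_neg_le
  have nK : ∫⁻ z, ENNReal.ofReal (-entIntegrand K ρ z) ∂ρ ≠ ⊤ :=
    ne_top_of_le_ne_top (measure_ne_top ρ univ) lintegral_entIntegrand_neg_le
  by_cases hK : K ≪ ρ
  · have eK := klDiv_add_eq hK
    rw [Ent, Ent, if_pos hπ, if_pos hK]
    set A := ∫⁻ z, ENNReal.ofReal (entIntegrand K ρ z) ∂ρ
    set B := ∫⁻ z, ENNReal.ofReal (-entIntegrand K ρ z) ∂ρ
    set A' := ∫⁻ z, ENNReal.ofReal (entIntegrand π ρ z) ∂ρ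
    set B' := ∫⁻ z, ENNReal.ofReal (-entIntegrand π ρ z) ∂ρ
    have key : A + B' ≤ A' + B := by
      refine (ENNReal.add_le_add_iff_right (measure_ne_top ρ univ)).1 ?_
      calc A + B' + ρ univ = (A + ρ univ) + B' := by ring
        _ = klDiv K ρ + B + K univ + B' := by rw [eK]
        _ ≤ klDiv π ρ + B + K univ + B' := by gcongr
        _ = (klDiv π ρ + B' + π univ) + B := by rw [hm]; ring
        _ = A' + B + ρ univ := by rw [eπ]; ring
    clear_value A B A' B'
    lift B to NNReal using nK
    lift B' to NNReal using nπ
    rcases eq_or_ne A' ⊤ with hA' | hA'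
    · rw [hA']
      have : ((⊤ : ENNReal) : EReal) - ((B' : ENNReal) : EReal) = ⊤ := by
        exact EReal.top_sub_coe (B' : ℝ)
      rw [this]
      exact le_top
    · have hA : A ≠ ⊤ := by
        rintro hA
        rw [hA, top_add, top_le_iff] at key
        exact (ENNReal.add_ne_top.2 ⟨hA', ENNReal.coe_ne_top⟩) key
      lift A to NNReal using hA
      lift A' to NNReal using hA'
      have key' : (A : ℝ) + B' ≤ A' + B := by exact_mod_cast key
      have : (A : ℝ) - B ≤ A' - B' := by linarith
      change ((A : ℝ) : EReal) - ((B : ℝ) : EReal) ≤ ((A' : ℝ) : EReal) - ((B' : ℝ) : EReal)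
      exact_mod_cast this
  · rw [klDiv_of_not_ac hK, top_le_iff] at h
    rw [Ent, Ent, if_pos hπ, if_neg hK, top_le_iff]
    rw [h, top_add, top_add] at eπ
    have hA' : ∫⁻ z, ENNReal.ofReal (entIntegrand π ρ z) ∂ρ = ⊤ := by
      by_contra hne
      exact (ENNReal.add_ne_top.2 ⟨hne, measure_ne_top ρ univ⟩) eπ.symm
    rw [hA']
    set B' := ∫⁻ z, ENNReal.ofReal (-entIntegrand π ρ z) ∂ρ
    clear_value B'
    lift B' to NNReal using nπ
    exact EReal.top_sub_coe (B' : ℝ)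

/-- Where the density vanishes, `klFun 0 = 1` contributes the mass of ρ. That term is the same for
all competitors and cancels in comparisons. -/
lemma klDiv_restrict_eq {A : Set S} (hA : MeasurableSet A) (hac : π.restrict A ≪ ρ) :
    klDiv (π.restrict A) ρ =
      (∫⁻ z in A, ENNReal.ofReal (klFun (π.rnDeriv ρ z).toReal) ∂ρ) + ρ Aᶜ := by
  rw [klDiv_eq_lintegral hac, ← lintegral_add_compl _ hA]
  have hr := Measure.rnDeriv_restrict π ρ hA
  congr 1
  · refine setLIntegral_congr_fun_ae hA ?_
    filter_upwards [hr] with z hz hzA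
    rw [hz, indicator_of_mem hzA]
  · rw [← setLIntegral_one]
    refine setLIntegral_congr_fun_ae hA.compl ?_
    filter_upwards [hr] with z hz hzA
    rw [hz, indicator_of_notMem hzA]
    simp [klFun_zero]

/-- Divergences can be compared piecewise. -/
lemma klDiv_le_of_partition {ι : Type*} [Countable ι] {A : ι → Set S}
    (hA : ∀ i, MeasurableSet (A i)) (hd : Pairwise fun i j => Disjoint (A i) (A j))
    (h : ∀ i, klDiv (K.restrict (A i)) ρ ≤ klDiv (π.restrict (A i)) ρ)
    (hrest : K.restrict (⋃ i, A i)ᶜ = π.restrict (⋃ i, A i)ᶜ) : klDiv K ρ ≤ klDiv π ρ := by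
  by_cases hfin : klDiv π ρ = ⊤
  · rw [hfin]; exact le_top
  have hπ : π ≪ ρ := (klDiv_ne_top_iff.1 hfin).1
  have hU : MeasurableSet (⋃ i, A i) := MeasurableSet.iUnion hA
  have hπA (B : Set S) : π.restrict B ≪ ρ := Measure.restrict_le_self.absolutelyContinuous.trans hπ
  have hKA (i : ι) : K.restrict (A i) ≪ ρ := by
    by_contra hn
    have := h i
    rw [klDiv_of_not_ac hn, klDiv_restrict_eq (hA i) (hπA _), top_le_iff] at this
    refine ENNReal.add_ne_top.2 ⟨?_, measure_ne_top _ _⟩ this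
    refine ne_top_of_le_ne_top hfin ?_
    rw [klDiv_eq_lintegral hπ]
    exact setLIntegral_le_lintegral _ _
  have hKU : K.restrict (⋃ i, A i) ≪ ρ := by
    rw [Measure.restrict_iUnion hd hA]
    exact Measure.absolutelyContinuous_sum_left hKA
  have hK : K ≪ ρ := by
    rw [← Measure.restrict_add_restrict_compl (μ := K) hU, hrest]
    intro s hs
    simp [hKU hs, hπA _ hs]
  rw [klDiv_eq_lintegral hπ, klDiv_eq_lintegral hK, ← lintegral_add_compl _ hU,
    ← lintegral_add_compl (fun z => ENNReal.ofReal (klFun (π.rnDeriv ρ z).toReal)) hU]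
  refine add_le_add ?_ (le_of_eq ?_)
  · rw [lintegral_iUnion hA hd, lintegral_iUnion hA hd]
    refine ENNReal.tsum_le_tsum fun i => ?_
    have := h i
    rw [klDiv_restrict_eq (hA i) (hπA _), klDiv_restrict_eq (hA i) (hKA _)] at this
    exact (ENNReal.add_le_add_iff_right (measure_ne_top _ _)).1 this
  · have h1 := Measure.rnDeriv_restrict π ρ hU.compl
    have h2 := Measure.rnDeriv_restrict K ρ hU.compl
    rw [hrest] at h2
    refine setLIntegral_congr_fun_ae hU.compl ?_
    filter_upwards [h1, h2] with z h1 h2 hz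
    rw [h1, indicator_of_mem hz, indicator_of_mem hz] at h2
    rw [h2]

end entropy

/-! ### Minimality for an irreducible pair -/

lemma exists_density_of_le {S : Type*} [MeasurableSpace S] {γ μ : Measure S} [IsFiniteMeasure μ]
    (h : γ ≤ μ) : ∃ c : S → ℝ, Measurable c ∧ (∀ x, 0 ≤ c x) ∧ (∀ x, c x ≤ 1) ∧
      γ = μ.withDensity (fun x => ENNReal.ofReal (c x)) := by
  have : IsFiniteMeasure γ := isFiniteMeasure_of_le μ h
  refine ⟨fun x => min 1 (γ.rnDeriv μ x).toReal,
    measurable_const.min (Measure.measurable_rnDeriv _ _).ennreal_toReal,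
    fun x => le_min zero_le_one ENNReal.toReal_nonneg, fun x => min_le_left _ _, ?_⟩
  conv_lhs => rw [← Measure.withDensity_rnDeriv_eq γ μ h.absolutelyContinuous]
  refine withDensity_congr_ae ?_
  filter_upwards [Measure.rnDeriv_le_one_of_le h] with x hx
  have hx' : γ.rnDeriv μ x ≤ 1 := hx
  have hne : γ.rnDeriv μ x ≠ ⊤ := ne_top_of_le_ne_top ENNReal.one_ne_top hx'
  rw [min_eq_right, ENNReal.ofReal_toReal hne]
  simpa using ENNReal.toReal_mono ENNReal.one_ne_top hx'

/-- Pointwise −c log c ≤ 1 − c ≤ 1. This keeps finite the price of replacing γ₁, γ₂ by the larger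
measures μ, ν in the reference product. -/
lemma lintegral_neg_log_le {S : Type*} [MeasurableSpace S] {μ : Measure S} {c : S → ℝ}
    (hc : Measurable c) (h0 : ∀ x, 0 ≤ c x) :
    ∫⁻ x, ENNReal.ofReal (-Real.log (c x)) ∂(μ.withDensity fun x => ENNReal.ofReal (c x)) ≤
      μ univ := by
  have hm : Measurable fun x => ENNReal.ofReal (-Real.log (c x)) := hc.log.neg.ennreal_ofReal
  rw [lintegral_withDensity_eq_lintegral_mul _ hc.ennreal_ofReal hm, ← lintegral_one]
  refine lintegral_mono fun x => ?_
  rw [Pi.mul_apply, ← ENNReal.ofReal_mul (h0 x), ← ENNReal.ofReal_one]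
  refine ENNReal.ofReal_le_ofReal ?_
  have h := klFun_nonneg (h0 x)
  have := h0 x
  unfold klFun at h
  linarith

lemma Marg.lintegral_fst {γ₁ γ₂ : Measure ℝ} {π : Measure (ℝ × ℝ)} (hπ : π ∈ Marg γ₁ γ₂)
    {f : ℝ → ENNReal} (hf : Measurable f) : ∫⁻ p, f p.1 ∂π = ∫⁻ x, f x ∂γ₁ := by
  rw [← hπ.2.1, lintegral_map hf measurable_fst]

lemma Marg.lintegral_snd {γ₁ γ₂ : Measure ℝ} {π : Measure (ℝ × ℝ)} (hπ : π ∈ Marg γ₁ γ₂)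
    {f : ℝ → ENNReal} (hf : Measurable f) : ∫⁻ p, f p.2 ∂π = ∫⁻ x, f x ∂γ₂ := by
  rw [← hπ.2.2, lintegral_map hf measurable_snd]

lemma Marg.ae_fst {γ₁ γ₂ : Measure ℝ} {π : Measure (ℝ × ℝ)} (hπ : π ∈ Marg γ₁ γ₂)
    {P : ℝ → Prop} (h : ∀ᵐ x ∂γ₁, P x) : ∀ᵐ p ∂π, P p.1 := by
  rw [← hπ.2.1] at h
  exact ae_of_ae_map measurable_fst.aemeasurable h

lemma Marg.ae_snd {γ₁ γ₂ : Measure ℝ} {π : Measure (ℝ × ℝ)} (hπ : π ∈ Marg γ₁ γ₂)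
    {P : ℝ → Prop} (h : ∀ᵐ x ∂γ₂, P x) : ∀ᵐ p ∂π, P p.2 := by
  rw [← hπ.2.2] at h
  exact ae_of_ae_map measurable_snd.aemeasurable h

lemma Marg.univ_eq {γ₁ γ₂ : Measure ℝ} {π : Measure (ℝ × ℝ)} (hπ : π ∈ Marg γ₁ γ₂) :
    π univ = γ₁ univ := by
  rw [← hπ.2.1, Measure.map_apply measurable_fst MeasurableSet.univ, preimage_univ]

/-- The Kellerer plan minimizes the divergence among the transport plans to the right. -/
theorem Irreducible.klDiv_le {γ₁ γ₂ μ ν : Measure ℝ} [IsFiniteMeasure γ₁] [IsFiniteMeasure γ₂]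
    [IsFiniteMeasure μ] [IsFiniteMeasure ν] (H : Irreducible γ₁ γ₂) (h₁ : γ₁ ≤ μ) (h₂ : γ₂ ≤ ν)
    {K π : Measure (ℝ × ℝ)} (hK : K ∈ Marg γ₁ γ₂) (hKm : IsStronglyMult K)
    (hπ : π ∈ Marg γ₁ γ₂) (hF : ∀ᵐ p ∂π, p.1 ≤ p.2) :
    klDiv K (μ.prod ν) ≤ klDiv π (μ.prod ν) := by
  have := hK.1
  have := hπ.1
  obtain ⟨b, l, hb, hl, hK', hbl, c, hc, hcπ⟩ := H.exists_factorization
  obtain rfl := hKm.unique hK hK' ⟨_, _, SigmaFinite.withDensity_ofReal _,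
    SigmaFinite.withDensity_ofReal _, rfl⟩
  set K := ((γ₁.withDensity fun x => ENNReal.ofReal (Real.exp (-b x))).prod
        (γ₂.withDensity fun y => ENNReal.ofReal (Real.exp (-l y)))).restrict halfPlane with hKdef
  obtain ⟨c₁, hc₁, hc₁0, hc₁1, e₁⟩ := exists_density_of_le h₁
  obtain ⟨c₂, hc₂, hc₂0, hc₂1, e₂⟩ := exists_density_of_le h₂
  set m := |Real.log (γ₁.real univ)| with hm
  -- On F, log k = log c₁(x) − b(x) + log c₂(y) − l(y) is split as U − V by inserting l(x). The
  -- constant m makes U non-negative, by the upper bound on b + l; V is non-negative since c₁, c₂ ≤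
  -- 1 and l increases along the plan.
  set U : ℝ × ℝ → ℝ := fun p => -b p.1 - l p.1 + m with hU
  set V : ℝ × ℝ → ℝ := fun p =>
    (l p.2 - l p.1) + (-Real.log (c₁ p.1) + (-Real.log (c₂ p.2) + m)) with hV
  set k : ℝ × ℝ → ℝ := halfPlane.indicator fun p =>
    (c₁ p.1 * Real.exp (-b p.1)) * (c₂ p.2 * Real.exp (-l p.2)) with hk
  have hk0 (p : ℝ × ℝ) : 0 ≤ k p := indicator_nonneg (fun p _ =>
    mul_nonneg (mul_nonneg (hc₁0 _) (Real.exp_pos _).le)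
      (mul_nonneg (hc₂0 _) (Real.exp_pos _).le)) p
  have hkm : Measurable k := Measurable.indicator (by fun_prop) measurableSet_halfPlane
  have hUm : Measurable U := by fun_prop
  have hVm : Measurable V := by fun_prop
  have d₁ : γ₁.withDensity (fun x => ENNReal.ofReal (Real.exp (-b x))) =
      μ.withDensity fun x => ENNReal.ofReal (c₁ x * Real.exp (-b x)) := by
    conv_lhs => rw [e₁]
    rw [← withDensity_mul _ (by fun_prop) (by fun_prop)]
    congr 1
    ext x
    rw [Pi.mul_apply, ENNReal.ofReal_mul (hc₁0 x)]
  have d₂ : γ₂.withDensity (fun x => ENNReal.ofReal (Real.exp (-l x))) =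
      ν.withDensity fun x => ENNReal.ofReal (c₂ x * Real.exp (-l x)) := by
    conv_lhs => rw [e₂]
    rw [← withDensity_mul _ (by fun_prop) (by fun_prop)]
    congr 1
    ext x
    rw [Pi.mul_apply, ENNReal.ofReal_mul (hc₂0 x)]
  have eK : K = (μ.prod ν).withDensity fun p => ENNReal.ofReal (k p) := by
    rw [hKdef, d₁, d₂, prod_withDensity (by fun_prop) (by fun_prop),
      restrict_withDensity measurableSet_halfPlane, ← withDensity_indicator
      measurableSet_halfPlane]
    congr 1
    ext p
    by_cases hp : p ∈ halfPlane
    · rw [indicator_of_mem hp, hk, indicator_of_mem hp,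
        ENNReal.ofReal_mul (mul_nonneg (hc₁0 _) (Real.exp_pos _).le)]
    · rw [indicator_of_notMem hp, hk, indicator_of_notMem hp, ENNReal.ofReal_zero]
  have hKF : ∀ᵐ p ∂K, p.1 ≤ p.2 := ae_restrict_mem measurableSet_halfPlane
  have p₁ : ∀ᵐ x ∂γ₁, 0 < c₁ x := by
    rw [e₁, ae_withDensity_iff hc₁.ennreal_ofReal]
    exact ae_of_all _ fun x hx => (hc₁0 x).lt_of_ne' fun h => hx (by rw [h, ENNReal.ofReal_zero])
  have p₂ : ∀ᵐ x ∂γ₂, 0 < c₂ x := by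
    rw [e₂, ae_withDensity_iff hc₂.ennreal_ofReal]
    exact ae_of_all _ fun x hx => (hc₂0 x).lt_of_ne' fun h => hx (by rw [h, ENNReal.ofReal_zero])
  have key (σ : Measure (ℝ × ℝ)) (hσ : σ ∈ Marg γ₁ γ₂) (hσF : ∀ᵐ p ∂σ, p.1 ≤ p.2) :
      (∀ᵐ p ∂σ, 0 ≤ U p ∧ 0 ≤ V p ∧ k p = Real.exp (U p - V p)) ∧
      ∫⁻ p, ENNReal.ofReal (U p) ∂σ = ∫⁻ x, ENNReal.ofReal (-b x - l x + m) ∂γ₁ ∧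
      ∫⁻ p, ENNReal.ofReal (V p) ∂σ = c + ((∫⁻ x, ENNReal.ofReal (-Real.log (c₁ x)) ∂γ₁) +
        ((∫⁻ x, ENNReal.ofReal (-Real.log (c₂ x)) ∂γ₂) + ENNReal.ofReal m * γ₁ univ)) := by
    obtain ⟨hl', hlc⟩ := hcπ σ hσ hσF
    refine ⟨?_, ?_, ?_⟩
    · filter_upwards [hl', hσF, Marg.ae_fst hσ p₁, Marg.ae_snd hσ p₂, Marg.ae_fst hσ hbl]
        with p hlp hp q₁ q₂ hblp
      have hlog := le_abs_self (Real.log (γ₁.real univ))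
      have n₁ := Real.log_nonpos (hc₁0 p.1) (hc₁1 p.1)
      have n₂ := Real.log_nonpos (hc₂0 p.2) (hc₂1 p.2)
      have m0 : 0 ≤ m := abs_nonneg _
      refine ⟨?_, ?_, ?_⟩
      · simp only [hU]; linarith
      · simp only [hV]; linarith
      · have hpF : p ∈ halfPlane := hp
        rw [hk, indicator_of_mem hpF]
        have : U p - V p = (Real.log (c₁ p.1) + -b p.1) + (Real.log (c₂ p.2) + -l p.2) := by
          simp only [hU, hV]; ring
        rw [this, Real.exp_add, Real.exp_add, Real.exp_add, Real.exp_log q₁, Real.exp_log q₂]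
    · exact Marg.lintegral_fst hσ (f := fun x => ENNReal.ofReal (-b x - l x + m)) (by fun_prop)
    · rw [← hlc, ← Marg.lintegral_fst hσ (f := fun x => ENNReal.ofReal (-Real.log (c₁ x)))
          (by fun_prop), ← Marg.lintegral_snd hσ (f := fun x => ENNReal.ofReal (-Real.log (c₂ x)))
          (by fun_prop), ← Marg.univ_eq hσ, ← lintegral_const,
        ← lintegral_add_right _ (by fun_prop), ← lintegral_add_left (by fun_prop),
        ← lintegral_add_right _ (by fun_prop)]
      refine lintegral_congr_ae ?_
      filter_upwards [hl'] with p hlp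
      have n₁ := neg_nonneg.2 (Real.log_nonpos (hc₁0 p.1) (hc₁1 p.1))
      have n₂ := neg_nonneg.2 (Real.log_nonpos (hc₂0 p.2) (hc₂1 p.2))
      have m0 : 0 ≤ m := abs_nonneg _
      rw [hV]
      simp only
      rw [ENNReal.ofReal_add (sub_nonneg.2 hlp) (by positivity),
        ENNReal.ofReal_add n₁ (by positivity), ENNReal.ofReal_add n₂ m0]
  obtain ⟨kK, uK, vK⟩ := key K hK hKF
  obtain ⟨kπ, uπ, vπ⟩ := key π hπ hF
  refine klDiv_le_of_density hkm hk0 hUm hVm eK kK kπ (uK.trans uπ.symm) (vK.trans vπ.symm) ?_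
  rw [vK]
  have f₁ : ∫⁻ x, ENNReal.ofReal (-Real.log (c₁ x)) ∂γ₁ ≠ ⊤ := by
    rw [e₁]; exact ne_top_of_le_ne_top (measure_ne_top μ univ) (lintegral_neg_log_le hc₁ hc₁0)
  have f₂ : ∫⁻ x, ENNReal.ofReal (-Real.log (c₂ x)) ∂γ₂ ≠ ⊤ := by
    rw [e₂]; exact ne_top_of_le_ne_top (measure_ne_top ν univ) (lintegral_neg_log_le hc₂ hc₂0)
  exact ENNReal.add_ne_top.2 ⟨hc, ENNReal.add_ne_top.2 ⟨f₁, ENNReal.add_ne_top.2 ⟨f₂,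
    ENNReal.mul_ne_top ENNReal.ofReal_ne_top (measure_ne_top _ _)⟩⟩⟩

/-! ### Plans without crossings -/

/-- A plan that does not transport mass across a point in both directions. -/
def NoCross (π : Measure (ℝ × ℝ)) : Prop :=
  ∀ t, (π {p | p.1 ≤ t ∧ t < p.2} = 0 ∨ π {p | p.2 ≤ t ∧ t < p.1} = 0) ∧
    (π {p | p.1 < t ∧ t ≤ p.2} = 0 ∨ π {p | p.2 < t ∧ t ≤ p.1} = 0)

lemma nonempty_inter_of_measure_ne_zero {S : Type*} [MeasurableSpace S] {π : Measure S}
    {Γ A : Set S} (hΓ : π Γᶜ = 0) (hA : π A ≠ 0) : ∃ p ∈ Γ, p ∈ A := by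
  by_contra! h
  exact hA (measure_mono_null (fun p hp hpΓ => h p hpΓ hp) hΓ)

lemma IsCyclicallyMonotone.two {Γ : Set (ℝ × ℝ)} (h : IsCyclicallyMonotone Γ) {p q : ℝ × ℝ}
    (hp : p ∈ Γ) (hq : q ∈ Γ) : |p.2 - p.1| + |q.2 - q.1| ≤ |q.2 - p.1| + |p.2 - q.1| := by
  have := h 1 ![p, q] (by intro i; fin_cases i <;> simpa)
  simpa [Fin.sum_univ_two] using this

/-- If pairs moving right and left overlapped in an interval of positive length, exchanging their
targets would lower the cost. Cycles of length two suffice. -/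
lemma noCross_of_mem_cyclMonPlans {μ ν : Measure ℝ} {π : Measure (ℝ × ℝ)}
    (h : π ∈ cyclMonPlans μ ν) : NoCross π := by
  obtain ⟨-, Γ, -, hΓ, hπ⟩ := h
  have key {p q : ℝ × ℝ} (hp : p ∈ Γ) (hq : q ∈ Γ) (h1 : p.1 < p.2) (h2 : q.2 < q.1)
      (h3 : max p.1 q.2 < min p.2 q.1) : False := by
    have := hΓ.two hp hq
    simp only [max_lt_iff, lt_min_iff] at h3
    rw [abs_of_pos (sub_pos.2 h1), abs_of_neg (sub_neg.2 h2)] at this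
    rcases abs_cases (q.2 - p.1) with ⟨e, _⟩ | ⟨e, _⟩ <;>
    rcases abs_cases (p.2 - q.1) with ⟨e', _⟩ | ⟨e', _⟩ <;>
    rw [e, e'] at this <;> linarith
  intro t
  refine ⟨?_, ?_⟩ <;> by_contra! hn
  · obtain ⟨p, hp, hp1, hp2⟩ := nonempty_inter_of_measure_ne_zero hπ hn.1
    obtain ⟨q, hq, hq1, hq2⟩ := nonempty_inter_of_measure_ne_zero hπ hn.2
    exact key hp hq (hp1.trans_lt hp2) (hq1.trans_lt hq2)
      ((max_le hp1 hq1).trans_lt (lt_min hp2 hq2))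
  · obtain ⟨p, hp, hp1, hp2⟩ := nonempty_inter_of_measure_ne_zero hπ hn.1
    obtain ⟨q, hq, hq1, hq2⟩ := nonempty_inter_of_measure_ne_zero hπ hn.2
    exact key hp hq (hp1.trans_le hp2) (hq1.trans_le hq2)
      ((max_lt hp1 hq1).trans_le (le_min hp2 hq2))

lemma exists_le_cdfR_of_lt {γ : Measure ℝ} [IsFiniteMeasure γ] {u : ℝ} (hu : u < γ.real univ) :
    ∃ t, u ≤ cdfR γ t :=
  ((tendsto_cdfR_atTop γ).eventually_const_lt hu).exists.imp fun _ h => h.le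

lemma aemeasurable_quant (γ : Measure ℝ) [IsFiniteMeasure γ] :
    AEMeasurable (quant γ) (volume.restrict (Ioo 0 (γ.real univ))) :=
  aemeasurable_restrict_of_monotoneOn measurableSet_Ioo fun _ hu _ hw huw =>
    quant_mono hu.1 huw (exists_le_cdfR_of_lt hw.2)

lemma map_quant (γ : Measure ℝ) [IsFiniteMeasure γ] :
    (volume.restrict (Ioo 0 (γ.real univ))).map (quant γ) = γ := by
  refine (Measure.ext_of_Iic _ _ fun t => ?_).symm
  rw [Measure.map_apply_of_aemeasurable (aemeasurable_quant γ) measurableSet_Iic]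
  have : (volume.restrict (Ioo 0 (γ.real univ))) (quant γ ⁻¹' Iic t) =
      (volume.restrict (Ioo 0 (γ.real univ))) (Iic (cdfR γ t)) := by
    refine measure_congr ?_
    filter_upwards [ae_restrict_mem measurableSet_Ioo] with u hu
    exact propext (quant_le_iff hu.1 (exists_le_cdfR_of_lt hu.2))
  rw [this, Measure.restrict_congr_set Ioo_ae_eq_Ioc, Measure.restrict_apply measurableSet_Iic,
    inter_comm, Ioc_inter_Iic, min_eq_right (cdfR_le γ t), Real.volume_Ioc, sub_zero]
  exact (ofReal_measureReal).symm

/-- The quantile coupling. -/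
lemma exists_noCross (μ ν : Measure ℝ) [IsFiniteMeasure μ] [IsFiniteMeasure ν]
    (hmass : μ univ = ν univ) : ∃ π ∈ Marg μ ν, NoCross π := by
  have hM : ν.real univ = μ.real univ := by simp [measureReal_def, hmass]
  have hμ := aemeasurable_quant μ
  have hν := aemeasurable_quant ν
  have eμ := map_quant μ
  have eν := map_quant ν
  rw [hM] at hν eν
  set L := volume.restrict (Ioo 0 (μ.real univ)) with hL
  have hp : AEMeasurable (fun u => (quant μ u, quant ν u)) L := hμ.prodMk hν
  refine ⟨L.map fun u => (quant μ u, quant ν u), ⟨inferInstance, ?_, ?_⟩, ?_⟩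
  · rw [AEMeasurable.map_map_of_aemeasurable measurable_fst.aemeasurable hp]
    exact eμ
  · rw [AEMeasurable.map_map_of_aemeasurable measurable_snd.aemeasurable hp]
    exact eν
  -- The two quantile functions increase together, so the coupling lives on a chain for the product
  -- order. Sets whose points are mutually incomparable cannot both be charged.
  have key (A B : Set (ℝ × ℝ)) (hA : MeasurableSet A) (hB : MeasurableSet B)
      (hAB : ∀ p ∈ A, ∀ q ∈ B, ¬ (p.1 ≤ q.1 ∧ p.2 ≤ q.2) ∧ ¬ (q.1 ≤ p.1 ∧ q.2 ≤ p.2)) :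
      (L.map fun u => (quant μ u, quant ν u)) A = 0 ∨
      (L.map fun u => (quant μ u, quant ν u)) B = 0 := by
    by_contra! hn
    rw [Measure.map_apply_of_aemeasurable hp hA, Measure.map_apply_of_aemeasurable hp hB] at hn
    have hc : L (Ioo 0 (μ.real univ))ᶜ = 0 := by
      rw [hL, Measure.restrict_apply measurableSet_Ioo.compl, compl_inter_self, measure_empty]
    obtain ⟨u, hu, hu'⟩ := nonempty_inter_of_measure_ne_zero hc hn.1
    obtain ⟨w, hw, hw'⟩ := nonempty_inter_of_measure_ne_zero hc hn.2
    obtain ⟨h1, h2⟩ := hAB _ hu' _ hw'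
    rcases le_total u w with h | h
    · exact h1 ⟨quant_mono hu.1 h (exists_le_cdfR_of_lt hw.2),
        quant_mono hu.1 h (exists_le_cdfR_of_lt (hM ▸ hw.2))⟩
    · exact h2 ⟨quant_mono hw.1 h (exists_le_cdfR_of_lt hu.2),
        quant_mono hw.1 h (exists_le_cdfR_of_lt (hM ▸ hu.2))⟩
  have m1 (t : ℝ) : MeasurableSet {p : ℝ × ℝ | p.1 ≤ t ∧ t < p.2} :=
    (measurableSet_le measurable_fst measurable_const).inter
      (measurableSet_lt measurable_const measurable_snd)
  have m2 (t : ℝ) : MeasurableSet {p : ℝ × ℝ | p.2 ≤ t ∧ t < p.1} :=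
    (measurableSet_le measurable_snd measurable_const).inter
      (measurableSet_lt measurable_const measurable_fst)
  have m3 (t : ℝ) : MeasurableSet {p : ℝ × ℝ | p.1 < t ∧ t ≤ p.2} :=
    (measurableSet_lt measurable_fst measurable_const).inter
      (measurableSet_le measurable_const measurable_snd)
  have m4 (t : ℝ) : MeasurableSet {p : ℝ × ℝ | p.2 < t ∧ t ≤ p.1} :=
    (measurableSet_lt measurable_snd measurable_const).inter
      (measurableSet_le measurable_const measurable_fst)
  intro t
  refine ⟨key _ _ (m1 t) (m2 t) ?_, key _ _ (m3 t) (m4 t) ?_⟩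
  · rintro p ⟨h1, h2⟩ q ⟨h3, h4⟩
    exact ⟨fun h => by linarith, fun h => by linarith⟩
  · rintro p ⟨h1, h2⟩ q ⟨h3, h4⟩
    exact ⟨fun h => by linarith, fun h => by linarith⟩

lemma Marg.swap {μ ν : Measure ℝ} {π : Measure (ℝ × ℝ)} (h : π ∈ Marg μ ν) :
    π.map Prod.swap ∈ Marg ν μ := by
  have := h.1
  refine ⟨inferInstance, ?_, ?_⟩
  · rw [Measure.map_map measurable_fst measurable_swap]
    exact h.2.2
  · rw [Measure.map_map measurable_snd measurable_swap]
    exact h.2.1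

lemma map_swap_apply (π : Measure (ℝ × ℝ)) (A : Set (ℝ × ℝ)) :
    π.map Prod.swap A = π (Prod.swap ⁻¹' A) :=
  MeasurableEquiv.prodComm.map_apply A

lemma NoCross.swap {π : Measure (ℝ × ℝ)} (h : NoCross π) : NoCross (π.map Prod.swap) := by
  intro t
  simp only [map_swap_apply]
  exact ⟨(h t).1.symm, (h t).2.symm⟩

section flux

variable {μ ν : Measure ℝ} {π : Measure (ℝ × ℝ)}

lemma Marg.flux_right (h : π ∈ Marg μ ν) (t : ℝ) :
    π.real {p | p.1 ≤ t ∧ t < p.2} - π.real {p | p.2 ≤ t ∧ t < p.1} = cdfR μ t - cdfR ν t := by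
  have := h.1
  have h1 : cdfR μ t = π.real {p | p.1 ≤ t} := by
    rw [cdfR, ← h.2.1, map_measureReal_apply measurable_fst measurableSet_Iic]
    rfl
  have h2 : cdfR ν t = π.real {p | p.2 ≤ t} := by
    rw [cdfR, ← h.2.2, map_measureReal_apply measurable_snd measurableSet_Iic]
    rfl
  have m1 : MeasurableSet {p : ℝ × ℝ | p.1 ≤ t} := measurableSet_le measurable_fst measurable_const
  have m2 : MeasurableSet {p : ℝ × ℝ | p.2 ≤ t} := measurableSet_le measurable_snd measurable_const
  have s1 := measureReal_inter_add_sdiff (μ := π) (s := {p : ℝ × ℝ | p.1 ≤ t}) m2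
  have s2 := measureReal_inter_add_sdiff (μ := π) (s := {p : ℝ × ℝ | p.2 ≤ t}) m1
  rw [inter_comm] at s2
  have e1 : {p : ℝ × ℝ | p.1 ≤ t ∧ t < p.2} = {p | p.1 ≤ t} \ {p | p.2 ≤ t} := by
    ext p; simp
  have e2 : {p : ℝ × ℝ | p.2 ≤ t ∧ t < p.1} = {p | p.2 ≤ t} \ {p | p.1 ≤ t} := by
    ext p; simp
  rw [h1, h2, e1, e2]
  linarith

lemma Marg.flux_left (h : π ∈ Marg μ ν) (t : ℝ) :
    π.real {p | p.1 < t ∧ t ≤ p.2} - π.real {p | p.2 < t ∧ t ≤ p.1} = cdfL μ t - cdfL ν t := by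
  have := h.1
  have h1 : cdfL μ t = π.real {p | p.1 < t} := by
    rw [cdfL, ← h.2.1, map_measureReal_apply measurable_fst measurableSet_Iio]
    rfl
  have h2 : cdfL ν t = π.real {p | p.2 < t} := by
    rw [cdfL, ← h.2.2, map_measureReal_apply measurable_snd measurableSet_Iio]
    rfl
  have m1 : MeasurableSet {p : ℝ × ℝ | p.1 < t} := measurableSet_lt measurable_fst measurable_const
  have m2 : MeasurableSet {p : ℝ × ℝ | p.2 < t} := measurableSet_lt measurable_snd measurable_const
  have s1 := measureReal_inter_add_sdiff (μ := π) (s := {p : ℝ × ℝ | p.1 < t}) m2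
  have s2 := measureReal_inter_add_sdiff (μ := π) (s := {p : ℝ × ℝ | p.2 < t}) m1
  rw [inter_comm] at s2
  have e1 : {p : ℝ × ℝ | p.1 < t ∧ t ≤ p.2} = {p | p.1 < t} \ {p | p.2 < t} := by
    ext p; simp
  have e2 : {p : ℝ × ℝ | p.2 < t ∧ t ≤ p.1} = {p | p.2 < t} \ {p | p.1 < t} := by
    ext p; simp
  rw [h1, h2, e1, e2]
  linarith

/-- The difference of distribution functions is the net flux across t. Without crossings one
direction carries nothing, so the flux to the right is its positive part. -/
lemma Marg.measure_right (h : π ∈ Marg μ ν) (hn : NoCross π) (t : ℝ) :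
    π {p | p.1 ≤ t ∧ t < p.2} = ENNReal.ofReal (cdfR μ t - cdfR ν t) := by
  have := h.1
  have hf := Marg.flux_right h t
  rcases (hn t).1 with h0 | h0
  · rw [(measureReal_eq_zero_iff).2 h0, zero_sub] at hf
    rw [h0, ← hf, ENNReal.ofReal_of_nonpos (neg_nonpos.2 measureReal_nonneg)]
  · rw [(measureReal_eq_zero_iff).2 h0, sub_zero] at hf
    rw [← hf, ofReal_measureReal]

lemma Marg.measure_left (h : π ∈ Marg μ ν) (hn : NoCross π) (t : ℝ) :
    π {p | p.1 < t ∧ t ≤ p.2} = ENNReal.ofReal (cdfL μ t - cdfL ν t) := by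
  have := h.1
  have hf := Marg.flux_left h t
  rcases (hn t).2 with h0 | h0
  · rw [(measureReal_eq_zero_iff).2 h0, zero_sub] at hf
    rw [h0, ← hf, ENNReal.ofReal_of_nonpos (neg_nonpos.2 measureReal_nonneg)]
  · rw [(measureReal_eq_zero_iff).2 h0, sub_zero] at hf
    rw [← hf, ofReal_measureReal]

/-- Off E⁺ at least one of the inequalities between the two versions of the distribution functions
fails, and the corresponding flux already contains all strict crossings. -/
lemma Marg.measure_cross (h : π ∈ Marg μ ν) (hn : NoCross π) {t : ℝ} (ht : t ∉ Epos μ ν) :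
    π {p | p.1 < t ∧ t < p.2} = 0 := by
  have h1 := Marg.measure_right h hn t
  have h2 := Marg.measure_left h hn t
  by_cases hR : cdfR ν t < cdfR μ t
  · have hL : ¬ cdfL ν t < cdfL μ t := fun hL => ht ⟨hR, hL⟩
    rw [ENNReal.ofReal_of_nonpos (by linarith)] at h2
    exact measure_mono_null (fun p hp =>
      show p.1 < t ∧ t ≤ p.2 from ⟨hp.1, le_of_lt hp.2⟩) h2
  · rw [ENNReal.ofReal_of_nonpos (by linarith)] at h1
    exact measure_mono_null (fun p hp =>
      show p.1 ≤ t ∧ t < p.2 from ⟨le_of_lt hp.1, hp.2⟩) h1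

/-- Mass is moved to the right within `E⁺` only. -/
lemma Marg.ae_Ioo_subset (h : π ∈ Marg μ ν) (hn : NoCross π) :
    ∀ᵐ p ∂π, p.1 < p.2 → Ioo p.1 p.2 ⊆ Epos μ ν := by
  -- The crossing sets are open in the plane, so by the Lindelöf property countably many null sets
  -- cover their uncountable union.
  obtain ⟨T, hT, hTc, hTU⟩ := TopologicalSpace.isOpen_biUnion_countable (Epos μ ν)ᶜ
    (fun t => {p : ℝ × ℝ | p.1 < t ∧ t < p.2}) fun t _ =>
      (isOpen_lt continuous_fst continuous_const).inter (isOpen_lt continuous_const continuous_snd)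
  have h0 : π (⋃ t ∈ (Epos μ ν)ᶜ, {p : ℝ × ℝ | p.1 < t ∧ t < p.2}) = 0 := by
    rw [← hTU]
    exact (measure_biUnion_null_iff hTc).2 fun t ht => Marg.measure_cross h hn (hT ht)
  filter_upwards [measure_eq_zero_iff_ae_notMem.1 h0] with p hp _ t ht
  by_contra hE
  exact hp (mem_biUnion (x := t) hE ht)

lemma Marg.ae_Ioo_subset' (h : π ∈ Marg μ ν) (hn : NoCross π) :
    ∀ᵐ p ∂π, p.2 < p.1 → Ioo p.2 p.1 ⊆ Eneg μ ν :=
  ae_of_ae_map measurable_swap.aemeasurable (Marg.ae_Ioo_subset (Marg.swap h) hn.swap)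

end flux

/-! ### Components of open sets and cells of the plane -/

/-- `I` is a connected component of the open subset `E` of the line. -/
structure IsComp (E I : Set ℝ) : Prop where
  isOpen : IsOpen I
  ordConnected : OrdConnected I
  nonempty : I.Nonempty
  subset : I ⊆ E
  maximal : ∀ J : Set ℝ, OrdConnected J → J ⊆ E → (J ∩ I).Nonempty → J ⊆ I

lemma isComp_connectedComponentIn {E : Set ℝ} (hE : IsOpen E) {x : ℝ} (hx : x ∈ E) :
    IsComp E (connectedComponentIn E x) where
  isOpen := hE.connectedComponentIn
  ordConnected := isPreconnected_connectedComponentIn.ordConnected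
  nonempty := ⟨x, mem_connectedComponentIn hx⟩
  subset := connectedComponentIn_subset E x
  maximal J hJ hJE := by
    rintro ⟨y, hyJ, hyI⟩
    rw [connectedComponentIn_eq hyI]
    exact hJ.isPreconnected.subset_connectedComponentIn hyJ hJE

lemma isComp_of_mem_comps {E I : Set ℝ} (hE : IsOpen E) (hI : I ∈ comps E) : IsComp E I := by
  obtain ⟨x, hx, rfl⟩ := hI
  exact isComp_connectedComponentIn hE hx

lemma IsComp.eq {E I J : Set ℝ} (hI : IsComp E I) (hJ : IsComp E J) (h : (I ∩ J).Nonempty) :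
    I = J :=
  Subset.antisymm (hJ.maximal I hI.ordConnected hI.subset h)
    (hI.maximal J hJ.ordConnected hJ.subset (inter_comm I J ▸ h))

lemma IsComp.sInf_notMem {E I : Set ℝ} (hI : IsComp E I) (hb : BddBelow I) : sInf I ∉ I := by
  intro h
  obtain ⟨y, hy, hyI⟩ := (mem_nhdsLT_iff_exists_Ioo_subset).1
    (nhdsWithin_le_nhds (hI.isOpen.mem_nhds h) : I ∈ 𝓝[<] (sInf I))
  obtain ⟨z, hz⟩ := exists_between (show y < sInf I from hy)
  exact absurd (csInf_le hb (hyI hz)) (not_le.2 hz.2)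

lemma IsComp.sSup_notMem {E I : Set ℝ} (hI : IsComp E I) (hb : BddAbove I) : sSup I ∉ I := by
  intro h
  obtain ⟨y, hy, hyI⟩ := (mem_nhdsGT_iff_exists_Ioo_subset).1
    (nhdsWithin_le_nhds (hI.isOpen.mem_nhds h) : I ∈ 𝓝[>] (sSup I))
  obtain ⟨z, hz⟩ := exists_between (show sSup I < y from hy)
  exact absurd (le_csSup hb (hyI hz)) (not_le.2 hz.1)

lemma IsComp.lt_of_sInf {E I : Set ℝ} (hI : IsComp E I) (hb : BddBelow I) {s : ℝ} (hs : s ∈ I) :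
    sInf I < s :=
  lt_of_le_of_ne (csInf_le hb hs) fun h => hI.sInf_notMem hb (h ▸ hs)

lemma IsComp.lt_of_sSup {E I : Set ℝ} (hI : IsComp E I) (hb : BddAbove I) {s : ℝ} (hs : s ∈ I) :
    s < sSup I :=
  lt_of_le_of_ne (le_csSup hb hs) fun h => hI.sSup_notMem hb (h ▸ hs)

lemma IsComp.sInf_notMem_base {E I : Set ℝ} (hI : IsComp E I) (hb : BddBelow I) :
    sInf I ∉ E := by
  intro h
  obtain ⟨s, hs⟩ := hI.nonempty
  have hlt := hI.lt_of_sInf hb hs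
  have hsub : Icc (sInf I) s ⊆ E := by
    intro t ht
    rcases ht.1.eq_or_lt with h' | h'
    · exact h' ▸ h
    · obtain ⟨r, hr, hrt⟩ := exists_lt_of_csInf_lt hI.nonempty h'
      exact hI.subset (hI.ordConnected.out hr hs ⟨hrt.le, ht.2⟩)
  exact hI.sInf_notMem hb (hI.maximal _ ordConnected_Icc hsub ⟨s, ⟨hlt.le, le_rfl⟩, hs⟩
    ⟨le_rfl, hlt.le⟩)

lemma IsComp.sSup_notMem_base {E I : Set ℝ} (hI : IsComp E I) (hb : BddAbove I) :
    sSup I ∉ E := by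
  intro h
  obtain ⟨s, hs⟩ := hI.nonempty
  have hlt := hI.lt_of_sSup hb hs
  have hsub : Icc s (sSup I) ⊆ E := by
    intro t ht
    rcases ht.2.eq_or_lt with h' | h'
    · exact h' ▸ h
    · obtain ⟨r, hr, hrt⟩ := exists_lt_of_lt_csSup hI.nonempty h'
      exact hI.subset (hI.ordConnected.out hs hr ⟨ht.1, hrt.le⟩)
  exact hI.sSup_notMem hb (hI.maximal _ ordConnected_Icc hsub ⟨s, ⟨le_rfl, hlt.le⟩, hs⟩
    ⟨hlt.le, le_rfl⟩)

/-- A point to the left of points of `I`, and separated from them by points of `I` only. -/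
lemma IsComp.eq_sInf {E I : Set ℝ} {x y : ℝ} (hI : IsComp E I) (hx : x ∉ I) (hxy : x < y)
    (h : Ioo x y ⊆ I) : BddBelow I ∧ x = sInf I := by
  have hlb : ∀ s ∈ I, x ≤ s := fun s hs => by
    by_contra! hsx
    obtain ⟨z, hz⟩ := exists_between hxy
    exact hx (hI.ordConnected.out hs (h hz) ⟨hsx.le, hz.1.le⟩)
  refine ⟨⟨x, hlb⟩, le_antisymm (le_csInf hI.nonempty hlb) ?_⟩
  refine le_of_forall_gt_imp_ge_of_dense fun z hz => ?_
  obtain ⟨w, hw⟩ := exists_between (lt_min hz hxy)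
  exact (csInf_le ⟨x, hlb⟩ (h ⟨hw.1, hw.2.trans_le (min_le_right _ _)⟩)).trans
    (hw.2.le.trans (min_le_left _ _))

lemma IsComp.eq_sSup {E I : Set ℝ} {x y : ℝ} (hI : IsComp E I) (hy : y ∉ I) (hxy : x < y)
    (h : Ioo x y ⊆ I) : BddAbove I ∧ y = sSup I := by
  have hub : ∀ s ∈ I, s ≤ y := fun s hs => by
    by_contra! hsy
    obtain ⟨z, hz⟩ := exists_between hxy
    exact hy (hI.ordConnected.out (h hz) hs ⟨hz.2.le, hsy.le⟩)
  refine ⟨⟨y, hub⟩, le_antisymm ?_ (csSup_le hI.nonempty hub)⟩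
  refine le_of_forall_lt_imp_le_of_dense fun z hz => ?_
  obtain ⟨w, hw⟩ := exists_between (max_lt hz hxy)
  exact ((le_max_left _ _).trans hw.1.le).trans
    (le_csSup ⟨y, hub⟩ (h ⟨(le_max_right _ _).trans_lt hw.1, hw.2⟩))

/-- The pairs that are joined by a transport to the right within `I`. -/
def cell (I : Set ℝ) : Set (ℝ × ℝ) :=
  {p | p.1 < p.2 ∧ Ioo p.1 p.2 ⊆ I} ∪ {p | p.1 = p.2 ∧ p.1 ∈ I}

lemma measurableSet_cell {I : Set ℝ} (hI : IsOpen I) : MeasurableSet (cell I) := by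
  refine MeasurableSet.union ?_ ?_
  · refine (measurableSet_lt measurable_fst measurable_snd).inter ?_
    have : {p : ℝ × ℝ | Ioo p.1 p.2 ⊆ I} = (⋃ t ∈ Iᶜ, {p : ℝ × ℝ | p.1 < t ∧ t < p.2})ᶜ := by
      ext p
      simp only [mem_ofPred_eq, mem_compl_iff, mem_iUnion, not_exists]
      exact ⟨fun h t ht hp => ht (h hp), fun h t ht => by_contra fun hn => h t hn ht⟩
    change MeasurableSet {p : ℝ × ℝ | Ioo p.1 p.2 ⊆ I}
    rw [this]
    refine (IsOpen.measurableSet ?_).compl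
    exact isOpen_biUnion fun t _ =>
      (isOpen_lt continuous_fst continuous_const).inter (isOpen_lt continuous_const continuous_snd)
  · exact (measurableSet_eq_fun measurable_fst measurable_snd).inter
      (measurable_fst hI.measurableSet)

lemma cell_le {I : Set ℝ} {p : ℝ × ℝ} (hp : p ∈ cell I) : p.1 ≤ p.2 := by
  rcases hp with h | h
  · exact h.1.le
  · exact h.1.le

lemma disjoint_cell {I J : Set ℝ} (h : Disjoint I J) : Disjoint (cell I) (cell J) := by
  rw [Set.disjoint_left] at h ⊢
  rintro p (⟨h1, h2⟩ | ⟨h1, h2⟩) (⟨h3, h4⟩ | ⟨h3, h4⟩)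
  · obtain ⟨z, hz⟩ := exists_between h1
    exact h (h2 hz) (h4 hz)
  · exact h1.ne h3
  · exact h3.ne h1
  · exact h h2 h4

/-- The set of pairs that a plan without crossings may use. -/
def goodPairs (E E' : Set ℝ) : Set (ℝ × ℝ) :=
  {p | (p.1 < p.2 → Ioo p.1 p.2 ⊆ E) ∧ (p.2 < p.1 → Ioo p.2 p.1 ⊆ E')}

lemma exists_mem_Ioo_of_mem_left {I : Set ℝ} (hI : IsOpen I) {t x : ℝ} (ht : t ∈ I)
    (hx : x < t) : ∃ s ∈ I, s ∈ Ioo x t := by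
  obtain ⟨y, hy, hyI⟩ := (mem_nhdsLT_iff_exists_Ioo_subset).1
    (nhdsWithin_le_nhds (hI.mem_nhds ht) : I ∈ 𝓝[<] t)
  obtain ⟨z, hz⟩ := exists_between (max_lt (show y < t from hy) hx)
  exact ⟨z, hyI ⟨(le_max_left _ _).trans_lt hz.1, hz.2⟩, (le_max_right _ _).trans_lt hz.1, hz.2⟩

lemma exists_mem_Ioo_of_mem_right {I : Set ℝ} (hI : IsOpen I) {t x : ℝ} (ht : t ∈ I)
    (hx : t < x) : ∃ s ∈ I, s ∈ Ioo t x := by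
  obtain ⟨y, hy, hyI⟩ := (mem_nhdsGT_iff_exists_Ioo_subset).1
    (nhdsWithin_le_nhds (hI.mem_nhds ht) : I ∈ 𝓝[>] t)
  obtain ⟨z, hz⟩ := exists_between (lt_min (show t < y from hy) hx)
  exact ⟨z, hyI ⟨hz.1, hz.2.trans_le (min_le_left _ _)⟩, hz.1, hz.2.trans_le (min_le_right _ _)⟩

section cells

variable {E E' I : Set ℝ} {p : ℝ × ℝ}

lemma IsComp.mem_cell_of_inter (hI : IsComp E I) (hp : p ∈ goodPairs E E') (h : p.1 < p.2)
    (hn : (Ioo p.1 p.2 ∩ I).Nonempty) : p ∈ cell I :=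
  Or.inl ⟨h, hI.maximal _ ordConnected_Ioo (hp.1 h) hn⟩

/-- Since I is open, a move starting in I passes through further points of I. A move to the left
would then meet E', which is disjoint from E; a move to the right stays in the component by
maximality. -/
lemma IsComp.mem_cell_of_fst (hI : IsComp E I) (hd : Disjoint E E') (hp : p ∈ goodPairs E E')
    (h : p.1 ∈ I) : p ∈ cell I := by
  rcases lt_trichotomy p.1 p.2 with h' | h' | h'
  · obtain ⟨s, hs, hs'⟩ := exists_mem_Ioo_of_mem_right hI.isOpen h h'
    exact hI.mem_cell_of_inter hp h' ⟨s, hs', hs⟩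
  · exact Or.inr ⟨h', h⟩
  · obtain ⟨s, hs, hs'⟩ := exists_mem_Ioo_of_mem_left hI.isOpen h h'
    exact absurd (hp.2 h' hs') (Set.disjoint_left.1 hd (hI.subset hs))

lemma IsComp.mem_cell_of_snd (hI : IsComp E I) (hd : Disjoint E E') (hp : p ∈ goodPairs E E')
    (h : p.2 ∈ I) : p ∈ cell I := by
  rcases lt_trichotomy p.1 p.2 with h' | h' | h'
  · obtain ⟨s, hs, hs'⟩ := exists_mem_Ioo_of_mem_left hI.isOpen h h'
    exact hI.mem_cell_of_inter hp h' ⟨s, hs', hs⟩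
  · exact Or.inr ⟨h', h' ▸ h⟩
  · obtain ⟨s, hs, hs'⟩ := exists_mem_Ioo_of_mem_right hI.isOpen h h'
    exact absurd (hp.2 h' hs') (Set.disjoint_left.1 hd (hI.subset hs))

lemma IsComp.fst_of_mem_cell (hI : IsComp E I) (hp : p ∈ cell I) (h : p.1 ∉ I) :
    p.1 < p.2 ∧ BddBelow I ∧ p.1 = sInf I := by
  rcases hp with ⟨h1, h2⟩ | ⟨h1, h2⟩
  · exact ⟨h1, hI.eq_sInf h h1 h2⟩
  · exact absurd h2 h

lemma IsComp.snd_of_mem_cell (hI : IsComp E I) (hp : p ∈ cell I) (h : p.2 ∉ I) :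
    p.1 < p.2 ∧ BddAbove I ∧ p.2 = sSup I := by
  rcases hp with ⟨h1, h2⟩ | ⟨h1, h2⟩
  · exact ⟨h1, hI.eq_sSup h h1 h2⟩
  · exact absurd (h1 ▸ h2) h

lemma IsComp.mem_cell_of_sInf (hI : IsComp E I) (hp : p ∈ goodPairs E E') (hb : BddBelow I)
    (h : p.1 = sInf I) (hlt : p.1 < p.2) : p ∈ cell I := by
  obtain ⟨s, hs, hs'⟩ := exists_lt_of_csInf_lt hI.nonempty (h ▸ hlt)
  exact hI.mem_cell_of_inter hp hlt ⟨s, ⟨h ▸ hI.lt_of_sInf hb hs, hs'⟩, hs⟩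

lemma IsComp.mem_cell_of_sSup (hI : IsComp E I) (hp : p ∈ goodPairs E E') (hb : BddAbove I)
    (h : p.2 = sSup I) (hlt : p.1 < p.2) : p ∈ cell I := by
  obtain ⟨s, hs, hs'⟩ := exists_lt_of_lt_csSup hI.nonempty (h ▸ hlt)
  exact hI.mem_cell_of_inter hp hlt ⟨s, ⟨hs', h ▸ hI.lt_of_sSup hb hs⟩, hs⟩

/-- A pair whose first point is in `I` or is its left endpoint, and whose second point is in `I`
or is its right endpoint. -/
lemma IsComp.mem_cell (hI : IsComp E I) (h : p.1 ≤ p.2)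
    (h1 : p.1 ∈ I ∨ (BddBelow I ∧ p.1 = sInf I)) (h2 : p.2 ∈ I ∨ (BddAbove I ∧ p.2 = sSup I)) :
    p ∈ cell I := by
  rcases h.eq_or_lt with h | h
  · refine Or.inr ⟨h, ?_⟩
    rcases h1 with h1 | ⟨hb, h1⟩
    · exact h1
    rcases h2 with h2 | ⟨hb', h2⟩
    · exact h ▸ h2
    obtain ⟨s, hs⟩ := hI.nonempty
    have := hI.lt_of_sInf hb hs
    have := hI.lt_of_sSup hb' hs
    linarith
  · refine Or.inl ⟨h, fun t ht => ?_⟩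
    have e1 : ∃ s ∈ I, s ≤ t := by
      rcases h1 with h1 | ⟨hb, h1⟩
      · exact ⟨_, h1, ht.1.le⟩
      · obtain ⟨s, hs, hst⟩ := exists_lt_of_csInf_lt hI.nonempty (h1 ▸ ht.1)
        exact ⟨s, hs, hst.le⟩
    have e2 : ∃ s ∈ I, t ≤ s := by
      rcases h2 with h2 | ⟨hb, h2⟩
      · exact ⟨_, h2, ht.2.le⟩
      · obtain ⟨s, hs, hst⟩ := exists_lt_of_lt_csSup hI.nonempty (h2 ▸ ht.2)
        exact ⟨s, hs, hst.le⟩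
    obtain ⟨s, hs, hst⟩ := e1
    obtain ⟨r, hr, hrt⟩ := e2
    exact hI.ordConnected.out hs hr ⟨hst, hrt⟩

lemma cell_lt {t : ℝ} (ht : ∀ s ∈ I, s < t)
    (hp : p ∈ cell I) : p.1 < t ∧ p.2 ≤ t := by
  rcases hp with ⟨h1, h2⟩ | ⟨h1, h2⟩
  · refine ⟨?_, ?_⟩
    · obtain ⟨z, hz⟩ := exists_between h1
      exact hz.1.trans (ht z (h2 hz))
    · exact le_of_forall_lt_imp_le_of_dense fun z hz => by
        obtain ⟨w, hw⟩ := exists_between (max_lt h1 hz)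
        exact ((le_max_right _ _).trans hw.1.le).trans
          (ht w (h2 ⟨(le_max_left _ _).trans_lt hw.1, hw.2⟩)).le
  · exact ⟨ht _ h2, h1 ▸ (ht _ h2).le⟩

lemma lt_cell {t : ℝ} (ht : ∀ s ∈ I, t < s)
    (hp : p ∈ cell I) : t ≤ p.1 ∧ t < p.2 := by
  rcases hp with ⟨h1, h2⟩ | ⟨h1, h2⟩
  · refine ⟨?_, ?_⟩
    · exact le_of_forall_gt_imp_ge_of_dense fun z hz => by
        obtain ⟨w, hw⟩ := exists_between (lt_min h1 hz)
        exact (ht w (h2 ⟨hw.1, hw.2.trans_le (min_le_left _ _)⟩)).le.trans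
          (hw.2.le.trans (min_le_right _ _))
    · obtain ⟨z, hz⟩ := exists_between h1
      exact (ht z (h2 hz)).trans hz.2
  · exact ⟨(ht _ h2).le, h1 ▸ (ht _ h2)⟩

end cells

lemma disjoint_Epos_Eneg {μ ν : Measure ℝ} : Disjoint (Epos μ ν) (Eneg μ ν) :=
  Set.disjoint_left.2 fun _ h h' => lt_asymm h.1 h'.1

lemma Marg.ae_mem_goodPairs {μ ν : Measure ℝ} {π : Measure (ℝ × ℝ)} (h : π ∈ Marg μ ν)
    (hn : NoCross π) : ∀ᵐ p ∂π, p ∈ goodPairs (Epos μ ν) (Eneg μ ν) := by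
  filter_upwards [Marg.ae_Ioo_subset h hn, Marg.ae_Ioo_subset' h hn] with p h1 h2
  exact ⟨h1, h2⟩

/-! ### The marginals of a plan within a cell -/

section restriction

variable {μ ν : Measure ℝ} {π : Measure (ℝ × ℝ)}

/-- All mass starting in I uses the cell. Outside I only the left endpoint can be a source, and it
emits the flux to the right there: strict crossings of the endpoint are null because it lies outside
E⁺. -/
lemma Marg.map_fst_restrict_cell (h : π ∈ Marg μ ν) (hn : NoCross π) {I : Set ℝ}
    (hI : IsComp (Epos μ ν) I) : (π.restrict (cell I)).map Prod.fst = muPos μ ν I := by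
  have := h.1
  have hgood := Marg.ae_mem_goodPairs h hn
  have hmI := hI.isOpen.measurableSet
  have hc := measurableSet_cell hI.isOpen
  ext A hA
  rw [Measure.map_apply measurable_fst hA, Measure.restrict_apply (measurable_fst hA),
    ← measure_inter_add_sdiff _ (measurable_fst hmI), muPos, Measure.add_apply, add_comm]
  congr 1
  · rw [leftAtom]
    split_ifs with hb
    · rw [Measure.smul_apply, Measure.dirac_apply' _ hA, ← Marg.measure_right h hn, smul_eq_mul]
      by_cases hs : sInf I ∈ A
      · rw [indicator_of_mem hs, Pi.one_apply, mul_one]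
        have hz := Marg.measure_cross h hn (hI.sInf_notMem_base hb)
        refine measure_congr ?_
        filter_upwards [hgood, measure_eq_zero_iff_ae_notMem.1 hz] with p hp hz
        refine propext ⟨fun h' => ?_, fun h' => ?_⟩
        · obtain ⟨h1, -, h2⟩ := hI.fst_of_mem_cell h'.1.2 h'.2
          exact ⟨h2.le, h2 ▸ h1⟩
        · have h2 : p.1 = sInf I := le_antisymm h'.1 (not_lt.1 fun hl => hz ⟨hl, h'.2⟩)
          exact ⟨⟨show p.1 ∈ A from h2 ▸ hs, hI.mem_cell_of_sInf hp hb h2 (h2 ▸ h'.2)⟩,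
            fun h3 => hI.sInf_notMem hb (h2 ▸ h3)⟩
      · rw [indicator_of_notMem hs, mul_zero]
        convert measure_empty (μ := π)
        refine eq_empty_of_forall_notMem ?_
        rintro p ⟨⟨h1, h2⟩, h3⟩
        exact hs ((hI.fst_of_mem_cell h2 h3).2.2 ▸ h1)
    · rw [Measure.coe_zero, Pi.zero_apply]
      convert measure_empty (μ := π)
      refine eq_empty_of_forall_notMem ?_
      rintro p ⟨⟨h1, h2⟩, h3⟩
      exact hb (hI.fst_of_mem_cell h2 h3).2.1
  · rw [Measure.restrict_apply hA]
    conv_rhs => rw [← h.2.1, Measure.map_apply measurable_fst (hA.inter hmI)]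
    refine measure_congr ?_
    filter_upwards [hgood] with p hp
    refine propext ⟨fun h => ⟨h.1.1, h.2⟩, fun h' => ⟨⟨h'.1, ?_⟩, h'.2⟩⟩
    exact hI.mem_cell_of_fst disjoint_Epos_Eneg hp h'.2

/-- Here the right endpoint receives the flux. An arrival at the point itself has to be counted,
hence the left-continuous distribution functions. -/
lemma Marg.map_snd_restrict_cell (h : π ∈ Marg μ ν) (hn : NoCross π) {I : Set ℝ}
    (hI : IsComp (Epos μ ν) I) : (π.restrict (cell I)).map Prod.snd = nuPos μ ν I := by
  have := h.1
  have hgood := Marg.ae_mem_goodPairs h hn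
  have hmI := hI.isOpen.measurableSet
  have hc := measurableSet_cell hI.isOpen
  ext A hA
  rw [Measure.map_apply measurable_snd hA, Measure.restrict_apply (measurable_snd hA),
    ← measure_inter_add_sdiff _ (measurable_snd hmI), nuPos, Measure.add_apply]
  congr 1
  · rw [Measure.restrict_apply hA]
    conv_rhs => rw [← h.2.2, Measure.map_apply measurable_snd (hA.inter hmI)]
    refine measure_congr ?_
    filter_upwards [hgood] with p hp
    refine propext ⟨fun h => ⟨h.1.1, h.2⟩, fun h' => ⟨⟨h'.1, ?_⟩, h'.2⟩⟩
    exact hI.mem_cell_of_snd disjoint_Epos_Eneg hp h'.2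
  · rw [rightAtom]
    split_ifs with hb
    · rw [Measure.smul_apply, Measure.dirac_apply' _ hA, ← Marg.measure_left h hn, smul_eq_mul]
      by_cases hs : sSup I ∈ A
      · rw [indicator_of_mem hs, Pi.one_apply, mul_one]
        have hz := Marg.measure_cross h hn (hI.sSup_notMem_base hb)
        refine measure_congr ?_
        filter_upwards [hgood, measure_eq_zero_iff_ae_notMem.1 hz] with p hp hz
        refine propext ⟨fun h' => ?_, fun h' => ?_⟩
        · obtain ⟨h1, -, h2⟩ := hI.snd_of_mem_cell h'.1.2 h'.2
          exact ⟨h2 ▸ h1, h2.ge⟩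
        · have h2 : p.2 = sSup I := le_antisymm (not_lt.1 fun hl => hz ⟨h'.1, hl⟩) h'.2
          exact ⟨⟨show p.2 ∈ A from h2 ▸ hs, hI.mem_cell_of_sSup hp hb h2 (h2 ▸ h'.1)⟩,
            fun h3 => hI.sSup_notMem hb (h2 ▸ h3)⟩
      · rw [indicator_of_notMem hs, mul_zero]
        convert measure_empty (μ := π)
        refine eq_empty_of_forall_notMem ?_
        rintro p ⟨⟨h1, h2⟩, h3⟩
        exact hs ((hI.snd_of_mem_cell h2 h3).2.2 ▸ h1)
    · rw [Measure.coe_zero, Pi.zero_apply]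
      convert measure_empty (μ := π)
      refine eq_empty_of_forall_notMem ?_
      rintro p ⟨⟨h1, h2⟩, h3⟩
      exact hb (hI.snd_of_mem_cell h2 h3).2.1

/-- The marginals do not depend on the plan, so the pieces in different cells can be optimized, and
replaced, independently. -/
lemma Marg.restrict_cell (h : π ∈ Marg μ ν) (hn : NoCross π) {I : Set ℝ}
    (hI : IsComp (Epos μ ν) I) : π.restrict (cell I) ∈ Marg (muPos μ ν I) (nuPos μ ν I) :=
  have := h.1
  ⟨inferInstance, Marg.map_fst_restrict_cell h hn hI, Marg.map_snd_restrict_cell h hn hI⟩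

end restriction

/-! ### Irreducibility of the component marginals -/

section marginals

variable {μ ν : Measure ℝ} [IsFiniteMeasure μ] [IsFiniteMeasure ν] {π : Measure (ℝ × ℝ)}

lemma eventually_cdf_lt_right {t : ℝ} (h : cdfR ν t < cdfR μ t) :
    ∀ᶠ s in 𝓝[>] t, s ∈ Epos μ ν := by
  obtain ⟨c, hc1, hc2⟩ := exists_between h
  have hν := (tendsto_cdfR_nhdsGT ν t).eventually_lt_const hc1
  filter_upwards [hν, self_mem_nhdsWithin] with s hs hts
  have h1 : c < cdfL μ s := hc2.trans_le (measureReal_mono (Iic_subset_Iio.2 hts))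
  exact ⟨hs.trans (h1.trans_le (cdfL_le_cdfR μ s)), (cdfL_le_cdfR ν s).trans_lt (hs.trans h1)⟩

lemma eventually_cdf_lt_left {t : ℝ} (h : cdfL ν t < cdfL μ t) :
    ∀ᶠ s in 𝓝[<] t, s ∈ Epos μ ν := by
  obtain ⟨c, hc1, hc2⟩ := exists_between h
  have hL := tendsto_cdfR_nhdsLT μ t
  have h2 := hL.eventually_const_lt hc2
  obtain ⟨y, hy, hyI⟩ := mem_nhdsLT_iff_exists_Ioo_subset.1 h2
  filter_upwards [Ioo_mem_nhdsLT (show y < t from hy)] with s hs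
  obtain ⟨r, hr⟩ := exists_between hs.1
  have h1 : c < cdfL μ s := (show c < cdfR μ r from hyI ⟨hr.1, hr.2.trans hs.2⟩).trans_le
    (measureReal_mono (Iic_subset_Iio.2 hr.2))
  have h3 : cdfR ν s ≤ cdfL ν t := measureReal_mono (Iic_subset_Iio.2 hs.2)
  have h4 := cdfL_le_cdfR μ s
  have h5 := cdfL_le_cdfR ν s
  exact ⟨by linarith, by linarith⟩

/-- The right-continuous inequality propagates to the right of t and the left-continuous one to the
left. Requiring both makes the set open. -/
lemma isOpen_Epos : IsOpen (Epos μ ν) := by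
  rw [isOpen_iff_mem_nhds]
  intro t ht
  rw [← nhdsNE_sup_pure, ← nhdsLT_sup_nhdsGT]
  exact ⟨⟨eventually_cdf_lt_left ht.2, eventually_cdf_lt_right ht.1⟩, ht⟩

/-- The quantile coupling exhibits the measure as a marginal of a smaller plan, which avoids
discussing the endpoint mass. -/
lemma muPos_le (hmass : μ univ = ν univ) {I : Set ℝ} (hI : IsComp (Epos μ ν) I) :
    muPos μ ν I ≤ μ := by
  obtain ⟨π, h, hn⟩ := exists_noCross μ ν hmass
  rw [← Marg.map_fst_restrict_cell h hn hI]
  conv_rhs => rw [← h.2.1]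
  exact Measure.map_mono Measure.restrict_le_self measurable_fst

lemma nuPos_le (hmass : μ univ = ν univ) {I : Set ℝ} (hI : IsComp (Epos μ ν) I) :
    nuPos μ ν I ≤ ν := by
  obtain ⟨π, h, hn⟩ := exists_noCross μ ν hmass
  rw [← Marg.map_snd_restrict_cell h hn hI]
  conv_rhs => rw [← h.2.2]
  exact Measure.map_mono Measure.restrict_le_self measurable_snd

/-- At a point of I the restricted plan has the full flux of the quantile coupling, which is
positive because I ⊆ E⁺. At other points the cell lies on one side, and one distribution function is
trivial. -/
lemma Irreducible.of_isComp (hmass : μ univ = ν univ) {I : Set ℝ} (hI : IsComp (Epos μ ν) I) :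
    Irreducible (muPos μ ν I) (nuPos μ ν I) := by
  obtain ⟨π, h, hn⟩ := exists_noCross μ ν hmass
  have hπ := h.1
  have hσ := Marg.restrict_cell h hn hI
  have hgood := Marg.ae_mem_goodPairs h hn
  have hc := measurableSet_cell hI.isOpen
  have hcell : ∀ᵐ p ∂π.restrict (cell I), p ∈ cell I := ae_restrict_mem hc
  have : IsFiniteMeasure (muPos μ ν I) := isFiniteMeasure_of_le μ (muPos_le hmass hI)
  have : IsFiniteMeasure (nuPos μ ν I) := isFiniteMeasure_of_le ν (nuPos_le hmass hI)
  have hmass' : muPos μ ν I univ = nuPos μ ν I univ :=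
    by
    rw [← Marg.univ_eq hσ, ← Marg.univ_eq (Marg.swap hσ), map_swap_apply, preimage_univ]
  have hM : (nuPos μ ν I).real univ = (muPos μ ν I).real univ := by
    simp [measureReal_def, hmass']
  have f1 {A : Set ℝ} (hA : MeasurableSet A) (hs : ∀ p ∈ cell I, p.1 ∈ A) :
      (muPos μ ν I).real A = (muPos μ ν I).real univ := by
    refine measureReal_congr (eventuallyEq_univ.2 ?_)
    change ∀ᵐ x ∂_, x ∈ A
    rw [← hσ.2.1]
    exact (ae_map_iff measurable_fst.aemeasurable hA).2 (hcell.mono hs)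
  have f2 {A : Set ℝ} (hA : MeasurableSet A) (hs : ∀ p ∈ cell I, p.2 ∈ A) :
      (nuPos μ ν I).real A = (muPos μ ν I).real univ := by
    rw [← hM]
    refine measureReal_congr (eventuallyEq_univ.2 ?_)
    change ∀ᵐ x ∂_, x ∈ A
    rw [← hσ.2.2]
    exact (ae_map_iff measurable_snd.aemeasurable hA).2 (hcell.mono hs)
  have z1 {A : Set ℝ} (hA : MeasurableSet A) (hs : ∀ p ∈ cell I, p.1 ∉ A) :
      (muPos μ ν I).real A = 0 := by
    have := f1 hA.compl hs
    rw [measureReal_compl hA] at this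
    linarith
  have z2 {A : Set ℝ} (hA : MeasurableSet A) (hs : ∀ p ∈ cell I, p.2 ∉ A) :
      (nuPos μ ν I).real A = 0 := by
    have := f2 hA.compl hs
    rw [measureReal_compl hA] at this
    linarith
  have trich (t : ℝ) : t ∈ I ∨ (∀ s ∈ I, s < t) ∨ (∀ s ∈ I, t < s) := by
    by_contra! hcon
    obtain ⟨h1, ⟨s, hs, hst⟩, r, hr, hrt⟩ := hcon
    exact h1 (hI.ordConnected.out hr hs ⟨hrt, hst⟩)
  refine ⟨hmass', fun t => ?_, fun t => ?_⟩
  · rcases trich t with ht | ht | ht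
    · left
      have hfl := Marg.flux_right hσ t
      have e1 : (π.restrict (cell I)).real {p | p.2 ≤ t ∧ t < p.1} = 0 := by
        refine (measureReal_eq_zero_iff).2 (measure_eq_zero_iff_ae_notMem.2 ?_)
        filter_upwards [hcell] with p hp hp'
        exact absurd (cell_le hp) (not_le.2 (hp'.1.trans_lt hp'.2))
      have e2 : 0 < (π.restrict (cell I)).real {p | p.1 ≤ t ∧ t < p.2} := by
        rw [measureReal_restrict_apply' hc, measureReal_def, ENNReal.toReal_pos_iff]
        have : π ({p | p.1 ≤ t ∧ t < p.2} ∩ cell I) = π {p | p.1 ≤ t ∧ t < p.2} := by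
          refine measure_congr ?_
          filter_upwards [hgood] with p hp
          refine propext ⟨fun h' => h'.1, fun h' => ⟨h', ?_⟩⟩
          obtain ⟨s, hs, hs'⟩ := exists_mem_Ioo_of_mem_right hI.isOpen ht h'.2
          exact hI.mem_cell_of_inter hp (h'.1.trans_lt h'.2)
            ⟨s, ⟨h'.1.trans_lt hs'.1, hs'.2⟩, hs⟩
        rw [this, Marg.measure_right h hn]
        exact ⟨ENNReal.ofReal_pos.2 (sub_pos.2 (hI.subset ht).1), ENNReal.ofReal_lt_top⟩
      linarith
    · refine Or.inr (Or.inr ⟨?_, ?_⟩)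
      · exact f1 measurableSet_Iic fun p hp => (cell_lt ht hp).1.le
      · exact f2 measurableSet_Iic fun p hp => (cell_lt ht hp).2
    -- Here t may be the left endpoint, where the first marginal can have an atom while the second
    -- has no mass yet.
    · have h0 : cdfR (nuPos μ ν I) t = 0 :=
        z2 measurableSet_Iic fun p hp => not_le.2 (lt_cell ht hp).2
      rcases (cdfR_nonneg (muPos μ ν I) t).eq_or_lt with h' | h'
      · exact Or.inr (Or.inl ⟨h'.symm, h0⟩)
      · exact Or.inl (h0 ▸ h')
  · rcases trich t with ht | ht | ht
    · left
      have hfl := Marg.flux_left hσ t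
      have e1 : (π.restrict (cell I)).real {p | p.2 < t ∧ t ≤ p.1} = 0 := by
        refine (measureReal_eq_zero_iff).2 (measure_eq_zero_iff_ae_notMem.2 ?_)
        filter_upwards [hcell] with p hp hp'
        exact absurd (cell_le hp) (not_le.2 (hp'.1.trans_le hp'.2))
      have e2 : 0 < (π.restrict (cell I)).real {p | p.1 < t ∧ t ≤ p.2} := by
        rw [measureReal_restrict_apply' hc, measureReal_def, ENNReal.toReal_pos_iff]
        have : π ({p | p.1 < t ∧ t ≤ p.2} ∩ cell I) = π {p | p.1 < t ∧ t ≤ p.2} := by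
          refine measure_congr ?_
          filter_upwards [hgood] with p hp
          refine propext ⟨fun h' => h'.1, fun h' => ⟨h', ?_⟩⟩
          obtain ⟨s, hs, hs'⟩ := exists_mem_Ioo_of_mem_left hI.isOpen ht h'.1
          exact hI.mem_cell_of_inter hp (h'.1.trans_le h'.2)
            ⟨s, ⟨hs'.1, hs'.2.trans_le h'.2⟩, hs⟩
        rw [this, Marg.measure_left h hn]
        exact ⟨ENNReal.ofReal_pos.2 (sub_pos.2 (hI.subset ht).2), ENNReal.ofReal_lt_top⟩
      linarith
    · have h0 : cdfL (muPos μ ν I) t = (muPos μ ν I).real univ :=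
        f1 measurableSet_Iio fun p hp => (cell_lt ht hp).1
      rcases (cdfL_le (nuPos μ ν I) t).eq_or_lt with h' | h'
      · exact Or.inr (Or.inr ⟨h0, h'.trans hM⟩)
      · exact Or.inl (h0 ▸ hM ▸ h')
    · refine Or.inr (Or.inl ⟨?_, ?_⟩)
      · exact z1 measurableSet_Iio fun p hp => not_lt.2 (lt_cell ht hp).1
      · exact z2 measurableSet_Iio fun p hp => not_lt.2 (lt_cell ht hp).2.le

end marginals

/-! ### Decomposition of a plan into moving and resting parts -/

lemma countable_comps {E : Set ℝ} (hE : IsOpen E) : (comps E).Countable := by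
  refine Set.PairwiseDisjoint.countable_of_isOpen (s := id) ?_
    (fun I hI => (isComp_of_mem_comps hE hI).isOpen)
    (fun I hI => (isComp_of_mem_comps hE hI).nonempty)
  intro I hI J hJ hne
  refine Set.disjoint_iff_inter_eq_empty.2 (not_nonempty_iff_eq_empty.1 fun h => hne ?_)
  exact (isComp_of_mem_comps hE hI).eq (isComp_of_mem_comps hE hJ) h

lemma exists_isComp {E : Set ℝ} (hE : IsOpen E) {x : ℝ} (hx : x ∈ E) :
    ∃ I : comps E, IsComp E I ∧ x ∈ (I : Set ℝ) :=
  ⟨⟨_, mem_image_of_mem _ hx⟩, isComp_connectedComponentIn hE hx, mem_connectedComponentIn hx⟩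

lemma sum_sumType {S ι κ : Type*} [MeasurableSpace S] (f : ι ⊕ κ → Measure S) :
    Measure.sum f = Measure.sum (fun i => f (Sum.inl i)) + Measure.sum fun j => f (Sum.inr j) := by
  ext A hA
  rw [Measure.add_apply, Measure.sum_apply _ hA, Measure.sum_apply _ hA, Measure.sum_apply _ hA]
  exact ENNReal.summable.tsum_sum ENNReal.summable

section parts

variable (μ ν : Measure ℝ)

/-- The parts of the plane in which a plan without crossings moves mass. -/
def cells : comps (Epos μ ν) ⊕ comps (Eneg μ ν) → Set (ℝ × ℝ)
  | .inl I => cell I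
  | .inr J => Prod.swap ⁻¹' cell (J : Set ℝ)

/-- The part of the plane in which a plan without crossings does not move mass. -/
def restPart : Set (ℝ × ℝ) := (⋃ i, cells μ ν i)ᶜ

variable {μ ν} [IsFiniteMeasure μ] [IsFiniteMeasure ν]

/-- Exchanging the measures is definitional: `Eneg μ ν` is `Epos ν μ`, `muNeg μ ν` is `nuPos ν μ`,
and `nuNeg μ ν` is `muPos ν μ`. So results on transport to the right also cover transport to the
left. -/
lemma isOpen_Eneg : IsOpen (Eneg μ ν) := isOpen_Epos

lemma isComp_pos (I : comps (Epos μ ν)) : IsComp (Epos μ ν) I :=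
  isComp_of_mem_comps isOpen_Epos I.2

lemma isComp_neg (J : comps (Eneg μ ν)) : IsComp (Epos ν μ) J :=
  isComp_of_mem_comps isOpen_Eneg J.2

instance : Countable (comps (Epos μ ν)) := (countable_comps isOpen_Epos).to_subtype

instance : Countable (comps (Eneg μ ν)) := (countable_comps isOpen_Eneg).to_subtype

lemma measurableSet_cells (i : comps (Epos μ ν) ⊕ comps (Eneg μ ν)) :
    MeasurableSet (cells μ ν i) := by
  rcases i with I | J
  · exact measurableSet_cell (isComp_pos I).isOpen
  · exact measurable_swap (measurableSet_cell (isComp_neg J).isOpen)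

lemma disjoint_of_isComp {E : Set ℝ} (hE : IsOpen E) {I J : comps E} (h : I ≠ J) :
    Disjoint (I : Set ℝ) J := by
  refine Set.disjoint_iff_inter_eq_empty.2 (not_nonempty_iff_eq_empty.1 fun h' => h ?_)
  exact Subtype.ext ((isComp_of_mem_comps hE I.2).eq (isComp_of_mem_comps hE J.2) h')

lemma disjoint_cell_swap {I J : Set ℝ} (h : Disjoint I J) :
    Disjoint (cell I) (Prod.swap ⁻¹' cell J) := by
  rw [Set.disjoint_left] at h ⊢
  intro p h1 h2
  have h3 := cell_le h1
  have h4 : p.2 ≤ p.1 := cell_le h2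
  rcases h1 with ⟨h1, -⟩ | ⟨-, h1⟩
  · exact absurd h4 (not_le.2 h1)
  rcases h2 with ⟨h2, -⟩ | ⟨-, h2⟩
  · exact absurd h3 (not_le.2 h2)
  · exact h h1 ((le_antisymm h4 h3 : p.2 = p.1) ▸ (show p.2 ∈ J from h2))

lemma disjoint_pos_neg (I : comps (Epos μ ν)) (J : comps (Eneg μ ν)) :
    Disjoint (I : Set ℝ) J :=
  disjoint_Epos_Eneg.mono (isComp_pos I).subset (isComp_neg J).subset

lemma pairwise_disjoint_cells : Pairwise fun i j => Disjoint (cells μ ν i) (cells μ ν j) := by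
  rintro (I | I) (J | J) h
  · exact disjoint_cell (disjoint_of_isComp isOpen_Epos fun h' => h (congrArg Sum.inl h'))
  · exact disjoint_cell_swap (disjoint_pos_neg I J)
  · exact (disjoint_cell_swap (disjoint_pos_neg J I)).symm
  · exact (disjoint_cell (disjoint_of_isComp isOpen_Eneg
      fun h' => h (congrArg Sum.inr h'))).preimage _

lemma measurableSet_restPart : MeasurableSet (restPart μ ν) :=
  (MeasurableSet.iUnion measurableSet_cells).compl

/-- A pair that moves has a midway point in some component, and maximality puts the pair in that
cell. -/
lemma mem_restPart {p : ℝ × ℝ} (hp : p ∈ goodPairs (Epos μ ν) (Eneg μ ν))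
    (h : p ∈ restPart μ ν) : p.1 = p.2 ∧ p.1 ∈ Eeq μ ν := by
  simp only [restPart, mem_compl_iff, mem_iUnion, not_exists, Sum.forall] at h
  obtain ⟨hpos, hneg⟩ := h
  have h' : p.swap ∈ goodPairs (Epos ν μ) (Eneg ν μ) := ⟨hp.2, hp.1⟩
  have heq : p.1 = p.2 := by
    rcases lt_trichotomy p.1 p.2 with hlt | he | hlt
    · obtain ⟨z, hz⟩ := exists_between hlt
      obtain ⟨I, hI, hzI⟩ := exists_isComp isOpen_Epos (hp.1 hlt hz)
      exact absurd (hI.mem_cell_of_inter hp hlt ⟨z, hz, hzI⟩) (hpos I)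
    · exact he
    · obtain ⟨z, hz⟩ := exists_between hlt
      obtain ⟨I, hI, hzI⟩ := exists_isComp isOpen_Eneg (hp.2 hlt hz)
      exact absurd (IsComp.mem_cell_of_inter hI h' hlt ⟨z, hz, hzI⟩) (hneg I)
  refine ⟨heq, ?_⟩
  rintro (hE | hE)
  · obtain ⟨I, hI, hzI⟩ := exists_isComp isOpen_Epos hE
    exact hpos I (Or.inr ⟨heq, hzI⟩)
  · obtain ⟨I, hI, hzI⟩ := exists_isComp isOpen_Eneg hE
    exact hneg I (Or.inr ⟨heq.symm, show p.2 ∈ (I : Set ℝ) from heq ▸ hzI⟩)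

section decomposition

variable {π : Measure (ℝ × ℝ)}

lemma sum_restrict_cells (π : Measure (ℝ × ℝ)) :
    π = Measure.sum (fun i => π.restrict (cells μ ν i)) + π.restrict (restPart μ ν) := by
  rw [← Measure.restrict_iUnion pairwise_disjoint_cells measurableSet_cells, restPart,
    Measure.restrict_add_restrict_compl (MeasurableSet.iUnion measurableSet_cells)]

lemma restrict_swap (π : Measure (ℝ × ℝ)) {A : Set (ℝ × ℝ)} (hA : MeasurableSet A) :
    (π.map Prod.swap).restrict A = (π.restrict (Prod.swap ⁻¹' A)).map Prod.swap :=
  Measure.restrict_map measurable_swap hA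

lemma Marg.restrict_cell_swap (h : π ∈ Marg μ ν) (hn : NoCross π) (J : comps (Eneg μ ν)) :
    π.restrict (Prod.swap ⁻¹' cell J) ∈ Marg (muNeg μ ν J) (nuNeg μ ν J) := by
  have h' := Marg.swap (Marg.restrict_cell (Marg.swap h) hn.swap (isComp_neg J))
  rw [restrict_swap _ (measurableSet_cell (isComp_neg J).isOpen),
    Measure.map_map measurable_swap measurable_swap, Prod.swap_swap_eq, Measure.map_id] at h'
  exact h'

lemma Marg.ae_restPart (h : π ∈ Marg μ ν) (hn : NoCross π) :
    ∀ᵐ p ∂π.restrict (restPart μ ν), p.1 = p.2 ∧ p.1 ∈ Eeq μ ν := by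
  filter_upwards [ae_restrict_of_ae (Marg.ae_mem_goodPairs h hn),
    ae_restrict_mem measurableSet_restPart] with p hp hp' using mem_restPart hp hp'

lemma Marg.eq_add_map_fst (h : π ∈ Marg μ ν) (hn : NoCross π) :
    μ = muPosSum μ ν + muNegSum μ ν + (π.restrict (restPart μ ν)).map Prod.fst := by
  conv_lhs => rw [← h.2.1, sum_restrict_cells (μ := μ) (ν := ν) π,
    Measure.map_add _ _ measurable_fst, Measure.map_sum measurable_fst.aemeasurable, sum_sumType]
  congr 2
  · exact congrArg _ (funext fun I => Marg.map_fst_restrict_cell h hn (isComp_pos I))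
  · exact congrArg _ (funext fun J => (Marg.restrict_cell_swap h hn J).2.1)

end decomposition

lemma bdryPts_countable : (bdryPts μ ν).Countable := by
  have h := (countable_comps (isOpen_Epos (μ := μ) (ν := ν))).union
    (countable_comps (isOpen_Eneg (μ := μ) (ν := ν)))
  refine ((h.image sInf).union (h.image sSup)).mono ?_
  rintro x ⟨I, hI, ⟨-, rfl⟩ | ⟨-, rfl⟩⟩
  · exact Or.inl (mem_image_of_mem _ hI)
  · exact Or.inr (mem_image_of_mem _ hI)

lemma muPosSum_apply_eq_zero {A : Set ℝ} (hA : MeasurableSet A)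
    (h : A ⊆ (bdryPts μ ν)ᶜ ∩ Eeq μ ν) : muPosSum μ ν A = 0 := by
  rw [muPosSum, Measure.sum_apply _ hA, ENNReal.tsum_eq_zero]
  intro I
  have hI := isComp_pos I
  have h1 : A ∩ I = ∅ := eq_empty_of_forall_notMem fun x hx =>
    (h hx.1).2 (Or.inl (hI.subset hx.2))
  rw [muPos, Measure.add_apply, Measure.restrict_apply hA, h1, measure_empty, add_zero, leftAtom]
  split_ifs with hb
  · have : sInf (I : Set ℝ) ∉ A := fun hx => (h hx).1 ⟨I, Or.inl I.2, Or.inl ⟨hb, rfl⟩⟩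
    simp [Measure.dirac_apply' _ hA, this]
  · simp

lemma muNegSum_apply_eq_zero {A : Set ℝ} (hA : MeasurableSet A)
    (h : A ⊆ (bdryPts μ ν)ᶜ ∩ Eeq μ ν) : muNegSum μ ν A = 0 := by
  rw [muNegSum, Measure.sum_apply _ hA, ENNReal.tsum_eq_zero]
  intro I
  have hI := isComp_neg I
  have h1 : A ∩ I = ∅ := eq_empty_of_forall_notMem fun x hx =>
    (h hx.1).2 (Or.inr (hI.subset hx.2))
  rw [muNeg, Measure.add_apply, Measure.restrict_apply hA, h1, measure_empty, zero_add, rightAtom]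
  split_ifs with hb
  · have : sSup (I : Set ℝ) ∉ A := fun hx => (h hx).1 ⟨I, Or.inr I.2, Or.inr ⟨hb, rfl⟩⟩
    simp [Measure.dirac_apply' _ hA, this]
  · simp

lemma measurableSet_Eeq : MeasurableSet (Eeq μ ν) :=
  (isOpen_Epos.measurableSet.union isOpen_Eneg.measurableSet).compl

/-- The resting mass is found by mass balance. The measures μ⁺ and μ⁻ do not charge E⁼ away from the
endpoints; at each of the countably many endpoints they are subtracted, and finiteness makes the
truncated subtraction exact. -/
lemma Marg.map_fst_restPart {π : Measure (ℝ × ℝ)} (h : π ∈ Marg μ ν) (hn : NoCross π) :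
    (π.restrict (restPart μ ν)).map Prod.fst = muEq μ ν := by
  have := h.1
  set τ := (π.restrict (restPart μ ν)).map Prod.fst with hτ
  have hdec (A : Set ℝ) : μ A = muPosSum μ ν A + muNegSum μ ν A + τ A :=
    congrArg (fun ρ : Measure ℝ => ρ A) (Marg.eq_add_map_fst h hn)
  have hB := bdryPts_countable (μ := μ) (ν := ν)
  have : Countable (bdryPts μ ν) := hB.to_subtype
  have hτE : ∀ᵐ x ∂τ, x ∈ Eeq μ ν := by
    refine (ae_map_iff measurable_fst.aemeasurable measurableSet_Eeq).2 ?_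
    exact (Marg.ae_restPart h hn).mono fun p hp => hp.2
  have e1 : τ.restrict (bdryPts μ ν)ᶜ = μ.restrict ((bdryPts μ ν)ᶜ ∩ Eeq μ ν) := by
    ext A hA
    have hm := (hA.inter (hB.measurableSet.compl.inter (measurableSet_Eeq (μ := μ) (ν := ν))))
    rw [Measure.restrict_apply hA, Measure.restrict_apply hA]
    rw [hdec, muPosSum_apply_eq_zero hm inter_subset_right,
      muNegSum_apply_eq_zero hm inter_subset_right, zero_add, zero_add]
    refine measure_congr ?_
    filter_upwards [hτE] with x hx
    exact propext ⟨fun h' => ⟨h'.1, h'.2, hx⟩, fun h' => ⟨h'.1, h'.2.1⟩⟩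
  have e2 : τ.restrict (bdryPts μ ν) = Measure.sum fun x : bdryPts μ ν =>
      (μ {(x : ℝ)} - muPosSum μ ν {(x : ℝ)} - muNegSum μ ν {(x : ℝ)}) •
        Measure.dirac (x : ℝ) := by
    conv_lhs => rw [← iUnion_of_singleton_coe (bdryPts μ ν)]
    rw [Measure.restrict_iUnion]
    · refine congrArg _ (funext fun x => ?_)
      rw [Measure.restrict_singleton]
      congr 1
      have hx : μ {(x : ℝ)} = muPosSum μ ν {(x : ℝ)} + muNegSum μ ν {(x : ℝ)} + τ {(x : ℝ)} :=
        hdec _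
      have hfin : muPosSum μ ν {(x : ℝ)} + muNegSum μ ν {(x : ℝ)} ≠ ⊤ :=
        ne_top_of_le_ne_top (measure_ne_top μ {(x : ℝ)}) (hx ▸ le_self_add)
      rw [tsub_tsub, hx, ENNReal.add_sub_cancel_left hfin]
    · intro x y hxy
      simpa [Subtype.ext_iff] using hxy
    · exact fun x => measurableSet_singleton _
  rw [muEq, ← e1, ← e2, Measure.restrict_compl_add_restrict hB.measurableSet]

/-- On the diagonal a plan is determined by its first marginal. Hence all plans without crossings
share this part. -/
lemma Marg.restrict_restPart {π : Measure (ℝ × ℝ)} (h : π ∈ Marg μ ν) (hn : NoCross π) :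
    π.restrict (restPart μ ν) = (muEq μ ν).map fun x => (x, x) := by
  rw [← Marg.map_fst_restPart h hn, Measure.map_map (by fun_prop) measurable_fst]
  conv_lhs => rw [← Measure.map_id (μ := π.restrict (restPart μ ν))]
  refine Measure.map_congr ?_
  filter_upwards [Marg.ae_restPart h hn] with p hp
  exact Prod.ext rfl hp.1.symm

end parts

/-! ### Assembling the generalized Kellerer plan -/

lemma planF_spec {γ₁ γ₂ : Measure ℝ} [IsFiniteMeasure γ₁] [IsFiniteMeasure γ₂]
    (H : Irreducible γ₁ γ₂) : planF γ₁ γ₂ ∈ Marg γ₁ γ₂ ∧ IsStronglyMult (planF γ₁ γ₂) := by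
  have h := H.existsUnique_isStronglyMult.exists
  rw [planF, dif_pos h]
  exact h.choose_spec

lemma IsStronglyMult.ae_le {π : Measure (ℝ × ℝ)} (h : IsStronglyMult π) :
    ∀ᵐ p ∂π, p.1 ≤ p.2 := by
  obtain ⟨η₁, η₂, -, -, rfl⟩ := h
  exact ae_restrict_mem measurableSet_halfPlane

lemma ae_muPos {μ ν : Measure ℝ} {I : Set ℝ} (hI : MeasurableSet I) :
    ∀ᵐ x ∂muPos μ ν I, x ∈ I ∨ (BddBelow I ∧ x = sInf I) := by
  rw [muPos, ae_add_measure_iff]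
  refine ⟨?_, (ae_restrict_mem hI).mono fun x hx => Or.inl hx⟩
  rw [leftAtom]
  split_ifs with hb
  · refine Measure.ae_smul_measure ?_ _
    rw [ae_dirac_eq]
    exact Or.inr ⟨hb, rfl⟩
  · simp

lemma ae_nuPos {μ ν : Measure ℝ} {I : Set ℝ} (hI : MeasurableSet I) :
    ∀ᵐ x ∂nuPos μ ν I, x ∈ I ∨ (BddAbove I ∧ x = sSup I) := by
  rw [nuPos, ae_add_measure_iff]
  refine ⟨(ae_restrict_mem hI).mono fun x hx => Or.inl hx, ?_⟩
  rw [rightAtom]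
  split_ifs with hb
  · refine Measure.ae_smul_measure ?_ _
    rw [ae_dirac_eq]
    exact Or.inr ⟨hb, rfl⟩
  · simp

section single

variable {μ ν : Measure ℝ} [IsFiniteMeasure μ] [IsFiniteMeasure ν] {I : Set ℝ}

lemma isFiniteMeasure_muPos (hmass : μ univ = ν univ) (hI : IsComp (Epos μ ν) I) :
    IsFiniteMeasure (muPos μ ν I) := isFiniteMeasure_of_le μ (muPos_le hmass hI)

lemma isFiniteMeasure_nuPos (hmass : μ univ = ν univ) (hI : IsComp (Epos μ ν) I) :
    IsFiniteMeasure (nuPos μ ν I) := isFiniteMeasure_of_le ν (nuPos_le hmass hI)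

lemma existsUnique_of_isComp (hmass : μ univ = ν univ) (hI : IsComp (Epos μ ν) I) :
    ∃! π, π ∈ Marg (muPos μ ν I) (nuPos μ ν I) ∧ IsStronglyMult π := by
  have := isFiniteMeasure_muPos hmass hI
  have := isFiniteMeasure_nuPos hmass hI
  exact (Irreducible.of_isComp hmass hI).existsUnique_isStronglyMult

lemma planF_spec_of_isComp (hmass : μ univ = ν univ) (hI : IsComp (Epos μ ν) I) :
    planF (muPos μ ν I) (nuPos μ ν I) ∈ Marg (muPos μ ν I) (nuPos μ ν I) ∧
      IsStronglyMult (planF (muPos μ ν I) (nuPos μ ν I)) := by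
  have := isFiniteMeasure_muPos hmass hI
  have := isFiniteMeasure_nuPos hmass hI
  exact planF_spec (Irreducible.of_isComp hmass hI)

lemma ae_planF_mem_cell (hmass : μ univ = ν univ) (hI : IsComp (Epos μ ν) I) :
    ∀ᵐ p ∂planF (muPos μ ν I) (nuPos μ ν I), p ∈ cell I := by
  obtain ⟨h, hm⟩ := planF_spec_of_isComp hmass hI
  filter_upwards [hm.ae_le, Marg.ae_fst h (ae_muPos hI.isOpen.measurableSet),
    Marg.ae_snd h (ae_nuPos hI.isOpen.measurableSet)] with p hp h1 h2
  exact hI.mem_cell hp h1 h2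

lemma klDiv_planF_le (hmass : μ univ = ν univ) (hI : IsComp (Epos μ ν) I)
    {π : Measure (ℝ × ℝ)} (h : π ∈ Marg μ ν) (hn : NoCross π) :
    InformationTheory.klDiv (planF (muPos μ ν I) (nuPos μ ν I)) (μ.prod ν) ≤
      InformationTheory.klDiv (π.restrict (cell I)) (μ.prod ν) := by
  have := isFiniteMeasure_muPos hmass hI
  have := isFiniteMeasure_nuPos hmass hI
  obtain ⟨hF, hm⟩ := planF_spec_of_isComp hmass hI
  refine (Irreducible.of_isComp hmass hI).klDiv_le (muPos_le hmass hI) (nuPos_le hmass hI) hF hm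
    (Marg.restrict_cell h hn hI) ?_
  exact (ae_restrict_mem (measurableSet_cell hI.isOpen)).mono fun p hp => cell_le hp

/-- Divergence does not increase under maps, and the swap is its own inverse. -/
lemma klDiv_map_swap (κ : Measure (ℝ × ℝ)) [IsFiniteMeasure κ] :
    InformationTheory.klDiv (κ.map Prod.swap) (ν.prod μ) =
      InformationTheory.klDiv κ (μ.prod ν) := by
  refine le_antisymm ?_ ?_
  · rw [← Measure.prod_swap (μ := μ) (ν := ν)]
    exact InformationTheory.klDiv_map_le _ _ measurable_swap
  · conv_lhs => rw [← Measure.prod_swap (μ := ν) (ν := μ), ← Measure.map_id (μ := κ),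
      ← Prod.swap_swap_eq, ← Measure.map_map measurable_swap measurable_swap]
    exact InformationTheory.klDiv_map_le _ _ measurable_swap

end single

variable {μ ν : Measure ℝ}

/-- The parts of the generalized Kellerer plan that move mass. -/
def planPart (μ ν : Measure ℝ) : comps (Epos μ ν) ⊕ comps (Eneg μ ν) → Measure (ℝ × ℝ)
  | .inl I => planF (muPos μ ν I) (nuPos μ ν I)
  | .inr J => planFswap (muNeg μ ν J) (nuNeg μ ν J)

lemma plan_eq (μ ν : Measure ℝ) :
    plan μ ν = Measure.sum (planPart μ ν) + (muEq μ ν).map fun x => (x, x) := by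
  rw [plan, sum_sumType]
  rfl

variable [IsFiniteMeasure μ] [IsFiniteMeasure ν]

lemma ae_planPart_mem (hmass : μ univ = ν univ) (i : comps (Epos μ ν) ⊕ comps (Eneg μ ν)) :
    ∀ᵐ p ∂planPart μ ν i, p ∈ cells μ ν i := by
  rcases i with I | J
  · exact ae_planF_mem_cell hmass (isComp_pos I)
  · refine (ae_map_iff measurable_swap.aemeasurable (measurableSet_cells (Sum.inr J))).2 ?_
    exact ae_planF_mem_cell hmass.symm (isComp_neg J)

lemma planPart_map (hmass : μ univ = ν univ) {π : Measure (ℝ × ℝ)} (h : π ∈ Marg μ ν)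
    (hn : NoCross π) (i : comps (Epos μ ν) ⊕ comps (Eneg μ ν)) :
    (planPart μ ν i).map Prod.fst = (π.restrict (cells μ ν i)).map Prod.fst ∧
      (planPart μ ν i).map Prod.snd = (π.restrict (cells μ ν i)).map Prod.snd := by
  rcases i with I | J
  · have h1 := (planF_spec_of_isComp hmass (isComp_pos I)).1.2
    have h2 := (Marg.restrict_cell h hn (isComp_pos I)).2
    exact ⟨h1.1.trans h2.1.symm, h1.2.trans h2.2.symm⟩
  · have h1 := (Marg.swap (planF_spec_of_isComp hmass.symm (isComp_neg J)).1).2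
    have h2 := (Marg.restrict_cell_swap h hn J).2
    exact ⟨h1.1.trans h2.1.symm, h1.2.trans h2.2.symm⟩

/-- Start from the quantile coupling and exchange its piece in each cell for one with the same
marginals. -/
lemma plan_mem_Marg (hmass : μ univ = ν univ) : plan μ ν ∈ Marg μ ν := by
  obtain ⟨π, h, hn⟩ := exists_noCross μ ν hmass
  have hp := plan_eq μ ν
  rw [← Marg.restrict_restPart h hn] at hp
  have hs := sum_restrict_cells (μ := μ) (ν := ν) π
  have h1 : (plan μ ν).map Prod.fst = μ := by
    rw [hp, Measure.map_add _ _ measurable_fst, Measure.map_sum measurable_fst.aemeasurable]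
    conv_rhs => rw [← h.2.1]
    conv_rhs => rw [hs]
    rw [Measure.map_add _ _ measurable_fst, Measure.map_sum measurable_fst.aemeasurable]
    simp only [(planPart_map hmass h hn _).1]
  have h2 : (plan μ ν).map Prod.snd = ν := by
    rw [hp, Measure.map_add _ _ measurable_snd, Measure.map_sum measurable_snd.aemeasurable]
    conv_rhs => rw [← h.2.2]
    conv_rhs => rw [hs]
    rw [Measure.map_add _ _ measurable_snd, Measure.map_sum measurable_snd.aemeasurable]
    simp only [(planPart_map hmass h hn _).2]
  refine ⟨⟨?_⟩, h1, h2⟩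
  have : (plan μ ν) univ = μ univ := by
    conv_rhs => rw [← h1]
    rw [Measure.map_apply measurable_fst MeasurableSet.univ, preimage_univ]
  rw [this]
  exact measure_lt_top μ univ

lemma plan_restrict_cells (hmass : μ univ = ν univ)
    (i : comps (Epos μ ν) ⊕ comps (Eneg μ ν)) :
    (plan μ ν).restrict (cells μ ν i) = planPart μ ν i := by
  obtain ⟨π, h, hn⟩ := exists_noCross μ ν hmass
  ext A hA
  rw [Measure.restrict_apply hA, plan_eq, ← Marg.restrict_restPart h hn, Measure.add_apply,
    Measure.sum_apply _ (hA.inter (measurableSet_cells i)),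
    Measure.restrict_apply (hA.inter (measurableSet_cells i)), tsum_eq_single i]
  · have : A ∩ cells μ ν i ∩ restPart μ ν = ∅ := eq_empty_of_forall_notMem fun p hp =>
      hp.2 (mem_iUnion.2 ⟨i, hp.1.2⟩)
    rw [this, measure_empty, add_zero]
    refine measure_congr ?_
    filter_upwards [ae_planPart_mem hmass i] with p hp
    exact propext ⟨fun h' => h'.1, fun h' => ⟨h', hp⟩⟩
  · intro j hj
    refine measure_eq_zero_iff_ae_notMem.2 ?_
    filter_upwards [ae_planPart_mem hmass j] with p hp hp'
    exact Set.disjoint_left.1 (pairwise_disjoint_cells hj) hp hp'.2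

lemma plan_restrict_restPart (hmass : μ univ = ν univ) :
    (plan μ ν).restrict (restPart μ ν) = (muEq μ ν).map fun x => (x, x) := by
  obtain ⟨π, h, hn⟩ := exists_noCross μ ν hmass
  ext A hA
  rw [Measure.restrict_apply hA, plan_eq, ← Marg.restrict_restPart h hn, Measure.add_apply,
    Measure.sum_apply _ (hA.inter measurableSet_restPart), ENNReal.tsum_eq_zero.2, zero_add,
    Measure.restrict_apply (hA.inter measurableSet_restPart), Measure.restrict_apply hA,
    inter_assoc, inter_self]
  intro j
  refine measure_eq_zero_iff_ae_notMem.2 ?_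
  filter_upwards [ae_planPart_mem hmass j] with p hp hp'
  exact hp'.2 (mem_iUnion.2 ⟨j, hp⟩)

lemma cells_subset_goodPairs (i : comps (Epos μ ν) ⊕ comps (Eneg μ ν)) :
    cells μ ν i ⊆ goodPairs (Epos μ ν) (Eneg μ ν) := by
  rcases i with I | J
  · rintro p hp
    refine ⟨fun h => ?_, fun h => absurd h (not_lt.2 (cell_le hp))⟩
    rcases hp with hp | hp
    · exact hp.2.trans (isComp_pos I).subset
    · exact absurd hp.1 h.ne
  · rintro p hp
    refine ⟨fun h => absurd h (not_lt.2 (cell_le hp)), fun h => ?_⟩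
    rcases hp with hp | hp
    · exact hp.2.trans (isComp_neg J).subset
    · exact absurd hp.1 h.ne

lemma ae_plan_mem_goodPairs (hmass : μ univ = ν univ) :
    ∀ᵐ p ∂plan μ ν, p ∈ goodPairs (Epos μ ν) (Eneg μ ν) := by
  obtain ⟨π, h, hn⟩ := exists_noCross μ ν hmass
  rw [plan_eq, ← Marg.restrict_restPart h hn, ae_add_measure_iff, Measure.ae_sum_iff]
  exact ⟨fun i => (ae_planPart_mem hmass i).mono fun p hp => cells_subset_goodPairs i hp,
    ae_restrict_of_ae (Marg.ae_mem_goodPairs h hn)⟩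

/-! ### Cyclical monotonicity and minimality of the plan -/

/-- Along such pairs the cost is a difference of values of u. Its sum does not change when the
targets are shifted cyclically, and the Lipschitz bound applies to the shifted pairs. -/
lemma isCyclicallyMonotone_of_lipschitz {u : ℝ → ℝ} (hu : ∀ x y, u y - u x ≤ |y - x|) :
    IsCyclicallyMonotone {p | u p.2 - u p.1 = |p.2 - p.1|} := by
  intro n p hp
  have hp' (i) : |(p i).2 - (p i).1| = u (p i).2 - u (p i).1 := (hp i).symm
  calc ∑ i, |(p i).2 - (p i).1| = ∑ i, u (p i).2 - ∑ i, u (p i).1 := by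
        simp only [hp', Finset.sum_sub_distrib]
    _ = ∑ i, u (p (i + 1)).2 - ∑ i, u (p i).1 := by
        rw [← Equiv.sum_comp (Equiv.addRight 1) fun i => u (p i).2]
        rfl
    _ ≤ _ := by
        rw [← Finset.sum_sub_distrib]
        exact Finset.sum_le_sum fun i _ => hu _ _

/-- A Kantorovich potential. -/
def potential (E E' : Set ℝ) (t : ℝ) : ℝ :=
  ∫ s in (0 : ℝ)..t, E.indicator 1 s - E'.indicator 1 s

section potential

variable {E E' : Set ℝ}

lemma norm_integrand_le (hd : Disjoint E E') (s : ℝ) :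
    ‖E.indicator (1 : ℝ → ℝ) s - E'.indicator 1 s‖ ≤ 1 := by
  by_cases h : s ∈ E
  · simp [h, Set.disjoint_left.1 hd h]
  · by_cases h' : s ∈ E' <;> simp [h, h']

lemma intervalIntegrable_integrand (hE : IsOpen E) (hE' : IsOpen E') (a b : ℝ) :
    IntervalIntegrable (fun s => E.indicator (1 : ℝ → ℝ) s - E'.indicator 1 s) volume a b := by
  have h1 {A : Set ℝ} (hA : IsOpen A) :
      IntervalIntegrable (A.indicator (1 : ℝ → ℝ)) volume a b := by
    refine intervalIntegrable_iff.2 (IntegrableOn.indicator ?_ hA.measurableSet)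
    exact integrableOn_const (by simp)
  exact (h1 hE).sub (h1 hE')

lemma potential_sub (hE : IsOpen E) (hE' : IsOpen E') (x y : ℝ) :
    potential E E' y - potential E E' x =
      ∫ s in x..y, E.indicator (1 : ℝ → ℝ) s - E'.indicator 1 s :=
  intervalIntegral.integral_interval_sub_left (intervalIntegrable_integrand hE hE' _ _)
    (intervalIntegrable_integrand hE hE' _ _)

lemma potential_sub_le (hE : IsOpen E) (hE' : IsOpen E') (hd : Disjoint E E') (x y : ℝ) :
    potential E E' y - potential E E' x ≤ |y - x| := by
  rw [potential_sub hE hE']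
  have := intervalIntegral.norm_integral_le_of_norm_le_const (a := x) (b := y)
    fun s _ => norm_integrand_le hd s
  rw [one_mul] at this
  exact (le_abs_self _).trans this

lemma continuous_potential (hE : IsOpen E) (hE' : IsOpen E') : Continuous (potential E E') :=
  intervalIntegral.continuous_primitive (intervalIntegrable_integrand hE hE') 0

/-- Between the two points the slope is constantly 1 or constantly −1, according to the direction of
the move. -/
lemma potential_of_mem_goodPairs (hE : IsOpen E) (hE' : IsOpen E') (hd : Disjoint E E')
    {p : ℝ × ℝ} (hp : p ∈ goodPairs E E') :
    potential E E' p.2 - potential E E' p.1 = |p.2 - p.1| := by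
  rw [potential_sub hE hE']
  rcases lt_trichotomy p.1 p.2 with h | h | h
  · rw [abs_of_pos (sub_pos.2 h), intervalIntegral.integral_of_le h.le,
      integral_Ioc_eq_integral_Ioo]
    rw [setIntegral_congr_fun (g := fun _ => (1 : ℝ)) measurableSet_Ioo]
    · simp [h.le]
    · intro s hs
      have h1 := hp.1 h hs
      simp [h1, Set.disjoint_left.1 hd h1]
  · simp [h]
  · rw [abs_of_neg (sub_neg.2 h), intervalIntegral.integral_of_ge h.le,
      integral_Ioc_eq_integral_Ioo]
    rw [setIntegral_congr_fun (g := fun _ => (-1 : ℝ)) measurableSet_Ioo]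
    · simp [h.le]
    · intro s hs
      have h1 := hp.2 h hs
      simp [h1, Set.disjoint_right.1 hd h1]

end potential

lemma plan_mem_cyclMonPlans (hmass : μ univ = ν univ) : plan μ ν ∈ cyclMonPlans μ ν := by
  have hE : IsOpen (Epos μ ν) := isOpen_Epos
  have hE' : IsOpen (Eneg μ ν) := isOpen_Eneg
  -- The Borel set is the equality set of the potential, closed by continuity and containing
  -- `goodPairs`.
  refine ⟨plan_mem_Marg hmass, _, ?_, isCyclicallyMonotone_of_lipschitz
    (potential_sub_le hE hE' disjoint_Epos_Eneg), ?_⟩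
  · have hc := continuous_potential hE hE'
    exact (isClosed_eq (by fun_prop) (by fun_prop)).measurableSet
  · exact (ae_plan_mem_goodPairs hmass).mono fun p hp =>
      potential_of_mem_goodPairs hE hE' disjoint_Epos_Eneg hp

lemma klDiv_plan_le (hmass : μ univ = ν univ) {π : Measure (ℝ × ℝ)} (h : π ∈ Marg μ ν)
    (hn : NoCross π) :
    InformationTheory.klDiv (plan μ ν) (μ.prod ν) ≤ InformationTheory.klDiv π (μ.prod ν) := by
  have hπ := h.1
  have hp := (plan_mem_Marg hmass).1
  refine klDiv_le_of_partition (measurableSet_cells (μ := μ) (ν := ν)) pairwise_disjoint_cells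
    (fun i => ?_) ?_
  · rw [plan_restrict_cells hmass]
    rcases i with I | J
    · exact klDiv_planF_le hmass (isComp_pos I) h hn
    -- For the exchanged measures, transport to the left becomes transport to the right.
    · have hJ := isComp_neg J
      have := (planF_spec_of_isComp hmass.symm hJ).1.1
      have key := klDiv_planF_le hmass.symm hJ (Marg.swap h) hn.swap
      rw [restrict_swap _ (measurableSet_cell hJ.isOpen), klDiv_map_swap] at key
      exact (klDiv_map_swap (planF (muPos ν μ J) (nuPos ν μ J))).le.trans key
  · exact (plan_restrict_restPart hmass).trans (Marg.restrict_restPart h hn).symm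

end Kellerer

end

theorem mainTheorem4 (μ ν : Measure ℝ) [IsFiniteMeasure μ] [IsFiniteMeasure ν]
    (hmass : μ univ = ν univ) (hpos : 0 < μ univ) :
    (∀ I ∈ Kellerer.comps (Kellerer.Epos μ ν),
        ∃! π, π ∈ Kellerer.Marg (Kellerer.muPos μ ν I) (Kellerer.nuPos μ ν I) ∧
          Kellerer.IsStronglyMult π) ∧
    (∀ I ∈ Kellerer.comps (Kellerer.Eneg μ ν),
        ∃! π, π ∈ Kellerer.Marg (Kellerer.nuNeg μ ν I) (Kellerer.muNeg μ ν I) ∧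
          Kellerer.IsStronglyMult π) ∧
    Kellerer.plan μ ν ∈ Kellerer.cyclMonPlans μ ν ∧
    ∀ π ∈ Kellerer.cyclMonPlans μ ν,
      Kellerer.Ent (Kellerer.plan μ ν) (μ.prod ν) ≤ Kellerer.Ent π (μ.prod ν) := by
  refine ⟨fun I hI => ?_, fun J hJ => ?_, Kellerer.plan_mem_cyclMonPlans hmass, fun π hπ => ?_⟩
  · exact Kellerer.existsUnique_of_isComp hmass (Kellerer.isComp_pos ⟨I, hI⟩)
  · exact Kellerer.existsUnique_of_isComp hmass.symm (Kellerer.isComp_neg (μ := μ) ⟨J, hJ⟩)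
  · have := hπ.1.1
    have := (Kellerer.plan_mem_Marg hmass).1
    refine Kellerer.Ent_le_of_klDiv_le ?_
      (Kellerer.klDiv_plan_le hmass hπ.1 (Kellerer.noCross_of_mem_cyclMonPlans hπ))
    rw [Kellerer.Marg.univ_eq (Kellerer.plan_mem_Marg hmass), Kellerer.Marg.univ_eq hπ.1]
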